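/- **Setting.** Let $H_{\mathbb R}$ be a separable real Hilbert space and $H$ its complexification, with inner product $\langle\cdot,\cdot\rangle$ linear in the right and antilinear in the left variable. Let $x\mapsto\bar x$ be a bounded self-adjoint *linear* operator on $H$ with $\bar{\bar x}=x$, let $\alpha,q\in(-1,1)$, and for each $x\in H_{\mathbb R}$ let $T_x$ be a bounded self-adjoint operator on $H$. *Fock space.* Let $\mathcal F=\bigoplus_{n\ge 0}H^{\otimes n}$ (algebraic tensor powers and direct sum), $H^{\otimes 0}=\mathbb C\Omega$. Let $\Sigma(n)$ be the group of bijections $\sigma$ of $\{\pm1,\dots,\pm n\}$ with $\sigma(-k)=-\sigma(k)$, generated by $\pi_0=(1,-1)$ and $\pi_i=(i,i+1)$, $1\le i\le n-1$. It acts on $H^{\otimes n}$ through $$\pi_0(x_1\otimes\cdots\otimes x_n)=\overline{x_1}\otimes x_2\otimes\cdots\otimes x_n,\qquad \pi_i(x_1\otimes\cdots\otimes x_n)=\cdots\otimes x_{i-1}\otimes x_{i+1}\otimes x_i\otimes x_{i+2}\otimes\cdots .$$ Let $l_1(\sigma)$ (resp. $l_2(\sigma)$) be the number of factors $\pi_0$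 (resp. $\pi_i$ with $i\ge1$) in an expression of $\sigma$ of minimal length in these generators. Put $P^{(n)}=\sum_{\sigma\in\Sigma(n)}\alpha^{l_1(\sigma)}q^{l_2(\sigma)}\sigma$ for $n\ge 1$, $P^{(0)}=I$, and equip $\mathcal F$ with the inner product $$\langle x_1\otimes\cdots\otimes x_m,\,y_1\otimes\cdots\otimes y_n\rangle_{\alpha,q}=\langle x_1\otimes\cdots\otimes x_m,\,P^{(n)}(y_1\otimes\cdots\otimes y_n)\rangle_{0,0},\qquad \langle x_1\otimes\cdots\otimes x_m,y_1\otimes\cdots\otimes y_n\rangle_{0,0}=\delta_{m,n}\prod_{i=1}^n\langle x_i,y_i\rangle .$$ Let $\varphi(X)=\langle\Omega,X\Omega\rangle_{\alpha,q}$. *Operators.* For $x\in H$ let $b_{\alpha,q}(x)\Omega=0$ and $$b_{\alpha,q}(x)(x_1\otimes\cdots\otimes x_n)=\sum_{k=1}^n\bigl(q^{n-k}\langle x,x_k\rangle+\alpha q^{n-1}q^{k-1}\langle x,\overline{x_k}\rangle\bigr)\,x_1\otimes\cdots\otimes\check x_k\otimes\cdots\otimes x_n\qquad(n\ge1),$$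 where $\check x_k$ means that $x_k$ is omitted, and let $b^*_{\alpha,q}(x)$ be the adjoint of $b_{\alpha,q}(x)$ on $\mathcal F$ with respect to $\langle\cdot,\cdot\rangle_{\alpha,q}$. For a bounded operator $T$ on $H$ let $p(T)\Omega=0$ and, on $H^{\otimes n}$ with $n\ge1$, $p(T)=p_0(T)R^{(n)}$, where $p_0(T)(x_1\otimes\cdots\otimes x_n)=x_1\otimes\cdots\otimes x_{n-1}\otimes Tx_n$ and $$R^{(n)}=1+\sum_{k=1}^{n-1}q^k\pi_{n-1}\cdots\pi_{n-k}+\alpha q^{n-1}\pi_{n-1}\cdots\pi_1\pi_0\Bigl(1+\sum_{k=1}^{n-1}q^k\pi_1\cdots\pi_k\Bigr).$$ For $x\in H_{\mathbb R}$ and $\lambda\in\mathbb R$ put $\mathcal B^{\lambda}(x)=b_{\alpha,q}(x)+b^*_{\alpha,q}(x)+p(T_x)+\lambda I$ on $\mathcal F$. *Partitions of type B.* For a set partition $\pi$ of $\{1,\dots,n\}$, an arc is a pair $(i,j)$ of elements of the same block such that $j$ is the smallest element of this block greater than $i$. $\mathcal P^B(n)$ is the set of pairs $\pi_f=(\pi,f)$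 where $\pi$ is a set partition of $\{1,\dots,n\}$ and $f$ assigns to each arc a colour $\pm1$ (singletons are not coloured). Let $\mathrm{Narc}(\pi_f)$ be the number of arcs of colour $-1$. Let $\mathrm{rc}(\pi)$ be the number of pairs of arcs $(i,j),(i',j')$ belonging to distinct blocks with $i<i'<j<j'$. Let $\mathrm{rnarc}(\pi_f)$ be the number of pairs of arcs $(i,j),(i',j')$ belonging to distinct blocks with $i<i'<j'<j$ and $f(i',j')=-1$. *Cumulants.* Let $\mathbf x=(x_1,\dots,x_n)\in H_{\mathbb R}^n$ and $\lambda_1,\dots,\lambda_n\in\mathbb R$. For a block $B=\{i_1<\cdots<i_m\}$ of $\pi_f$ put $$K^{\mathbf x}(B)=\lambda_{i_1}\ \text{ if } m=1,\qquad K^{\mathbf x}(B)=\bigl\langle x_{i_m},\,f_{m-1}T_{x_{i_{m-1}}}\cdots f_2T_{x_{i_2}}f_1x_{i_1}\bigr\rangle\ \text{ if } m\ge2,$$ where $f_j$ is the identity if the arc $(i_j,i_{j+1})$ has colour $1$ and is the operator $x\mapsto\bar x$ if it has colour $-1$. **Theorem (Wick formula).** For all $n\ge 0$, $x_1,\dots,x_n\in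 H_{\mathbb R}$ and $\lambda_1,\dots,\lambda_n\in\mathbb R$, $$\varphi\bigl(\mathcal B^{\lambda_n}(x_n)\cdots\mathcal B^{\lambda_1}(x_1)\bigr)=\sum_{\pi_f\in\mathcal P^B(n)}\alpha^{\mathrm{Narc}(\pi_f)}\,q^{\mathrm{rc}(\pi)+2\,\mathrm{rnarc}(\pi_f)}\prod_{B\in\pi}K^{\mathbf x}(B).$$ -/

import Mathlib

open scoped TensorProduct InnerProductSpace ComplexConjugate
open PiTensorProduct (tprod)

noncomputable section

namespace TypeBFock

/-! ## The complexification -/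

/-- `ι : E → H` exhibits the complex inner product space `H` as the complexification
`E ⊕ i E` of the real inner product space `E`. -/
structure IsComplexification {E H : Type*} [NormedAddCommGroup E] [InnerProductSpace ℝ E]
    [NormedAddCommGroup H] [InnerProductSpace ℂ H] (ι : E →ₗ[ℝ] H) : Prop where
  inner_eq : ∀ x y : E, ⟪ι x, ι y⟫_ℂ = ((⟪x, y⟫_ℝ : ℝ) : ℂ)
  exists_eq : ∀ z : H, ∃ x y : E, z = ι x + Complex.I • ι y

/-! ## The hyperoctahedral group and its reduced words -/

/-- The points `±1, …, ±n`: `(k, 1)` stands for `k + 1` and `(k, -1)` for `-(k + 1)`. -/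
abbrev SignedPoint (n : ℕ) : Type := Fin n × ℤˣ

/-- The negation `k ↦ -k` of signed points. -/
def SignedPoint.neg {n : ℕ} (p : SignedPoint n) : SignedPoint n := (p.1, -p.2)

/-- The Coxeter group of type B: bijections `σ` of `{±1, …, ±n}` with `σ (-k) = -σ k`. -/
def hyperoctahedral (n : ℕ) : Subgroup (Equiv.Perm (SignedPoint n)) where
  carrier := {σ | ∀ p, σ p.neg = (σ p).neg}
  mul_mem' {σ τ} hσ hτ p := by simp [hτ p, hσ (τ p)]
  one_mem' p := rfl
  inv_mem' {σ} hσ p := by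
    rw [Equiv.Perm.inv_eq_iff_eq, hσ]
    simp

instance (n : ℕ) : Fintype (hyperoctahedral n) := Fintype.ofFinite _

/-- The generators as permutations of the signed points: `coxeterPerm n 0 = (1, -1)`, and
`coxeterPerm n i = (i, i+1)` (together with `(-i, -(i+1))`) for `1 ≤ i ≤ n - 1`.
Indices outside `0, …, n - 1` are not used and give the identity. -/
def coxeterPerm (n : ℕ) : ℕ → Equiv.Perm (SignedPoint n)
  | 0 => Equiv.prodShear (Equiv.refl (Fin n))
      fun k : Fin n => if k.val = 0 then Equiv.neg ℤˣ else Equiv.refl ℤˣ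
  | i + 1 => if h : i + 1 < n then
      Equiv.prodCongr (Equiv.swap ⟨i, Nat.lt_of_succ_lt h⟩ ⟨i + 1, h⟩) (Equiv.refl ℤˣ) else 1

/-- The word `w = [i₁, …, i_k]` is a reduced (minimal length) expression
`σ = π_{i₁} ⋯ π_{i_k}` in the generators. -/
def IsReducedWord {n : ℕ} (σ : hyperoctahedral n) (w : List (Fin n)) : Prop :=
  (w.map fun i => coxeterPerm n i).prod = (σ : Equiv.Perm (SignedPoint n)) ∧
    ∀ w' : List (Fin n),
      (w'.map fun i => coxeterPerm n i).prod = (σ : Equiv.Perm (SignedPoint n)) →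
        w.length ≤ w'.length

/-- A chosen reduced word of `σ`. -/
def reducedWord {n : ℕ} (σ : hyperoctahedral n) : List (Fin n) :=
  Classical.epsilon (IsReducedWord σ)

/-- `l₁(σ)`: the number of `π₀` in a reduced word of `σ`. -/
def l₁ {n : ℕ} (σ : hyperoctahedral n) : ℕ := (reducedWord σ).countP fun i => i.val = 0

/-- `l₂(σ)`: the number of `π_i`, `1 ≤ i ≤ n - 1`, in a reduced word of `σ`. -/
def l₂ {n : ℕ} (σ : hyperoctahedral n) : ℕ := (reducedWord σ).countP fun i => i.val ≠ 0

/-! ## The algebraic full Fock space -/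

section Fock

variable {H : Type*} [NormedAddCommGroup H] [InnerProductSpace ℂ H]

variable (H) in
/-- The algebraic full Fock space `⨁ₙ H^{⊗ n}`. -/
abbrev Fock : Type _ := DirectSum ℕ fun n => ⨂[ℂ]^n H

variable (H) in
/-- The vacuum vector `Ω`, spanning `H^{⊗ 0}`. -/
def vacuum : Fock H := DirectSum.lof ℂ ℕ (fun n => ⨂[ℂ]^n H) 0 (tprod ℂ Fin.elim0)

/-- The linear functional `y₁ ⊗ ⋯ ⊗ yₙ ↦ ∏ ⟨xᵢ, yᵢ⟩` on `H^{⊗ n}`. -/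
def tensorFunctional {n : ℕ} (x : Fin n → H) : Module.Dual ℂ (⨂[ℂ]^n H) :=
  TensorPower.multilinearMapToDual ℂ H n fun i => (innerₛₗ ℂ (x i))

theorem tensorFunctional_tprod {n : ℕ} (x y : Fin n → H) :
    tensorFunctional x (tprod ℂ y) = ∏ i, ⟪x i, y i⟫_ℂ := by
  simp [tensorFunctional]

theorem tensorFunctional_update_add {n : ℕ} [DecidableEq (Fin n)] (x : Fin n → H) (i : Fin n)
    (u v : H) :
    tensorFunctional (Function.update x i u) + tensorFunctional (Function.update x i v) =
      tensorFunctional (Function.update x i (u + v)) := by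
  refine PiTensorProduct.ext (MultilinearMap.ext fun y => ?_)
  simp only [LinearMap.compMultilinearMap_apply, LinearMap.add_apply, tensorFunctional_tprod]
  have key : ∀ w : H, ∏ j, ⟪Function.update x i w j, y j⟫_ℂ =
      ⟪w, y i⟫_ℂ * ∏ j ∈ Finset.univ.erase i, ⟪x j, y j⟫_ℂ := by
    intro w
    rw [← Finset.mul_prod_erase _ _ (Finset.mem_univ i), Function.update_self]
    congr 1
    refine Finset.prod_congr rfl fun j hj => ?_
    rw [Function.update_of_ne (Finset.ne_of_mem_erase hj)]
  rw [key, key, key, inner_add_left, add_mul]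

theorem tensorFunctional_update_smul {n : ℕ} [DecidableEq (Fin n)] (x : Fin n → H) (i : Fin n)
    (c : ℂ) :
    tensorFunctional (Function.update x i (c • x i)) = conj c • tensorFunctional x := by
  refine PiTensorProduct.ext (MultilinearMap.ext fun y => ?_)
  simp only [LinearMap.compMultilinearMap_apply, LinearMap.smul_apply, tensorFunctional_tprod]
  rw [← Finset.mul_prod_erase _ _ (Finset.mem_univ i), Function.update_self,
    ← Finset.mul_prod_erase _ (fun j => ⟪x j, y j⟫_ℂ) (Finset.mem_univ i), inner_smul_left,
    smul_eq_mul, mul_assoc]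
  congr 2
  refine Finset.prod_congr rfl fun j hj => ?_
  rw [Function.update_of_ne (Finset.ne_of_mem_erase hj)]

variable (H) in
/-- The additive map underlying `tensorForm`. -/
def tensorFormAux (n : ℕ) : (⨂[ℂ]^n H) →+ Module.Dual ℂ (⨂[ℂ]^n H) :=
  PiTensorProduct.liftAddHom (fun p => conj p.1 • tensorFunctional p.2)
    (fun r f i hf => by
      have h := tensorFunctional_update_smul f i 0
      rw [zero_smul, map_zero, zero_smul, ← hf, Function.update_eq_self] at h
      simp [h])
    (fun f => by simp)
    (fun r f i u v => by rw [← smul_add, tensorFunctional_update_add])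
    (fun r r' f => by rw [map_add, add_smul])
    (fun r f i r' => by
      rw [tensorFunctional_update_smul, smul_smul, map_mul, mul_comm])

theorem tensorFormAux_smul_tprod (n : ℕ) (c : ℂ) (x : Fin n → H) :
    tensorFormAux H n (c • tprod ℂ x) = conj c • tensorFunctional x := by
  rw [← PiTensorProduct.tprodCoeff_eq_smul_tprod]
  exact (AddCon.lift_coe _ _).trans (FreeAddMonoid.lift_eval_of _ _)

variable (H) in
/-- The inner product `⟨·,·⟩_{0,0}` on `H^{⊗ n}`, antilinear in the first variable. -/
def tensorForm (n : ℕ) : (⨂[ℂ]^n H) →ₗ⋆[ℂ] (⨂[ℂ]^n H) →ₗ[ℂ] ℂ where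
  toFun := tensorFormAux H n
  map_add' := map_add _
  map_smul' c u := by
    induction u using PiTensorProduct.induction_on with
    | smul_tprod r x =>
      rw [smul_smul, tensorFormAux_smul_tprod, tensorFormAux_smul_tprod, map_mul, smul_smul]
    | add u v hu hv => rw [smul_add, map_add, hu, hv, map_add, smul_add]

theorem tensorForm_tprod {n : ℕ} (x y : Fin n → H) :
    tensorForm H n (tprod ℂ x) (tprod ℂ y) = ∏ i, ⟪x i, y i⟫_ℂ := by
  have h := tensorFormAux_smul_tprod n 1 x
  rw [one_smul, map_one, one_smul] at h
  change tensorFormAux H n (tprod ℂ x) (tprod ℂ y) = _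
  rw [h, tensorFunctional_tprod]

/-! ## The type B symmetrization and the deformed inner product

Here `J : H →L[ℂ] H` is the involution `x ↦ x̄`. -/

/-- The action of the generators on `H^{⊗ n}`: `π₀` applies the involution to the first tensor
factor, and `π_i` exchanges the factors number `i` and `i + 1`, for `1 ≤ i ≤ n - 1`.
Indices outside `0, …, n - 1` are not used and give the identity. -/
def coxeterOp (J : H →L[ℂ] H) (n : ℕ) : ℕ → Module.End ℂ (⨂[ℂ]^n H)
  | 0 => PiTensorProduct.map fun k : Fin n => if k.val = 0 then J.toLinearMap else LinearMap.id
  | i + 1 => if h : i + 1 < n then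
      (PiTensorProduct.reindex ℂ (fun _ : Fin n => H)
        (Equiv.swap ⟨i, Nat.lt_of_succ_lt h⟩ ⟨i + 1, h⟩)).toLinearMap else 1

/-- The action of `σ` on `H^{⊗ n}`, through its expression in the generators. -/
def signedPermOp (J : H →L[ℂ] H) {n : ℕ} (σ : hyperoctahedral n) : Module.End ℂ (⨂[ℂ]^n H) :=
  ((reducedWord σ).map fun i => coxeterOp J n i).prod

/-- The type B symmetrization operator `P^{(n)} = ∑_σ α^{l₁(σ)} q^{l₂(σ)} σ` on `H^{⊗ n}`. -/
def symmetrization (α q : ℝ) (J : H →L[ℂ] H) (n : ℕ) : Module.End ℂ (⨂[ℂ]^n H) :=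
  ∑ σ : hyperoctahedral n, ((α : ℂ) ^ l₁ σ * (q : ℂ) ^ l₂ σ) • signedPermOp J σ

/-- The deformed inner product `⟨u, v⟩_{α,q} = ∑ₙ ⟨uₙ, P^{(n)} vₙ⟩_{0,0}` on the Fock space. -/
def deformedInner (α q : ℝ) (J : H →L[ℂ] H) (u v : Fock H) : ℂ :=
  DirectSum.toAddMonoid (γ := Fock H →ₗ[ℂ] ℂ) (fun n => AddMonoidHom.mk'
    (fun a : ⨂[ℂ]^n H => tensorForm H n a ∘ₗ symmetrization α q J n ∘ₗ
      DirectSum.component ℂ ℕ (fun n => ⨂[ℂ]^n H) n)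
    (fun a b => by rw [map_add, LinearMap.add_comp])) u v

/-- The vacuum state `φ(X) = ⟨Ω, X Ω⟩_{α,q}`. -/
def vacuumState (α q : ℝ) (J : H →L[ℂ] H) (X : Module.End ℂ (Fock H)) : ℂ :=
  deformedInner α q J (vacuum H) (X (vacuum H))

/-! ## Annihilation, creation and gauge operators -/

/-- `x₁ ⊗ ⋯ ⊗ x_{m+1} ↦ g(x_k) x₁ ⊗ ⋯ ⊗ x̌_k ⊗ ⋯ ⊗ x_{m+1}`. -/
def contract {m : ℕ} (k : Fin (m + 1)) (g : H →ₗ[ℂ] ℂ) : (⨂[ℂ]^(m + 1) H) →ₗ[ℂ] ⨂[ℂ]^m H :=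
  PiTensorProduct.lift (MultilinearMap.mk' (fun x => g (x k) • tprod ℂ (k.removeNth x))
    (fun x i u v => by
      rcases Fin.eq_self_or_eq_succAbove k i with rfl | ⟨j, rfl⟩
      · simp [add_smul]
      · simp [Fin.removeNth_update_succAbove, (Fin.succAbove_ne k j).symm])
    (fun x i c u => by
      rcases Fin.eq_self_or_eq_succAbove k i with rfl | ⟨j, rfl⟩
      · simp [mul_smul]
      · simp [Fin.removeNth_update_succAbove, (Fin.succAbove_ne k j).symm, smul_comm c]))

theorem contract_tprod {m : ℕ} (k : Fin (m + 1)) (g : H →ₗ[ℂ] ℂ) (x : Fin (m + 1) → H) :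
    contract k g (tprod ℂ x) = g (x k) • tprod ℂ (k.removeNth x) := by
  simp [contract]

/-- `r_q(x)`: on `H^{⊗ n}`, with `n = m + 1`, it is
`∑_{k=1}^n q^{n-k} ⟨x, x_k⟩ x₁ ⊗ ⋯ ⊗ x̌_k ⊗ ⋯ ⊗ xₙ`; here `k` counts from `0`. -/
def rightAnnihilation (q : ℝ) (x : H) : Module.End ℂ (Fock H) :=
  DirectSum.toModule ℂ ℕ (Fock H) fun n => match n with
    | 0 => 0
    | m + 1 => DirectSum.lof ℂ ℕ (fun n => ⨂[ℂ]^n H) m ∘ₗ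
        ∑ k : Fin (m + 1), (q : ℂ) ^ (m - k.val) • contract k (innerₛₗ ℂ x)

/-- `ℓ^N_q(x)`: on `H^{⊗ n}`, with `n = m + 1`, it is
`q^{n-1} ∑_{k=1}^n q^{k-1} ⟨x, x̄_k⟩ x₁ ⊗ ⋯ ⊗ x̌_k ⊗ ⋯ ⊗ xₙ`; here `k` counts from `0`. -/
def leftAnnihilation (q : ℝ) (J : H →L[ℂ] H) (x : H) : Module.End ℂ (Fock H) :=
  DirectSum.toModule ℂ ℕ (Fock H) fun n => match n with
    | 0 => 0
    | m + 1 => DirectSum.lof ℂ ℕ (fun n => ⨂[ℂ]^n H) m ∘ₗ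
        ((q : ℂ) ^ m • ∑ k : Fin (m + 1),
          (q : ℂ) ^ k.val • contract k (innerₛₗ ℂ x ∘ₗ J.toLinearMap))

/-- The annihilation operator of type B, `b_{α,q}(x) = r_q(x) + α ℓ^N_q(x)`. -/
def annihilation (α q : ℝ) (J : H →L[ℂ] H) (x : H) : Module.End ℂ (Fock H) :=
  rightAnnihilation q x + (α : ℂ) • leftAnnihilation q J x

/-- The creation operator of type B: the adjoint of `b_{α,q}(x)` for the deformed inner product
on the Fock space (which is unique, as this is an inner product for `-1 < α, q < 1`). -/
def creation (α q : ℝ) (J : H →L[ℂ] H) (x : H) : Module.End ℂ (Fock H) :=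
  Classical.epsilon fun A : Module.End ℂ (Fock H) => ∀ u v : Fock H,
    deformedInner α q J (A u) v = deformedInner α q J u (annihilation α q J x v)

/-- The operator `R^{(n)}_{α,q}` on `H^{⊗ n}`, for `n = m + 1`:
`1 + ∑_{k=1}^{n-1} q^k π_{n-1} ⋯ π_{n-k}
  + α q^{n-1} π_{n-1} π_{n-2} ⋯ π₁ π₀ (1 + ∑_{k=1}^{n-1} q^k π₁ ⋯ π_k)`. -/
def Rop (α q : ℝ) (J : H →L[ℂ] H) (m : ℕ) : Module.End ℂ (⨂[ℂ]^(m + 1) H) :=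
  1 + ∑ k ∈ Finset.Icc 1 m,
      (q : ℂ) ^ k • ((List.range k).map fun j => coxeterOp J (m + 1) (m - j)).prod
    + ((α : ℂ) * (q : ℂ) ^ m) •
      (((List.range (m + 1)).map fun j => coxeterOp J (m + 1) (m - j)).prod *
        (1 + ∑ k ∈ Finset.Icc 1 m,
          (q : ℂ) ^ k • ((List.range k).map fun j => coxeterOp J (m + 1) (j + 1)).prod))

/-- The gauge operator `p(T)`: zero on the vacuum, and `p₀(T) R^{(n)}_{α,q}` on `H^{⊗ n}` for
`n = m + 1`, where `p₀(T)` applies `T` to the last tensor factor. -/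
def gauge (α q : ℝ) (J T : H →L[ℂ] H) : Module.End ℂ (Fock H) :=
  DirectSum.toModule ℂ ℕ (Fock H) fun n => match n with
    | 0 => 0
    | m + 1 => DirectSum.lof ℂ ℕ (fun n => ⨂[ℂ]^n H) (m + 1) ∘ₗ
        PiTensorProduct.map
          (fun k : Fin (m + 1) => if k = Fin.last m then T.toLinearMap else LinearMap.id) ∘ₗ
        Rop α q J m

/-- The operator of type B, `b_{α,q}(x) + b*_{α,q}(x) + p(T) + λ I`. -/
def typeBOp (α q : ℝ) (J : H →L[ℂ] H) (x : H) (T : H →L[ℂ] H) (lam : ℝ) :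
    Module.End ℂ (Fock H) :=
  annihilation α q J x + creation α q J x + gauge α q J T + (lam : ℂ) • 1

end Fock

/-! ## Partitions of type B and their statistics -/

/-- The arcs of a block `B`: pairs `(i, j)` in `B` such that `j` is the smallest element of `B`
greater than `i`. -/
def blockArcs {n : ℕ} (B : Finset (Fin n)) : Finset (Fin n × Fin n) :=
  Finset.univ.filter fun a =>
    a.1 ∈ B ∧ a.2 ∈ B ∧ a.1 < a.2 ∧ ∀ k ∈ B, a.1 < k → a.2 ≤ k

/-- The arcs of a set partition. -/
def arcs {n : ℕ} (π : Finpartition (Finset.univ : Finset (Fin n))) : Finset (Fin n × Fin n) :=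
  π.parts.biUnion blockArcs

/-- The set `P^B(n)`: set partitions of an `n`-element chain with a colouring of the arcs by
`±1`. (Singletons all carry the colour `1`, which is not recorded.) -/
abbrev PartitionB (n : ℕ) : Type :=
  Σ π : Finpartition (Finset.univ : Finset (Fin n)), ({a // a ∈ arcs π} → ℤˣ)

namespace PartitionB

variable {n : ℕ} (πf : PartitionB n)

/-- The colour of an arc (with the unused value `1` on pairs that are not arcs). -/
def color (a : Fin n × Fin n) : ℤˣ := if h : a ∈ arcs πf.1 then πf.2 ⟨a, h⟩ else 1

/-- The arc `V` crosses the arc `W`. -/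
def Crosses (V W : Fin n × Fin n) : Prop :=
  (V.1 < W.1 ∧ W.1 < V.2 ∧ V.2 < W.2) ∨ (W.1 < V.1 ∧ V.1 < W.2 ∧ W.2 < V.2)

/-- The arc `V` nests the arc `W`. -/
def Nests (V W : Fin n × Fin n) : Prop :=
  (V.1 < W.1 ∧ W.1 < V.2) ∧ (V.1 < W.2 ∧ W.2 < V.2)

/-- The pairs `(B, B')` of distinct blocks, ordered by their last elements. Singletons
need not be removed, since they have no arcs. -/
def blockPairs : Finset (Finset (Fin n) × Finset (Fin n)) :=
  (πf.1.parts ×ˢ πf.1.parts).filter fun p => p.1.max < p.2.max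

open Classical in
/-- The number of restricted crossings. -/
def rc : ℕ :=
  ∑ p ∈ πf.blockPairs, ((blockArcs p.1 ×ˢ blockArcs p.2).filter fun a => Crosses a.1 a.2).card

open Classical in
/-- The number of restricted negative nestings. -/
def rnarc : ℕ :=
  ∑ p ∈ πf.blockPairs, ((blockArcs p.1 ×ˢ blockArcs p.2).filter fun a =>
    (Nests a.1 a.2 ∧ πf.color a.2 = -1) ∨ (Nests a.2 a.1 ∧ πf.color a.1 = -1)).card

/-- The number of negative arcs. -/
def narc : ℕ := ((arcs πf.1).filter fun a => πf.color a = -1).card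

section Cumulant

variable {H : Type*} [NormedAddCommGroup H] [InnerProductSpace ℂ H]

/-- The colour operator of an arc: the identity for colour `1`, the involution for `-1`. -/
def colorOp (J : H →L[ℂ] H) (a : Fin n × Fin n) (v : H) : H :=
  if πf.color a = -1 then J v else v

/-- For `i₁ < ⋯ < i_k`, listed as `[i_k, …, i₁]`, the vector
`T_{i_k} f_{k-1} ⋯ f₂ T_{i₂} f₁ x_{i₁}` with `f_j` the colour operator of `(i_j, i_{j+1})`. -/
def chain (J : H →L[ℂ] H) (x : Fin n → H) (T : Fin n → H →L[ℂ] H) : List (Fin n) → H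
  | [] => 0
  | [i] => x i
  | j :: i :: l => T j (πf.colorOp J (i, j) (chain J x T (i :: l)))

/-- The deformed cumulant of a block `B = {i₁ < ⋯ < i_m}` of `π_f`: `λ_{i₁}` if `m = 1`, and
`⟨x_{i_m}, f_{m-1} T_{i_{m-1}} ⋯ f₂ T_{i₂} f₁ x_{i₁}⟩` if `m ≥ 2`. The elements of the block are
listed in decreasing order. -/
def cumulant (J : H →L[ℂ] H) (x : Fin n → H) (T : Fin n → H →L[ℂ] H) (lam : Fin n → ℝ)
    (B : Finset (Fin n)) : ℂ :=
  match B.sort (· ≥ ·) with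
  | [] => 1
  | [i] => (lam i : ℂ)
  | j :: i :: l => ⟪x j, πf.colorOp J (i, j) (πf.chain J x T (i :: l))⟫_ℂ

end Cumulant

end PartitionB

end TypeBFock

end

noncomputable section

namespace TypeBFock

/-! ## Lengths in the hyperoctahedral group -/

/-! The formula comes from letting the operators act on the vacuum one after another and recording,
for each basis tensor produced, which blocks of a partition are still open. Three facts make this
work.

The first is algebraic. Every element of `Σ(m+1)` is uniquely `σ c_p`, where `σ ∈ Σ(m)` and `c_p`
moves the signed point `p` to the last place; both length functions are additive in this
decomposition. Hence `P^{(m+1)} = (P^{(m)} ⊗ 1) R^{(m+1)}` (`symmetrization_succ`). Additivity is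
proved by identifying `l₁` and `l₂` with explicit inversion counts (`redWord_spec`). The operator
`R` is the weighted sum over all ways of selecting a factor, possibly applying the involution to it,
and moving it to the end (`Rop_tprod`). Consequently `b(x)` is `R` followed by contraction of the
last factor with `x`, and `u ↦ u ⊗ x` is an adjoint of it (`deformedInner_rightCreation`).

The second concerns the creation operator, which is only some chosen adjoint. It can differ from `u
↦ u ⊗ x` only by vectors in the radical of the form. All the operators involved have adjoints, so
they preserve the radical, and the vacuum state does not see the difference (`vacuumState_typeBOp`).
Positivity of the form is not needed.

The third is combinatorial. Label each tensor factor by the current last element of an open block.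
At step `k`, the term `λ` makes `k` a singleton, creation opens a block, annihilation closes a block
by an arc `(i, k)`, and the gauge operator continues a block by such an arc. An arc of colour `1`
has weight `q^a` and one of colour `-1` has weight `α q^(a + 2b)`, where `a` and `b` count the open
labels above and below `i`. Unrolling the recursion gives a sum over arc diagrams (`wick_from`),
which are the same as partitions of type B (`sum_valid_eq`). The open labels above `i` are the left
ends of the arcs that cross `(i, k)` and end later; those below `i` belong to the arcs that cover it
(`above_eq`, `below_eq`). The exponents therefore add up to `rc + 2 rnarc`. -/

theorem coxeterPerm_zero_apply {n : ℕ} (p : SignedPoint n) :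
    coxeterPerm n 0 p = (p.1, if p.1.val = 0 then -p.2 else p.2) := by
  rcases p with ⟨k, e⟩
  simp only [coxeterPerm, Equiv.prodShear_apply, Equiv.refl_apply]
  split_ifs <;> simp

theorem coxeterPerm_succ_apply {n i : ℕ} (h : i + 1 < n) (p : SignedPoint n) :
    coxeterPerm n (i + 1) p =
      (Equiv.swap (⟨i, Nat.lt_of_succ_lt h⟩ : Fin n) ⟨i + 1, h⟩ p.1, p.2) := by
  rcases p with ⟨k, e⟩
  simp [coxeterPerm, h]

theorem coxeterPerm_mem (n i : ℕ) : coxeterPerm n i ∈ hyperoctahedral n := by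
  intro p
  cases i with
  | zero =>
    simp only [coxeterPerm_zero_apply, SignedPoint.neg]
    split_ifs <;> simp
  | succ i =>
    by_cases h : i + 1 < n
    · simp [coxeterPerm_succ_apply h, SignedPoint.neg]
    · simp [coxeterPerm, h]

theorem coxeterPerm_mul_self (n i : ℕ) : coxeterPerm n i * coxeterPerm n i = 1 := by
  ext1 p
  rw [Equiv.Perm.mul_apply, Equiv.Perm.one_apply]
  cases i with
  | zero =>
    rcases p with ⟨k, e⟩
    simp only [coxeterPerm_zero_apply]
    split_ifs <;> simp
  | succ i =>
    by_cases h : i + 1 < n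
    · simp [coxeterPerm_succ_apply h]
    · simp [coxeterPerm, h]

/-- The product of a word in the generators. -/
def wordPerm (n : ℕ) (w : List ℕ) : Equiv.Perm (SignedPoint n) := (w.map (coxeterPerm n)).prod

theorem wordPerm_mem (n : ℕ) (w : List ℕ) : wordPerm n w ∈ hyperoctahedral n :=
  list_prod_mem (by
    intro σ hσ
    obtain ⟨i, -, rfl⟩ := List.mem_map.1 hσ
    exact coxeterPerm_mem n i)

theorem wordPerm_reverse (n : ℕ) (w : List ℕ) : wordPerm n w.reverse = (wordPerm n w)⁻¹ := by
  induction w with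
  | nil => simp [wordPerm]
  | cons i w ih =>
    have h : coxeterPerm n i = (coxeterPerm n i)⁻¹ :=
      eq_inv_of_mul_eq_one_left (coxeterPerm_mul_self n i)
    simp only [wordPerm, List.reverse_cons, List.map_append, List.prod_append, List.map_cons,
      List.prod_cons, mul_inv_rev, List.map_nil, List.prod_nil, mul_one] at ih ⊢
    rw [ih, ← h]

theorem apply_snd_neg_one {n : ℕ} {σ : Equiv.Perm (SignedPoint n)} (hσ : σ ∈ hyperoctahedral n)
    (k : Fin n) : σ (k, -1) = (σ (k, 1)).neg :=
  hσ (k, 1)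

/-- The signed integer represented by a signed point. -/
def signedVal {n : ℕ} (p : SignedPoint n) : ℤ := (p.2 : ℤ) * (p.1.val + 1)

theorem signedVal_neg {n : ℕ} (p : SignedPoint n) : signedVal p.neg = - signedVal p := by
  simp [signedVal, SignedPoint.neg]

/-- The number of negative values of a signed permutation on positive points. -/
def negCount {n : ℕ} (σ : Equiv.Perm (SignedPoint n)) : ℕ :=
  ∑ k, if (σ (k, 1)).2 = -1 then 1 else 0

/-- The contribution of a pair of values to the number of inversions of type B. -/
def pairInv {n : ℕ} (a b : SignedPoint n) : ℕ :=
  (if signedVal b < signedVal a then 1 else 0) + (if signedVal a + signedVal b < 0 then 1 else 0)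

/-- The number of inversions of type B that are not sign changes. -/
def pairCount {n : ℕ} (σ : Equiv.Perm (SignedPoint n)) : ℕ :=
  ∑ i : Fin n, ∑ j : Fin n, if i < j then pairInv (σ (i, 1)) (σ (j, 1)) else 0

/-- Right multiplication by `π₀` changes only the sign of the value at the first position; the other
generators only permute the positions. -/
theorem negCount_mul_le {n : ℕ} {σ : Equiv.Perm (SignedPoint n)} (i : ℕ) (hi : i < n) :
    negCount (σ * coxeterPerm n i) ≤ negCount σ + if i = 0 then 1 else 0 := by
  cases i with
  | zero =>
    have h0 : (∑ k : Fin n, if k = ⟨0, hi⟩ then 1 else 0) = 1 := by simp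
    rw [if_pos rfl, ← h0, negCount, negCount, ← Finset.sum_add_distrib]
    refine Finset.sum_le_sum fun k _ => ?_
    by_cases hk : k = ⟨0, hi⟩
    · rw [if_pos hk]
      split_ifs <;> simp
    · have hk' : k.val ≠ 0 := fun h => hk (Fin.ext h)
      simp [Equiv.Perm.mul_apply, coxeterPerm_zero_apply, hk']
  | succ i =>
    refine le_of_eq ?_
    simp only [negCount, Equiv.Perm.mul_apply, coxeterPerm_succ_apply hi, Nat.succ_ne_zero,
      if_false, add_zero]
    exact Equiv.sum_comp (Equiv.swap (⟨i, Nat.lt_of_succ_lt hi⟩ : Fin n) ⟨i + 1, hi⟩)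
      fun k => if (σ (k, 1)).2 = -1 then 1 else 0

/-- Negating `a` exchanges the conditions `b < a` and `a + b < 0`. Since the first position is the
smaller index of every pair containing it, `pairCount` is therefore insensitive to `π₀`. -/
theorem pairInv_neg_left {n : ℕ} (a b : SignedPoint n) : pairInv a.neg b = pairInv a b := by
  simp only [pairInv, signedVal_neg]
  rw [add_comm]
  congr 1 <;> refine if_congr ⟨fun h => ?_, fun h => ?_⟩ rfl rfl <;> linarith

theorem swap_val {n i : ℕ} (h : i + 1 < n) (a : Fin n) :
    (Equiv.swap (⟨i, Nat.lt_of_succ_lt h⟩ : Fin n) ⟨i + 1, h⟩ a).val =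
      if a.val = i then i + 1 else if a.val = i + 1 then i else a.val := by
  rw [Equiv.swap_apply_def]
  simp only [Fin.ext_iff]
  split_ifs <;> rfl

/-- An adjacent transposition preserves the order of every pair of positions except `{i, i + 1}`, so
a single summand is turned around. One term is added on each side to avoid subtraction in `ℕ`. -/
theorem sum_swap_lt {n i : ℕ} (hi : i + 1 < n) (g : Fin n → Fin n → ℕ) :
    (∑ a, ∑ b, if a < b then
        g (Equiv.swap (⟨i, Nat.lt_of_succ_lt hi⟩ : Fin n) ⟨i + 1, hi⟩ a)
          (Equiv.swap (⟨i, Nat.lt_of_succ_lt hi⟩ : Fin n) ⟨i + 1, hi⟩ b) else 0) +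
        g ⟨i, Nat.lt_of_succ_lt hi⟩ ⟨i + 1, hi⟩ =
      (∑ a, ∑ b, if a < b then g a b else 0) + g ⟨i + 1, hi⟩ ⟨i, Nat.lt_of_succ_lt hi⟩ := by
  set u : Fin n := ⟨i, Nat.lt_of_succ_lt hi⟩
  set v : Fin n := ⟨i + 1, hi⟩
  set s := Equiv.swap u v
  have hs : ∀ a, s (s a) = a := fun a => Equiv.swap_apply_self u v a
  have h1 : (∑ a, ∑ b, if a < b then g (s a) (s b) else 0) =
      ∑ a, ∑ b, if s a < s b then g a b else 0 := by
    rw [← Equiv.sum_comp s]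
    refine Finset.sum_congr rfl fun a _ => ?_
    rw [← Equiv.sum_comp s]
    simp only [hs]
  have h2 : ∀ c d : Fin n, g c d = ∑ a, ∑ b, if a = c ∧ b = d then g a b else 0 := by
    intro c d
    rw [Finset.sum_eq_single c, Finset.sum_eq_single d]
    · simp
    · intro b _ hb; simp [hb]
    · simp
    · intro a _ ha; simp [ha]
    · simp
  rw [h1, h2 u v, h2 v u, ← Finset.sum_add_distrib, ← Finset.sum_add_distrib]
  refine Finset.sum_congr rfl fun a _ => ?_
  rw [← Finset.sum_add_distrib, ← Finset.sum_add_distrib]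
  refine Finset.sum_congr rfl fun b _ => ?_
  have ha : (s a).val = _ := swap_val hi a
  have hb : (s b).val = _ := swap_val hi b
  have hu : u.val = i := rfl
  have hv : v.val = i + 1 := rfl
  simp only [Fin.lt_def, Fin.ext_iff, ha, hb, hu, hv]
  split_ifs <;> omega

theorem pairCount_mul_le {n : ℕ} {σ : Equiv.Perm (SignedPoint n)} (hσ : σ ∈ hyperoctahedral n)
    (i : ℕ) (hi : i < n) :
    pairCount (σ * coxeterPerm n i) ≤ pairCount σ + if i = 0 then 0 else 1 := by
  cases i with
  | zero =>
    refine le_of_eq ?_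
    rw [if_pos rfl, add_zero]
    refine Finset.sum_congr rfl fun a _ => Finset.sum_congr rfl fun b _ => ?_
    by_cases hab : a < b
    · have hb : b.val ≠ 0 := by have := Fin.lt_def.1 hab; omega
      simp only [Equiv.Perm.mul_apply, coxeterPerm_zero_apply, hb, if_false, hab, if_true]
      split_ifs
      · rw [apply_snd_neg_one hσ, pairInv_neg_left]
      · rfl
    · simp [hab]
  | succ i =>
    have h := sum_swap_lt hi fun a b => pairInv (σ (a, 1)) (σ (b, 1))
    simp only [pairCount, Equiv.Perm.mul_apply, coxeterPerm_succ_apply hi, Nat.succ_ne_zero,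
      if_false]
    -- The condition on the sum is symmetric, so reversing a pair can only affect the other
    -- indicator.
    have h2 : ∀ x y : SignedPoint n, pairInv x y ≤ pairInv y x + 1 := by
      intro x y
      simp only [pairInv, add_comm (signedVal x)]
      split_ifs <;> omega
    have h3 := h2 (σ (⟨i + 1, hi⟩, 1)) (σ (⟨i, Nat.lt_of_succ_lt hi⟩, 1))
    omega

theorem negCount_one (n : ℕ) : negCount (1 : Equiv.Perm (SignedPoint n)) = 0 := by
  have : (1 : ℤˣ) ≠ -1 := by decide
  simp [negCount, this]

theorem pairCount_one (n : ℕ) : pairCount (1 : Equiv.Perm (SignedPoint n)) = 0 := by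
  refine Finset.sum_eq_zero fun a _ => Finset.sum_eq_zero fun b _ => ?_
  split_ifs with h
  · have := Fin.lt_def.1 h
    have e : ∀ c : Fin n, signedVal ((1 : Equiv.Perm (SignedPoint n)) (c, 1)) = c.val + 1 := by
      simp [signedVal]
    simp only [pairInv, e]
    rw [if_neg (by omega), if_neg (by omega), add_zero]
  · rfl

/-- Together with `pairCount_wordPerm_le`, this bounds the two kinds of letters separately, not only
the length. That is what makes the letter counts the same in all reduced words. -/
theorem negCount_wordPerm_le {n : ℕ} (w : List ℕ) (hw : ∀ i ∈ w, i < n) :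
    negCount (wordPerm n w) ≤ w.countP (fun i => i = 0) := by
  induction w using List.reverseRecOn with
  | nil => simp [wordPerm, negCount_one]
  | append_singleton w i ih =>
    have h1 := ih fun j hj => hw j (by simp [hj])
    have h2 := negCount_mul_le (σ := wordPerm n w) i (hw i (by simp))
    simp only [wordPerm, List.map_append, List.prod_append, List.map_cons, List.map_nil,
      List.prod_cons, List.prod_nil, mul_one, List.countP_append, List.countP_cons,
      List.countP_nil] at h1 h2 ⊢
    refine h2.trans ?_
    simp only [decide_eq_true_eq]
    split_ifs <;> omega

theorem pairCount_wordPerm_le {n : ℕ} (w : List ℕ) (hw : ∀ i ∈ w, i < n) :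
    pairCount (wordPerm n w) ≤ w.countP (fun i => i ≠ 0) := by
  induction w using List.reverseRecOn with
  | nil => simp [wordPerm, pairCount_one]
  | append_singleton w i ih =>
    have h1 := ih fun j hj => hw j (by simp [hj])
    have h2 := pairCount_mul_le (wordPerm_mem n w) i (hw i (by simp))
    simp only [wordPerm, List.map_append, List.prod_append, List.map_cons, List.map_nil,
      List.prod_cons, List.prod_nil, mul_one, List.countP_append, List.countP_cons,
      List.countP_nil] at h1 h2 ⊢
    refine h2.trans ?_
    simp only [decide_eq_true_eq, ite_not]
    split_ifs <;> omega

/-! ## Coset representatives -/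

/-- The word `π_m ⋯ π_{m-k+1}`. -/
def descWord (m k : ℕ) : List ℕ := (List.range k).map fun j => m - j

/-- The word `π₁ ⋯ π_k`. -/
def ascWord (k : ℕ) : List ℕ := (List.range k).map fun j => j + 1

theorem descWord_succ (m k : ℕ) : descWord m (k + 1) = descWord m k ++ [m - k] := by
  simp [descWord, List.range_succ]

theorem ascWord_succ (k : ℕ) : ascWord (k + 1) = ascWord k ++ [k + 1] := by
  simp [ascWord, List.range_succ]

theorem wordPerm_append (n : ℕ) (w w' : List ℕ) :
    wordPerm n (w ++ w') = wordPerm n w * wordPerm n w' := by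
  simp [wordPerm]

theorem wordPerm_singleton (n i : ℕ) : wordPerm n [i] = coxeterPerm n i := by
  simp [wordPerm]

/-- The word of the coset representative that moves the signed point `p` to the last place. -/
def cosetWord {m : ℕ} (p : SignedPoint (m + 1)) : List ℕ :=
  if p.2 = 1 then descWord m (m - p.1.val) else descWord m (m + 1) ++ ascWord p.1.val

theorem wordPerm_descWord (m k : ℕ) (hk : k ≤ m) (p : SignedPoint (m + 1)) :
    (wordPerm (m + 1) (descWord m k) p).1.val =
        (if p.1.val < m - k then p.1.val else if p.1.val = m - k then m else p.1.val - 1) ∧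
      (wordPerm (m + 1) (descWord m k) p).2 = p.2 := by
  induction k generalizing p with
  | zero =>
    have := p.1.isLt
    simp only [descWord, List.range_zero, List.map_nil, wordPerm, List.prod_nil,
      Equiv.Perm.one_apply, and_true]
    split_ifs <;> omega
  | succ k ih =>
    -- As `k + 1 ≤ m`, the new letter `m - k` is not `π₀`, so it acts as a transposition.
    obtain ⟨i, hi⟩ : ∃ i, m - k = i + 1 := ⟨m - k - 1, by omega⟩
    have hi' : i + 1 < m + 1 := by omega
    rw [descWord_succ, wordPerm_append, Equiv.Perm.mul_apply, wordPerm_singleton, hi,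
      coxeterPerm_succ_apply hi']
    obtain ⟨h1, h2⟩ := ih (by omega)
      (Equiv.swap (⟨i, Nat.lt_of_succ_lt hi'⟩ : Fin (m + 1)) ⟨i + 1, hi'⟩ p.1, p.2)
    rw [h1, h2]
    refine ⟨?_, rfl⟩
    simp only [swap_val hi']
    split_ifs <;> omega

theorem wordPerm_ascWord (m k : ℕ) (hk : k ≤ m) (p : SignedPoint (m + 1)) :
    (wordPerm (m + 1) (ascWord k) p).1.val =
        (if p.1.val < k then p.1.val + 1 else if p.1.val = k then 0 else p.1.val) ∧
      (wordPerm (m + 1) (ascWord k) p).2 = p.2 := by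
  induction k generalizing p with
  | zero =>
    simp only [ascWord, List.range_zero, List.map_nil, wordPerm, List.prod_nil,
      Equiv.Perm.one_apply, and_true]
    split_ifs <;> omega
  | succ k ih =>
    have hi' : k + 1 < m + 1 := by omega
    rw [ascWord_succ, wordPerm_append, Equiv.Perm.mul_apply, wordPerm_singleton,
      coxeterPerm_succ_apply hi']
    obtain ⟨h1, h2⟩ := ih (by omega)
      (Equiv.swap (⟨k, Nat.lt_of_succ_lt hi'⟩ : Fin (m + 1)) ⟨k + 1, hi'⟩ p.1, p.2)
    rw [h1, h2]
    refine ⟨?_, rfl⟩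
    simp only [swap_val hi']
    split_ifs <;> omega

theorem units_eq_neg_one {e : ℤˣ} (h : e ≠ 1) : e = -1 :=
  (Int.units_eq_one_or e).resolve_left h

theorem succAbove_val {m : ℕ} (p : Fin (m + 1)) (j : Fin m) :
    (p.succAbove j).val = if j.val < p.val then j.val else j.val + 1 := by
  simp only [Fin.succAbove, Fin.lt_def, Fin.val_castSucc]
  split_ifs <;> simp

theorem wordPerm_cosetWord_self {m : ℕ} (p : SignedPoint (m + 1)) :
    wordPerm (m + 1) (cosetWord p) p = (Fin.last m, 1) := by
  have hp := p.1.isLt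
  unfold cosetWord
  split_ifs with h
  · obtain ⟨h1, h2⟩ := wordPerm_descWord m (m - p.1.val) (by omega) p
    refine Prod.ext (Fin.ext ?_) (h2.trans h)
    rw [h1, if_neg (by omega), if_pos (by omega), Fin.val_last]
  · obtain ⟨h1, h2⟩ := wordPerm_ascWord m p.1.val (by omega) p
    rw [descWord_succ, wordPerm_append, wordPerm_append, Equiv.Perm.mul_apply,
      Equiv.Perm.mul_apply, wordPerm_singleton, Nat.sub_self, coxeterPerm_zero_apply]
    rw [if_neg (lt_irrefl _), if_pos rfl] at h1
    rw [if_pos h1, h2]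
    obtain ⟨h3, h4⟩ := wordPerm_descWord m m le_rfl
      ((wordPerm (m + 1) (ascWord p.1.val) p).1, -p.2)
    refine Prod.ext (Fin.ext ?_) (h4.trans ?_)
    · rw [h3]
      simp [h1]
    · simp [units_eq_neg_one h]

/-- In the negative case, moving a point down to the first place shifts the places below it up by
one, and moving it from there to the last place shifts all others down by one. The remaining places
thus keep their order and signs, as they do in the positive case. -/
theorem wordPerm_cosetWord_succAbove {m : ℕ} (p : SignedPoint (m + 1)) (j : Fin m) (e : ℤˣ) :
    wordPerm (m + 1) (cosetWord p) (p.1.succAbove j, e) = (j.castSucc, e) := by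
  have hp := p.1.isLt
  have hj := j.isLt
  have hs := succAbove_val p.1 j
  unfold cosetWord
  split_ifs with h
  · obtain ⟨h1, h2⟩ := wordPerm_descWord m (m - p.1.val) (by omega) (p.1.succAbove j, e)
    refine Prod.ext (Fin.ext ?_) h2
    rw [h1, Fin.val_castSucc]
    simp only [hs]
    split_ifs <;> omega
  · obtain ⟨h1, h2⟩ := wordPerm_ascWord m p.1.val (by omega) (p.1.succAbove j, e)
    rw [descWord_succ, wordPerm_append, wordPerm_append, Equiv.Perm.mul_apply,
      Equiv.Perm.mul_apply, wordPerm_singleton, Nat.sub_self, coxeterPerm_zero_apply]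
    simp only [hs] at h1
    have h0 : (wordPerm (m + 1) (ascWord p.1.val) (p.1.succAbove j, e)).1.val = j.val + 1 := by
      rw [h1]
      split_ifs <;> omega
    rw [if_neg (by omega), h2]
    obtain ⟨h3, h4⟩ := wordPerm_descWord m m le_rfl
      ((wordPerm (m + 1) (ascWord p.1.val) (p.1.succAbove j, e)).1, e)
    refine Prod.ext (Fin.ext ?_) h4
    rw [h3, Fin.val_castSucc]
    simp only [h0]
    split_ifs <;> omega

theorem cosetWord_lt {m : ℕ} (p : SignedPoint (m + 1)) : ∀ i ∈ cosetWord p, i < m + 1 := by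
  have hp := p.1.isLt
  intro i hi
  unfold cosetWord descWord ascWord at hi
  split_ifs at hi
  · simp only [List.mem_map, List.mem_range] at hi
    omega
  · simp only [List.mem_append, List.mem_map, List.mem_range] at hi
    omega

theorem countP_descWord (m k : ℕ) (hk : k ≤ m) :
    (descWord m k).countP (fun i => i = 0) = 0 ∧ (descWord m k).countP (fun i => i ≠ 0) = k := by
  have h : ∀ i ∈ descWord m k, i ≠ 0 := by
    intro i hi
    simp only [descWord, List.mem_map, List.mem_range] at hi
    omega
  constructor
  · rw [List.countP_eq_zero]
    simpa using h
  · rw [List.countP_eq_length.2 (by simpa using h)]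
    simp [descWord]

theorem countP_ascWord (k : ℕ) :
    (ascWord k).countP (fun i => i = 0) = 0 ∧ (ascWord k).countP (fun i => i ≠ 0) = k := by
  have h : ∀ i ∈ ascWord k, i ≠ 0 := by
    intro i hi
    simp only [ascWord, List.mem_map, List.mem_range] at hi
    omega
  constructor
  · rw [List.countP_eq_zero]
    simpa using h
  · rw [List.countP_eq_length.2 (by simpa using h)]
    simp [ascWord]

theorem countP_cosetWord {m : ℕ} (p : SignedPoint (m + 1)) :
    (cosetWord p).countP (fun i => i = 0) = (if p.2 = 1 then 0 else 1) ∧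
      (cosetWord p).countP (fun i => i ≠ 0) =
        if p.2 = 1 then m - p.1.val else m + p.1.val := by
  unfold cosetWord
  split_ifs
  · exact countP_descWord m _ (Nat.sub_le _ _)
  · rw [descWord_succ]
    simp only [List.countP_append, countP_descWord m m le_rfl, countP_ascWord]
    simp

/-- The points of `±1, …, ±m` as the points of `±1, …, ±(m+1)` other than `±(m+1)`. -/
def liftEquiv (m : ℕ) : SignedPoint m ≃ {p : SignedPoint (m + 1) // p.1 ≠ Fin.last m} where
  toFun p := ⟨(p.1.castSucc, p.2), Fin.castSucc_ne_last p.1⟩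
  invFun p := (p.1.1.castPred p.2, p.1.2)
  left_inv p := by simp
  right_inv p := by simp

/-- The extension of a permutation of `±1, …, ±m` by the identity on `±(m+1)`. -/
def liftPerm {m : ℕ} (σ : Equiv.Perm (SignedPoint m)) : Equiv.Perm (SignedPoint (m + 1)) :=
  σ.extendDomain (liftEquiv m)

theorem liftPerm_castSucc {m : ℕ} (σ : Equiv.Perm (SignedPoint m)) (k : Fin m) (e : ℤˣ) :
    liftPerm σ (k.castSucc, e) = ((σ (k, e)).1.castSucc, (σ (k, e)).2) :=
  Equiv.Perm.extendDomain_apply_image σ (liftEquiv m) (k, e)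

theorem liftPerm_last {m : ℕ} (σ : Equiv.Perm (SignedPoint m)) (e : ℤˣ) :
    liftPerm σ (Fin.last m, e) = (Fin.last m, e) :=
  Equiv.Perm.extendDomain_apply_not_subtype σ (liftEquiv m) (by simp)

theorem signedPoint_cases {m : ℕ} {P : SignedPoint (m + 1) → Prop}
    (h1 : ∀ (k : Fin m) (e : ℤˣ), P (k.castSucc, e)) (h2 : ∀ e, P (Fin.last m, e))
    (p : SignedPoint (m + 1)) : P p := by
  rcases p with ⟨k, e⟩
  induction k using Fin.lastCases with
  | last => exact h2 e
  | cast k => exact h1 k e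

theorem liftPerm_mem {m : ℕ} {σ : Equiv.Perm (SignedPoint m)} (hσ : σ ∈ hyperoctahedral m) :
    liftPerm σ ∈ hyperoctahedral (m + 1) := by
  refine signedPoint_cases (fun k e => ?_) fun e => ?_
  · have := hσ (k, e)
    simp only [SignedPoint.neg] at this ⊢
    simp only [liftPerm_castSucc, this]
  · simp only [SignedPoint.neg, liftPerm_last]

theorem liftPerm_coxeterPerm {m i : ℕ} (hi : i < m) :
    liftPerm (coxeterPerm m i) = coxeterPerm (m + 1) i := by
  ext1 p
  induction p using signedPoint_cases with
  | h1 k e =>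
    rw [liftPerm_castSucc]
    cases i with
    | zero => simp [coxeterPerm_zero_apply]
    | succ i =>
      rw [coxeterPerm_succ_apply hi, coxeterPerm_succ_apply (Nat.lt_succ_of_lt hi)]
      refine Prod.ext (Fin.ext ?_) rfl
      rw [Fin.val_castSucc, swap_val hi, swap_val (Nat.lt_succ_of_lt hi)]
      simp
  | h2 e =>
    rw [liftPerm_last]
    cases i with
    | zero => simp [coxeterPerm_zero_apply, (Nat.zero_lt_of_lt hi).ne']
    | succ i =>
      rw [coxeterPerm_succ_apply (Nat.lt_succ_of_lt hi)]
      refine Prod.ext (Fin.ext ?_) rfl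
      rw [swap_val (Nat.lt_succ_of_lt hi), Fin.val_last, if_neg (by omega), if_neg (by omega)]

theorem liftPerm_wordPerm {m : ℕ} (w : List ℕ) (hw : ∀ i ∈ w, i < m) :
    liftPerm (wordPerm m w) = wordPerm (m + 1) w := by
  induction w with
  | nil => exact Equiv.Perm.extendDomain_one _
  | cons i w ih =>
    have h := ih fun j hj => hw j (List.mem_cons_of_mem i hj)
    have h2 : liftPerm (coxeterPerm m i * wordPerm m w) =
        liftPerm (coxeterPerm m i) * liftPerm (wordPerm m w) :=
      (Equiv.Perm.extendDomain_mul _ _ _).symm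
    rw [h, liftPerm_coxeterPerm (hw i List.mem_cons_self)] at h2
    simpa [wordPerm] using h2

/-- The element `σ c_p` of the coset of the signed point `p`. -/
def cosetMul {m : ℕ} (x : hyperoctahedral m × SignedPoint (m + 1)) : hyperoctahedral (m + 1) :=
  ⟨liftPerm x.1.1 * wordPerm (m + 1) (cosetWord x.2),
    mul_mem (liftPerm_mem x.1.2) (wordPerm_mem _ _)⟩

/-- By oddness `ρ` fixes both points `±(m+1)`, so it restricts to the remaining ones. -/
theorem exists_liftPerm {m : ℕ} {ρ : Equiv.Perm (SignedPoint (m + 1))}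
    (hρ : ρ ∈ hyperoctahedral (m + 1)) (h1 : ρ (Fin.last m, 1) = (Fin.last m, 1)) :
    ∃ σ ∈ hyperoctahedral m, liftPerm σ = ρ := by
  have hl : ∀ e, ρ (Fin.last m, e) = (Fin.last m, e) := by
    intro e
    rcases Int.units_eq_one_or e with rfl | rfl
    · exact h1
    · rw [apply_snd_neg_one hρ, h1, SignedPoint.neg]
  have hn : ∀ p : SignedPoint (m + 1), p.1 ≠ Fin.last m ↔ (ρ p).1 ≠ Fin.last m := by
    intro p
    refine not_congr ⟨fun h => ?_, fun h => ?_⟩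
    · rw [← h, show p = (Fin.last m, p.2) from Prod.ext h rfl, hl]
    · have h2 : ρ p = ρ (Fin.last m, (ρ p).2) := by rw [hl]; exact Prod.ext h rfl
      rw [ρ.injective h2]
  let σ : Equiv.Perm (SignedPoint m) :=
    (liftEquiv m).permCongr.symm (ρ.subtypePerm fun p => (hn p).symm)
  have hσ : liftPerm σ = ρ := by
    ext1 p
    induction p using signedPoint_cases with
    | h1 k e =>
      refine (Equiv.Perm.extendDomain_apply_image σ (liftEquiv m) (k, e)).trans ?_
      simp only [σ, Equiv.permCongr_symm, Equiv.permCongr_apply, Equiv.symm_symm,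
        Equiv.apply_symm_apply]
      rfl
    | h2 e => rw [liftPerm_last, hl]
  refine ⟨σ, fun p => ?_, hσ⟩
  have h := hρ (p.1.castSucc, p.2)
  rw [← hσ] at h
  simp only [SignedPoint.neg, liftPerm_castSucc, Prod.mk.injEq, Fin.castSucc_inj] at h
  exact Prod.ext h.1 h.2

/-- The lifted permutations fix `m + 1` and `c_p` sends `p` to it. Hence `p` is recovered from the
product as the preimage of `(Fin.last m, 1)`, and the other factor by cancellation. -/
theorem cosetMul_bijective (m : ℕ) : Function.Bijective (cosetMul (m := m)) := by
  constructor
  · rintro ⟨σ, p⟩ ⟨τ, r⟩ h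
    have h' : liftPerm σ.1 * wordPerm (m + 1) (cosetWord p) =
        liftPerm τ.1 * wordPerm (m + 1) (cosetWord r) := congrArg Subtype.val h
    have hp := Equiv.Perm.ext_iff.1 h' p
    rw [Equiv.Perm.mul_apply, Equiv.Perm.mul_apply, wordPerm_cosetWord_self, liftPerm_last,
      ← liftPerm_last τ.1] at hp
    have hpr : p = r := (wordPerm (m + 1) (cosetWord r)).injective
      (((liftPerm τ.1).injective hp).symm.trans (wordPerm_cosetWord_self r).symm)
    subst hpr
    have := Equiv.Perm.extendDomainHom_injective (liftEquiv m) (mul_right_cancel h')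
    exact Prod.ext (Subtype.ext this) rfl
  · intro σ
    let p := σ.1⁻¹ (Fin.last m, 1)
    have hc : σ.1 * (wordPerm (m + 1) (cosetWord p))⁻¹ ∈ hyperoctahedral (m + 1) :=
      mul_mem σ.2 (inv_mem (wordPerm_mem _ _))
    obtain ⟨τ, hτ, h⟩ := exists_liftPerm hc (by
      rw [Equiv.Perm.mul_apply, Equiv.Perm.inv_eq_iff_eq.2 (wordPerm_cosetWord_self p).symm]
      exact σ.1.apply_symm_apply _)
    refine ⟨(⟨τ, hτ⟩, p), Subtype.ext ?_⟩
    simp [cosetMul, h]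

theorem cosetMul_self {m : ℕ} (σ : hyperoctahedral m) (p : SignedPoint (m + 1)) :
    (cosetMul (σ, p)).1 (p.1, 1) = (Fin.last m, p.2) := by
  rcases p with ⟨k, e⟩
  simp only [cosetMul, Equiv.Perm.mul_apply]
  rcases Int.units_eq_one_or e with rfl | rfl
  · rw [wordPerm_cosetWord_self, liftPerm_last]
  · have h := wordPerm_mem (m + 1) (cosetWord (k, -1)) (k, -1)
    rw [wordPerm_cosetWord_self] at h
    simp only [SignedPoint.neg, neg_neg] at h
    rw [h, liftPerm_last]

theorem cosetMul_succAbove {m : ℕ} (σ : hyperoctahedral m) (p : SignedPoint (m + 1)) (j : Fin m) :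
    (cosetMul (σ, p)).1 (p.1.succAbove j, 1) = ((σ.1 (j, 1)).1.castSucc, (σ.1 (j, 1)).2) := by
  simp only [cosetMul, Equiv.Perm.mul_apply]
  rw [wordPerm_cosetWord_succAbove, liftPerm_castSucc]

theorem negCount_cosetMul {m : ℕ} (σ : hyperoctahedral m) (p : SignedPoint (m + 1)) :
    negCount (cosetMul (σ, p)).1 = negCount σ.1 + if p.2 = 1 then 0 else 1 := by
  rw [negCount, Fin.sum_univ_succAbove _ p.1, add_comm]
  simp only [cosetMul_self, cosetMul_succAbove]
  congr 1
  rcases Int.units_eq_one_or p.2 with h | h <;> rw [h] <;> decide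

theorem sum_val_lt (m p : ℕ) (hp : p ≤ m) : (∑ j : Fin m, if j.val < p then 1 else 0) = p := by
  induction m generalizing p with
  | zero => simp; omega
  | succ m ih =>
    rw [Fin.sum_univ_castSucc]
    simp only [Fin.val_castSucc, Fin.val_last]
    by_cases h : p ≤ m
    · rw [ih p h, if_neg (by omega), add_zero]
    · have h1 := ih m le_rfl
      have : p = m + 1 := by omega
      subst this
      rw [if_pos (by omega)]
      refine congrArg (· + 1) ((Finset.sum_congr rfl fun j _ => ?_).trans h1)
      rw [if_pos (by omega), if_pos (by omega)]

theorem sum_le_val (m p : ℕ) (hp : p ≤ m) :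
    (∑ j : Fin m, if j.val < p then 0 else 1) = m - p := by
  have h1 := sum_val_lt m p hp
  have h2 : (∑ j : Fin m, if j.val < p then 1 else 0) + (∑ j : Fin m, if j.val < p then 0 else 1)
      = m := by
    rw [← Finset.sum_add_distrib]
    have : ∀ j : Fin m, ((if j.val < p then 1 else 0) + if j.val < p then 0 else 1 : ℕ) = 1 := by
      intro j
      split_ifs <;> rfl
    simp [this]
  omega

theorem abs_signedVal_le {m : ℕ} (p : SignedPoint m) :
    -(m : ℤ) ≤ signedVal p ∧ signedVal p ≤ m := by
  have := p.1.isLt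
  rcases Int.units_eq_one_or p.2 with h | h <;> simp only [signedVal, h, Units.val_one,
    Units.val_neg] <;> constructor <;> linarith

theorem signedVal_castSucc {m : ℕ} (p : SignedPoint m) :
    signedVal ((p.1.castSucc, p.2) : SignedPoint (m + 1)) = signedVal p := rfl

/-- The value at position `p.1` has the largest absolute value, so its pairs are decided by its sign
alone. Each of the `m - p.1` later positions contributes `1` for either sign; each of the `p.1`
earlier ones contributes `0` for a positive value and `2` for a negative one. -/
theorem pairCount_cosetMul {m : ℕ} (σ : hyperoctahedral m) (p : SignedPoint (m + 1)) :
    pairCount (cosetMul (σ, p)).1 =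
      pairCount σ.1 + if p.2 = 1 then m - p.1.val else m + p.1.val := by
  have hp : p.1.val ≤ m := Nat.lt_succ_iff.1 p.1.isLt
  rw [pairCount, Fin.sum_univ_succAbove _ p.1]
  simp only [Fin.sum_univ_succAbove _ p.1, cosetMul_self, cosetMul_succAbove, lt_irrefl, if_false,
    zero_add, Fin.succAbove_lt_succAbove_iff, Finset.sum_add_distrib]
  have h1 : (∑ j : Fin m, if p.1 < p.1.succAbove j then
      pairInv (Fin.last m, p.2) ((σ.1 (j, 1)).1.castSucc, (σ.1 (j, 1)).2) else 0) =
      m - p.1.val := by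
    rw [← sum_le_val m p.1.val hp]
    refine Finset.sum_congr rfl fun j _ => ?_
    have hv := abs_signedVal_le (σ.1 (j, 1))
    have hs := succAbove_val p.1 j
    simp only [Fin.lt_def, hs, pairInv, signedVal_castSucc]
    rcases Int.units_eq_one_or p.2 with h | h <;> simp only [signedVal, h, Units.val_one,
      Units.val_neg, Fin.val_last] at hv ⊢ <;> split_ifs <;> omega
  have h2 : (∑ j : Fin m, if p.1.succAbove j < p.1 then
      pairInv ((σ.1 (j, 1)).1.castSucc, (σ.1 (j, 1)).2) (Fin.last m, p.2) else 0) =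
      (if p.2 = 1 then 0 else 2) * p.1.val := by
    have h0 := congrArg ((if p.2 = 1 then 0 else 2) * ·) (sum_val_lt m p.1.val hp)
    rw [← h0, Finset.mul_sum]
    refine Finset.sum_congr rfl fun j _ => ?_
    have hv := abs_signedVal_le (σ.1 (j, 1))
    have hs := succAbove_val p.1 j
    have h1 : (-1 : ℤˣ) ≠ 1 := by decide
    simp only [Fin.lt_def, hs, pairInv, signedVal_castSucc]
    rcases Int.units_eq_one_or p.2 with h | h <;> simp only [signedVal, h, Units.val_one,
      Units.val_neg, Fin.val_last, h1, if_true, if_false] at hv ⊢ <;> split_ifs <;> omega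
  rw [h1, h2]
  have h3 : (∑ i : Fin m, ∑ j : Fin m, if i < j then
      pairInv (((σ.1 (i, 1)).1.castSucc, (σ.1 (i, 1)).2) : SignedPoint (m + 1))
        ((σ.1 (j, 1)).1.castSucc, (σ.1 (j, 1)).2) else 0) = pairCount σ.1 := rfl
  rw [h3]
  split_ifs <;> omega

/-! ### Reduced words and the inversion statistics. -/

theorem exists_word {n : ℕ} (σ : hyperoctahedral n) :
    ∃ w : List ℕ, (∀ i ∈ w, i < n) ∧ wordPerm n w = σ.1 ∧
      w.countP (fun i => i = 0) = negCount σ.1 ∧ w.countP (fun i => i ≠ 0) = pairCount σ.1 := by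
  induction n with
  | zero => exact ⟨[], by simp, Subsingleton.elim _ _, by simp [negCount], by simp [pairCount]⟩
  | succ m ih =>
    obtain ⟨⟨τ, p⟩, rfl⟩ := (cosetMul_bijective m).2 σ
    obtain ⟨w, h1, h2, h3, h4⟩ := ih τ
    refine ⟨w ++ cosetWord p, fun i hi => ?_, ?_, ?_, ?_⟩
    · rcases List.mem_append.1 hi with hi | hi
      · exact Nat.lt_succ_of_lt (h1 i hi)
      · exact cosetWord_lt p i hi
    · rw [wordPerm_append, ← liftPerm_wordPerm w h1, h2]
      rfl
    · rw [List.countP_append, h3, (countP_cosetWord p).1, negCount_cosetMul]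
    · rw [List.countP_append, h4, (countP_cosetWord p).2, pairCount_cosetMul]

/-- The chosen reduced word of `σ`, as a list of natural numbers. -/
def redWord {n : ℕ} (σ : hyperoctahedral n) : List ℕ := (reducedWord σ).map Fin.val

theorem redWord_lt {n : ℕ} (σ : hyperoctahedral n) : ∀ i ∈ redWord σ, i < n := by
  intro i hi
  obtain ⟨k, -, rfl⟩ := List.mem_map.1 hi
  exact k.isLt

/-- The left side is the form taken by the coercion of a list over `Fin n` to a list of natural
numbers. -/
theorem bind_val_eq_map {n : ℕ} (w : List (Fin n)) :
    (do let a ← w; pure a.val) = w.map Fin.val :=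
  bind_pure_comp Fin.val w

theorem wordPerm_map_val {n : ℕ} (w : List (Fin n)) :
    wordPerm n (w.map Fin.val) = (w.map fun i => coxeterPerm n i).prod := by
  rw [wordPerm, ← bind_val_eq_map]

theorem length_eq_countP (w : List ℕ) :
    w.length = w.countP (fun i => i = 0) + w.countP (fun i => i ≠ 0) := by
  rw [List.length_eq_countP_add_countP (fun i => decide (i = 0))]
  simp

/-- Some word attains both lower bounds at once. A word of minimal length is no longer than it and
obeys the same two bounds, so it attains both of them too. -/
theorem redWord_spec {n : ℕ} (σ : hyperoctahedral n) :
    wordPerm n (redWord σ) = σ.1 ∧ (redWord σ).countP (fun i => i = 0) = negCount σ.1 ∧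
      (redWord σ).countP (fun i => i ≠ 0) = pairCount σ.1 := by
  obtain ⟨w, h1, h2, h3, h4⟩ := exists_word σ
  obtain ⟨w', rfl⟩ : ∃ w' : List (Fin n), w'.map Fin.val = w :=
    ⟨w.pmap Fin.mk h1, by simp [List.map_pmap]⟩
  have hex : ∃ v, IsReducedWord σ v := by
    refine ⟨w', by rw [← wordPerm_map_val, h2], fun v hv => ?_⟩
    rw [← wordPerm_map_val] at hv
    have hlt : ∀ i ∈ v.map Fin.val, i < n := by
      intro i hi
      obtain ⟨k, -, rfl⟩ := List.mem_map.1 hi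
      exact k.isLt
    have a1 := negCount_wordPerm_le _ hlt
    have a2 := pairCount_wordPerm_le _ hlt
    have a3 := length_eq_countP (v.map Fin.val)
    have a4 := length_eq_countP (w'.map Fin.val)
    rw [List.length_map] at a3 a4
    rw [hv] at a1 a2
    omega
  obtain ⟨b1, b2⟩ : IsReducedWord σ (reducedWord σ) := Classical.epsilon_spec hex
  rw [← wordPerm_map_val] at b1
  have b3 := b2 w' (by rw [← wordPerm_map_val, h2])
  have a1 := negCount_wordPerm_le _ (redWord_lt σ)
  have a2 := pairCount_wordPerm_le _ (redWord_lt σ)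
  have a3 := length_eq_countP (redWord σ)
  have a4 := length_eq_countP (w'.map Fin.val)
  have a5 : wordPerm n (redWord σ) = σ.1 := b1
  have a6 : (redWord σ).length = (reducedWord σ).length := List.length_map _
  rw [a5] at a1 a2
  rw [List.length_map] at a4
  exact ⟨a5, by omega, by omega⟩

theorem l₁_eq {n : ℕ} (σ : hyperoctahedral n) : l₁ σ = negCount σ.1 := by
  rw [← (redWord_spec σ).2.1, redWord, List.countP_map]
  rfl

theorem l₂_eq {n : ℕ} (σ : hyperoctahedral n) : l₂ σ = pairCount σ.1 := by
  rw [← (redWord_spec σ).2.2, redWord, List.countP_map]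
  rfl

/-- A reduced word of `σ` read backwards expresses `σ⁻¹`, so the letter bounds apply to it.
Replacing `σ` by `σ⁻¹` gives the converse inequalities. -/
theorem l_inv_le {n : ℕ} (σ : hyperoctahedral n) : l₁ σ⁻¹ ≤ l₁ σ ∧ l₂ σ⁻¹ ≤ l₂ σ := by
  obtain ⟨h1, h2, h3⟩ := redWord_spec σ
  have hr : wordPerm n (redWord σ).reverse = (σ⁻¹).1 := by rw [wordPerm_reverse, h1]; rfl
  have hlt : ∀ i ∈ (redWord σ).reverse, i < n := fun i hi =>
    redWord_lt σ i (List.mem_reverse.1 hi)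
  have a1 := negCount_wordPerm_le _ hlt
  have a2 := pairCount_wordPerm_le _ hlt
  rw [hr, List.countP_reverse] at a1 a2
  simp only [l₁_eq, l₂_eq]
  exact ⟨a1.trans h2.le, a2.trans h3.le⟩

theorem l₁_inv {n : ℕ} (σ : hyperoctahedral n) : l₁ σ⁻¹ = l₁ σ :=
  le_antisymm (l_inv_le σ).1 (by simpa using (l_inv_le σ⁻¹).1)

theorem l₂_inv {n : ℕ} (σ : hyperoctahedral n) : l₂ σ⁻¹ = l₂ σ :=
  le_antisymm (l_inv_le σ).2 (by simpa using (l_inv_le σ⁻¹).2)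

/-! ## The action of words on tensors -/

section Tensor

variable {H : Type*} [NormedAddCommGroup H] [InnerProductSpace ℂ H]

/-- The identity for the sign `1` and `J` for the sign `-1`. -/
def signOp (J : H →L[ℂ] H) (e : ℤˣ) (v : H) : H := if e = -1 then J v else v

theorem signOp_one (J : H →L[ℂ] H) (v : H) : signOp J 1 v = v := by
  rw [signOp, if_neg (by decide)]

theorem signOp_neg_one (J : H →L[ℂ] H) (v : H) : signOp J (-1) v = J v := if_pos rfl

theorem signOp_mul {J : H →L[ℂ] H} (hJJ : ∀ z, J (J z) = z) (e e' : ℤˣ) (v : H) :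
    signOp J (e * e') v = signOp J e (signOp J e' v) := by
  rcases Int.units_eq_one_or e with rfl | rfl <;> rcases Int.units_eq_one_or e' with rfl | rfl <;>
    simp [signOp_one, signOp_neg_one, hJJ]

/-- The action of a signed permutation on families of vectors. -/
def signedAct {n : ℕ} (J : H →L[ℂ] H) (σ : Equiv.Perm (SignedPoint n)) (x : Fin n → H) :
    Fin n → H :=
  fun k => signOp J (σ⁻¹ (k, 1)).2 (x (σ⁻¹ (k, 1)).1)

theorem apply_eq_sign_mul {n : ℕ} {σ : Equiv.Perm (SignedPoint n)} (hσ : σ ∈ hyperoctahedral n)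
    (p : SignedPoint n) : σ p = ((σ (p.1, 1)).1, p.2 * (σ (p.1, 1)).2) := by
  rcases p with ⟨k, e⟩
  rcases Int.units_eq_one_or e with rfl | rfl
  · simp
  · rw [apply_snd_neg_one hσ]
    simp [SignedPoint.neg]

theorem signedAct_mul {n : ℕ} {J : H →L[ℂ] H} (hJJ : ∀ z, J (J z) = z)
    (σ : Equiv.Perm (SignedPoint n)) {τ : Equiv.Perm (SignedPoint n)}
    (hτ : τ ∈ hyperoctahedral n) (x : Fin n → H) :
    signedAct J (σ * τ) x = signedAct J σ (signedAct J τ x) := by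
  funext k
  simp only [signedAct, mul_inv_rev, Equiv.Perm.mul_apply]
  rw [apply_eq_sign_mul (inv_mem hτ) (σ⁻¹ (k, 1)), signOp_mul hJJ]

theorem coxeterOp_tprod (J : H →L[ℂ] H) (n i : ℕ) (x : Fin n → H) :
    coxeterOp J n i (tprod ℂ x) = tprod ℂ (signedAct J (coxeterPerm n i) x) := by
  have hinv : (coxeterPerm n i)⁻¹ = coxeterPerm n i :=
    (eq_inv_of_mul_eq_one_left (coxeterPerm_mul_self n i)).symm
  unfold signedAct
  rw [hinv]
  cases i with
  | zero =>
    rw [coxeterOp, PiTensorProduct.map_tprod]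
    congr 1
    funext k
    simp only [coxeterPerm_zero_apply]
    split_ifs
    · rw [signOp_neg_one]; rfl
    · rw [signOp_one]; rfl
  | succ i =>
    by_cases h : i + 1 < n
    · rw [coxeterOp, dif_pos h]
      refine (PiTensorProduct.reindex_tprod _ _).trans ?_
      congr 1
      funext k
      rw [coxeterPerm_succ_apply h, signOp_one, Equiv.symm_swap]
    · rw [coxeterOp, dif_neg h, coxeterPerm, dif_neg h]
      simp only [Equiv.Perm.one_apply, signOp_one]
      rfl

/-- The operator of a word in the generators. -/
def wordOp (J : H →L[ℂ] H) (n : ℕ) (w : List ℕ) : Module.End ℂ (⨂[ℂ]^n H) :=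
  (w.map (coxeterOp J n)).prod

theorem wordOp_cons (J : H →L[ℂ] H) (n i : ℕ) (w : List ℕ) :
    wordOp J n (i :: w) = coxeterOp J n i * wordOp J n w := by
  simp [wordOp]

theorem wordOp_append (J : H →L[ℂ] H) (n : ℕ) (w w' : List ℕ) :
    wordOp J n (w ++ w') = wordOp J n w * wordOp J n w' := by
  simp [wordOp]

theorem wordOp_tprod {J : H →L[ℂ] H} (hJJ : ∀ z, J (J z) = z) (n : ℕ) (w : List ℕ)
    (x : Fin n → H) :
    wordOp J n w (tprod ℂ x) = tprod ℂ (signedAct J (wordPerm n w) x) := by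
  induction w with
  | nil =>
    refine congrArg (PiTensorProduct.tprod ℂ) (funext fun k => ?_)
    simp [signedAct, signOp_one, wordPerm]
  | cons i w ih =>
    rw [wordOp_cons, Module.End.mul_apply, ih, coxeterOp_tprod, ← signedAct_mul hJJ _
      (wordPerm_mem n w)]
    simp [wordPerm]

/-- On pure tensors a word acts through its permutation alone, because `J` is an involution and only
parities of sign changes matter. This permits replacing the chosen reduced words by convenient ones.
-/
theorem wordOp_congr {J : H →L[ℂ] H} (hJJ : ∀ z, J (J z) = z) {n : ℕ} {w w' : List ℕ}
    (h : wordPerm n w = wordPerm n w') : wordOp J n w = wordOp J n w' := by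
  refine PiTensorProduct.ext (MultilinearMap.ext fun x => ?_)
  simp only [LinearMap.compMultilinearMap_apply]
  rw [wordOp_tprod hJJ, wordOp_tprod hJJ, h]

theorem signedPermOp_eq (J : H →L[ℂ] H) {n : ℕ} (σ : hyperoctahedral n) :
    signedPermOp J σ = wordOp J n (redWord σ) := by
  rw [signedPermOp, wordOp, redWord, ← bind_val_eq_map]

theorem tensorForm_adjoint_of_tprod {m n : ℕ} {A : (⨂[ℂ]^m H) →ₗ[ℂ] ⨂[ℂ]^n H}
    {B : (⨂[ℂ]^n H) →ₗ[ℂ] ⨂[ℂ]^m H}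
    (h : ∀ x y, tensorForm H n (A (tprod ℂ x)) (tprod ℂ y) =
      tensorForm H m (tprod ℂ x) (B (tprod ℂ y)))
    (u : ⨂[ℂ]^m H) (v : ⨂[ℂ]^n H) :
    tensorForm H n (A u) v = tensorForm H m u (B v) := by
  induction u using PiTensorProduct.induction_on with
  | smul_tprod r x =>
    induction v using PiTensorProduct.induction_on with
    | smul_tprod s y => simp only [map_smul, map_smulₛₗ, LinearMap.smul_apply, h]
    | add v v' hv hv' => simp only [map_add, hv, hv']
  | add u u' hu hu' => simp only [map_add, LinearMap.add_apply, hu, hu']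

theorem tensorForm_conj {n : ℕ} (u v : ⨂[ℂ]^n H) :
    conj (tensorForm H n u v) = tensorForm H n v u := by
  induction u using PiTensorProduct.induction_on with
  | smul_tprod r x =>
    induction v using PiTensorProduct.induction_on with
    | smul_tprod s y =>
      simp only [map_smul, map_smulₛₗ, LinearMap.smul_apply, tensorForm_tprod, smul_eq_mul,
        map_mul, map_prod, inner_conj_symm, RingHomCompTriple.comp_apply, RingHom.id_apply]
      ring
    | add v v' hv hv' => simp only [map_add, LinearMap.add_apply, hv, hv']
  | add u u' hu hu' => simp only [map_add, LinearMap.add_apply, hu, hu']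

variable [CompleteSpace H]

theorem inner_J {J : H →L[ℂ] H} (hJ : IsSelfAdjoint J) (x y : H) : ⟪J x, y⟫_ℂ = ⟪x, J y⟫_ℂ :=
  ContinuousLinearMap.isSelfAdjoint_iff_isSymmetric.1 hJ x y

theorem tensorForm_coxeterOp {J : H →L[ℂ] H} (hJ : IsSelfAdjoint J) (n i : ℕ)
    (u v : ⨂[ℂ]^n H) :
    tensorForm H n (coxeterOp J n i u) v = tensorForm H n u (coxeterOp J n i v) := by
  refine tensorForm_adjoint_of_tprod (fun x y => ?_) u v
  have hinv : (coxeterPerm n i)⁻¹ = coxeterPerm n i :=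
    (eq_inv_of_mul_eq_one_left (coxeterPerm_mul_self n i)).symm
  rw [coxeterOp_tprod, coxeterOp_tprod, tensorForm_tprod, tensorForm_tprod]
  unfold signedAct
  rw [hinv]
  cases i with
  | zero =>
    refine Finset.prod_congr rfl fun k _ => ?_
    simp only [coxeterPerm_zero_apply]
    split_ifs
    · simp only [signOp_neg_one, inner_J hJ]
    · simp only [signOp_one]
  | succ i =>
    by_cases h : i + 1 < n
    · rw [← Equiv.prod_comp (Equiv.swap ⟨i, Nat.lt_of_succ_lt h⟩ ⟨i + 1, h⟩)]
      simp [coxeterPerm_succ_apply h, signOp_one]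
    · simp [coxeterPerm, h, signOp_one]

theorem tensorForm_wordOp {J : H →L[ℂ] H} (hJ : IsSelfAdjoint J) (n : ℕ) (w : List ℕ)
    (u v : ⨂[ℂ]^n H) :
    tensorForm H n (wordOp J n w u) v = tensorForm H n u (wordOp J n w.reverse v) := by
  induction w generalizing u v with
  | nil => rfl
  | cons i w ih =>
    rw [wordOp_cons, Module.End.mul_apply, tensorForm_coxeterOp hJ, ih, List.reverse_cons,
      wordOp_append]
    simp [wordOp]

/-- Each generator is symmetric for the undeformed form, so the adjoint of `σ` is `σ⁻¹`. The weights
are real and invariant under inversion, and the sum is reindexed by `σ ↦ σ⁻¹`. -/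
theorem tensorForm_symmetrization {J : H →L[ℂ] H} (hJ : IsSelfAdjoint J)
    (hJJ : ∀ z, J (J z) = z) (α q : ℝ) (n : ℕ) (u v : ⨂[ℂ]^n H) :
    tensorForm H n (symmetrization α q J n u) v =
      tensorForm H n u (symmetrization α q J n v) := by
  simp only [symmetrization, LinearMap.sum_apply, LinearMap.smul_apply, map_sum, map_smul,
    map_smulₛₗ, map_mul, map_pow, Complex.conj_ofReal]
  rw [← Equiv.sum_comp (Equiv.inv (hyperoctahedral n))]
  refine Finset.sum_congr rfl fun σ _ => ?_
  simp only [Equiv.inv_apply, l₁_inv, l₂_inv, signedPermOp_eq]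
  rw [tensorForm_wordOp hJ]
  have h : wordOp J n (redWord σ⁻¹).reverse = wordOp J n (redWord σ) := by
    refine wordOp_congr hJJ ?_
    rw [wordPerm_reverse, (redWord_spec _).1, (redWord_spec _).1]
    simp
  rw [h]

end Tensor

/-! ## Tensoring on the right and the factorization of the symmetrization -/

section Factorization

variable {H : Type*} [NormedAddCommGroup H] [InnerProductSpace ℂ H]

/-- The map `u ↦ u ⊗ z`. -/
def rightTensor (m : ℕ) (z : H) : (⨂[ℂ]^m H) →ₗ[ℂ] ⨂[ℂ]^(m + 1) H :=
  PiTensorProduct.lift (MultilinearMap.mk'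
    (fun x => tprod ℂ (Fin.snoc (α := fun _ : Fin (m + 1) => H) x z))
    (fun x i u v => by simp only [Fin.snoc_update, MultilinearMap.map_update_add])
    (fun x i c u => by simp only [Fin.snoc_update, MultilinearMap.map_update_smul]))

theorem rightTensor_tprod {m : ℕ} (z : H) (x : Fin m → H) :
    rightTensor m z (tprod ℂ x) = tprod ℂ (Fin.snoc (α := fun _ : Fin (m + 1) => H) x z) := by
  simp [rightTensor]

theorem tprod_eq_rightTensor {m : ℕ} (x : Fin (m + 1) → H) :
    tprod ℂ x = rightTensor m (x (Fin.last m)) (tprod ℂ (Fin.init x)) := by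
  rw [rightTensor_tprod, Fin.snoc_init_self]

theorem linearMap_ext_rightTensor {m : ℕ} {M : Type*} [AddCommMonoid M] [Module ℂ M]
    {A B : (⨂[ℂ]^(m + 1) H) →ₗ[ℂ] M}
    (h : ∀ z u, A (rightTensor m z u) = B (rightTensor m z u)) : A = B := by
  refine PiTensorProduct.ext (MultilinearMap.ext fun x => ?_)
  simp only [LinearMap.compMultilinearMap_apply]
  rw [tprod_eq_rightTensor, h]

theorem contract_rightTensor {m : ℕ} (g : H →ₗ[ℂ] ℂ) (z : H) (u : ⨂[ℂ]^m H) :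
    contract (Fin.last m) g (rightTensor m z u) = g z • u := by
  have : contract (Fin.last m) g ∘ₗ rightTensor m z = g z • LinearMap.id := by
    refine PiTensorProduct.ext (MultilinearMap.ext fun x => ?_)
    simp [rightTensor_tprod, contract_tprod, Fin.removeNth_last]
  exact LinearMap.congr_fun this u

/-- The undeformed adjointness relation; the factorization of `P^{(m+1)}` turns it into the deformed
one in `deformedInner_rightCreation`. -/
theorem tensorForm_rightTensor {m : ℕ} (z : H) (u : ⨂[ℂ]^m H) (v : ⨂[ℂ]^(m + 1) H) :
    tensorForm H (m + 1) (rightTensor m z u) v =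
      tensorForm H m u (contract (Fin.last m) (innerₛₗ ℂ z) v) := by
  refine tensorForm_adjoint_of_tprod (fun x y => ?_) u v
  rw [rightTensor_tprod, tensorForm_tprod, contract_tprod, map_smul, tensorForm_tprod,
    Fin.prod_univ_castSucc]
  simp [Fin.removeNth_last, Fin.init, mul_comm]

theorem signedAct_liftPerm {m : ℕ} (J : H →L[ℂ] H) (σ : Equiv.Perm (SignedPoint m))
    (x : Fin m → H) (z : H) :
    signedAct J (liftPerm σ) (Fin.snoc (α := fun _ : Fin (m + 1) => H) x z) =
      Fin.snoc (α := fun _ : Fin (m + 1) => H) (signedAct J σ x) z := by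
  have hinv : (liftPerm σ)⁻¹ = liftPerm σ⁻¹ := rfl
  funext k
  unfold signedAct
  rw [hinv]
  induction k using Fin.lastCases with
  | last => rw [liftPerm_last]; simp [signOp_one]
  | cast k => rw [liftPerm_castSucc]; simp

theorem wordOp_rightTensor {m : ℕ} {J : H →L[ℂ] H} (hJJ : ∀ z, J (J z) = z) (w : List ℕ)
    (hw : ∀ i ∈ w, i < m) (z : H) (u : ⨂[ℂ]^m H) :
    wordOp J (m + 1) w (rightTensor m z u) = rightTensor m z (wordOp J m w u) := by
  have : wordOp J (m + 1) w ∘ₗ rightTensor m z = rightTensor m z ∘ₗ wordOp J m w := by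
    refine PiTensorProduct.ext (MultilinearMap.ext fun x => ?_)
    simp only [LinearMap.compMultilinearMap_apply, LinearMap.comp_apply]
    rw [rightTensor_tprod, wordOp_tprod hJJ, wordOp_tprod hJJ, rightTensor_tprod,
      ← liftPerm_wordPerm w hw, signedAct_liftPerm]
  exact LinearMap.congr_fun this u

/-- The operator `P^{(m)} ⊗ 1` on `H^{⊗ (m+1)}`. -/
def symmetrizationInit (α q : ℝ) (J : H →L[ℂ] H) (m : ℕ) : Module.End ℂ (⨂[ℂ]^(m + 1) H) :=
  ∑ σ : hyperoctahedral m, ((α : ℂ) ^ l₁ σ * (q : ℂ) ^ l₂ σ) • wordOp J (m + 1) (redWord σ)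

theorem symmetrizationInit_rightTensor {J : H →L[ℂ] H} (hJJ : ∀ z, J (J z) = z) (α q : ℝ)
    {m : ℕ} (z : H) (u : ⨂[ℂ]^m H) :
    symmetrizationInit α q J m (rightTensor m z u) =
      rightTensor m z (symmetrization α q J m u) := by
  simp only [symmetrizationInit, symmetrization, LinearMap.sum_apply, LinearMap.smul_apply,
    map_sum, map_smul, signedPermOp_eq]
  refine Finset.sum_congr rfl fun σ _ => ?_
  rw [wordOp_rightTensor hJJ _ (redWord_lt σ)]

/-- The weight of the coset representative of a signed point. -/
def cosetWeight (α q : ℝ) {m : ℕ} (p : SignedPoint (m + 1)) : ℂ :=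
  if p.2 = 1 then (q : ℂ) ^ (m - p.1.val) else (α : ℂ) * (q : ℂ) ^ (m + p.1.val)

theorem sum_units {M : Type*} [AddCommMonoid M] (f : ℤˣ → M) : ∑ e, f e = f 1 + f (-1) := by
  rw [UnitsInt.univ, Finset.sum_pair (by decide)]

theorem add_sum_Icc_one {M : Type*} [AddCommMonoid M] (m : ℕ) (f : ℕ → M) :
    f 0 + ∑ k ∈ Finset.Icc 1 m, f k = ∑ k : Fin (m + 1), f k.val := by
  rw [Fin.sum_univ_eq_sum_range f (m + 1), Finset.range_eq_Ico,
    Finset.sum_eq_sum_Ico_succ_bot (Nat.succ_pos m)]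
  rfl

theorem Rop_eq (α q : ℝ) (J : H →L[ℂ] H) (m : ℕ) :
    Rop α q J m = ∑ p : SignedPoint (m + 1), cosetWeight α q p • wordOp J (m + 1) (cosetWord p) := by
  have hd : ∀ k, ((List.range k).map fun j => coxeterOp J (m + 1) (m - j)).prod =
      wordOp J (m + 1) (descWord m k) := by
    intro k
    rw [wordOp, descWord, List.map_map]
    rfl
  have ha : ∀ k, ((List.range k).map fun j => coxeterOp J (m + 1) (j + 1)).prod =
      wordOp J (m + 1) (ascWord k) := by
    intro k
    rw [wordOp, ascWord, List.map_map]
    rfl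
  have h1 := add_sum_Icc_one m fun k => (q : ℂ) ^ k • wordOp J (m + 1) (descWord m k)
  have h2 := add_sum_Icc_one m fun k => (q : ℂ) ^ k • wordOp J (m + 1) (ascWord k)
  have e1 : (q : ℂ) ^ 0 • wordOp J (m + 1) (descWord m 0) = 1 := by simp [wordOp, descWord]
  have e2 : (q : ℂ) ^ 0 • wordOp J (m + 1) (ascWord 0) = 1 := by simp [wordOp, ascWord]
  rw [e1] at h1
  rw [e2] at h2
  simp only [Rop, hd, ha]
  rw [h1, h2, Fintype.sum_prod_type]
  simp only [sum_units]
  rw [Finset.sum_add_distrib]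
  congr 1
  -- The descending word with `k` letters selects place `m - k` (counted from `0`), so this sum is
  -- read backwards.
  · rw [← Equiv.sum_comp Fin.revPerm]
    refine Finset.sum_congr rfl fun k _ => ?_
    have hk : m + 1 - (k.val + 1) = m - k.val := by omega
    simp only [cosetWeight, cosetWord, if_true, Fin.revPerm_apply, Fin.val_rev, hk]
  · rw [Finset.mul_sum, Finset.smul_sum]
    refine Finset.sum_congr rfl fun k _ => ?_
    have h : (-1 : ℤˣ) ≠ 1 := by decide
    simp only [cosetWeight, cosetWord, h, if_false, wordOp_append]
    rw [mul_smul_comm, smul_smul, pow_add, mul_assoc]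

/-- This is the decomposition `σ c_p` inserted into the sum over `Σ(m+1)`: additivity of `l₁` and
`l₂` makes the weights multiply, and a reduced word of `σ` followed by the coset word is an
expression of the product. -/
theorem symmetrization_succ {J : H →L[ℂ] H} (hJJ : ∀ z, J (J z) = z) (α q : ℝ) (m : ℕ) :
    symmetrization α q J (m + 1) = symmetrizationInit α q J m * Rop α q J m := by
  rw [Rop_eq, symmetrizationInit, Finset.sum_mul_sum, symmetrization,
    ← Equiv.sum_comp (Equiv.ofBijective _ (cosetMul_bijective m)), Fintype.sum_prod_type]
  refine Finset.sum_congr rfl fun σ _ => Finset.sum_congr rfl fun p _ => ?_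
  rw [smul_mul_smul_comm, ← wordOp_append, Equiv.ofBijective_apply, signedPermOp_eq]
  congr 1
  · simp only [l₁_eq, l₂_eq, negCount_cosetMul, pairCount_cosetMul, cosetWeight]
    split_ifs <;> ring
  · refine wordOp_congr hJJ ?_
    rw [(redWord_spec _).1, wordPerm_append, ← liftPerm_wordPerm _ (redWord_lt σ),
      (redWord_spec _).1]
    rfl

theorem signedAct_cosetWord {m : ℕ} (J : H →L[ℂ] H) (p : SignedPoint (m + 1))
    (x : Fin (m + 1) → H) :
    signedAct J (wordPerm (m + 1) (cosetWord p)) x =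
      Fin.snoc (α := fun _ : Fin (m + 1) => H) (p.1.removeNth x) (signOp J p.2 (x p.1)) := by
  funext k
  unfold signedAct
  induction k using Fin.lastCases with
  | last =>
    rw [Equiv.Perm.inv_eq_iff_eq.2 (wordPerm_cosetWord_self p).symm]
    simp
  | cast k =>
    rw [Equiv.Perm.inv_eq_iff_eq.2 (wordPerm_cosetWord_succAbove p k 1).symm]
    simp [signOp_one, Fin.removeNth]

/-- Each coset representative moves one selected factor to the end, applies `J` to it if the sign is
negative, and leaves the others in order. -/
theorem Rop_tprod {J : H →L[ℂ] H} (hJJ : ∀ z, J (J z) = z) (α q : ℝ) {m : ℕ}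
    (x : Fin (m + 1) → H) :
    Rop α q J m (tprod ℂ x) = ∑ p : SignedPoint (m + 1), cosetWeight α q p •
      rightTensor m (signOp J p.2 (x p.1)) (tprod ℂ (p.1.removeNth x)) := by
  rw [Rop_eq, LinearMap.sum_apply]
  refine Finset.sum_congr rfl fun p _ => ?_
  rw [LinearMap.smul_apply, wordOp_tprod hJJ, signedAct_cosetWord, rightTensor_tprod]

theorem contract_symmetrizationInit {J : H →L[ℂ] H} (hJJ : ∀ z, J (J z) = z) (α q : ℝ)
    {m : ℕ} (g : H →ₗ[ℂ] ℂ) (u : ⨂[ℂ]^(m + 1) H) :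
    contract (Fin.last m) g (symmetrizationInit α q J m u) =
      symmetrization α q J m (contract (Fin.last m) g u) := by
  have : contract (Fin.last m) g ∘ₗ symmetrizationInit α q J m =
      symmetrization α q J m ∘ₗ contract (Fin.last m) g := by
    refine linearMap_ext_rightTensor fun z u => ?_
    simp only [LinearMap.comp_apply]
    rw [symmetrizationInit_rightTensor hJJ, contract_rightTensor, contract_rightTensor, map_smul]
  exact LinearMap.congr_fun this u

/-- The operator that applies `T` to the last tensor factor. -/
def lastOp (m : ℕ) (T : H →L[ℂ] H) : Module.End ℂ (⨂[ℂ]^(m + 1) H) :=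
  PiTensorProduct.map
    (fun k : Fin (m + 1) => if k = Fin.last m then T.toLinearMap else LinearMap.id)

theorem lastOp_rightTensor {m : ℕ} (T : H →L[ℂ] H) (z : H) (u : ⨂[ℂ]^m H) :
    lastOp m T (rightTensor m z u) = rightTensor m (T z) u := by
  have : lastOp m T ∘ₗ rightTensor m z = rightTensor m (T z) := by
    refine PiTensorProduct.ext (MultilinearMap.ext fun x => ?_)
    simp only [LinearMap.compMultilinearMap_apply, LinearMap.comp_apply]
    rw [rightTensor_tprod, rightTensor_tprod, lastOp, PiTensorProduct.map_tprod]
    congr 1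
    funext k
    induction k using Fin.lastCases with
    | last => simp
    | cast k => simp [Fin.castSucc_ne_last]
  exact LinearMap.congr_fun this u

/-- The operator `P^{(m)} ⊗ 1` does not touch the last factor, so it commutes with operators acting
there only. -/
theorem lastOp_symmetrizationInit {J : H →L[ℂ] H} (hJJ : ∀ z, J (J z) = z) (α q : ℝ)
    {m : ℕ} (T : H →L[ℂ] H) (u : ⨂[ℂ]^(m + 1) H) :
    lastOp m T (symmetrizationInit α q J m u) = symmetrizationInit α q J m (lastOp m T u) := by
  have : lastOp m T ∘ₗ symmetrizationInit α q J m = symmetrizationInit α q J m ∘ₗ lastOp m T := by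
    refine linearMap_ext_rightTensor fun z u => ?_
    simp only [LinearMap.comp_apply]
    rw [symmetrizationInit_rightTensor hJJ, lastOp_rightTensor, lastOp_rightTensor,
      symmetrizationInit_rightTensor hJJ]
  exact LinearMap.congr_fun this u

variable [CompleteSpace H]

theorem tensorForm_symmetrizationInit {J : H →L[ℂ] H} (hJ : IsSelfAdjoint J)
    (hJJ : ∀ z, J (J z) = z) (α q : ℝ) {m : ℕ} (u v : ⨂[ℂ]^(m + 1) H) :
    tensorForm H (m + 1) (symmetrizationInit α q J m u) v =
      tensorForm H (m + 1) u (symmetrizationInit α q J m v) := by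
  refine tensorForm_adjoint_of_tprod (fun x y => ?_) u v
  rw [tprod_eq_rightTensor x, symmetrizationInit_rightTensor hJJ, tensorForm_rightTensor,
    tensorForm_rightTensor, contract_symmetrizationInit hJJ, tensorForm_symmetrization hJ hJJ]

theorem tensorForm_lastOp {T : H →L[ℂ] H} (hT : IsSelfAdjoint T) {m : ℕ}
    (u v : ⨂[ℂ]^(m + 1) H) :
    tensorForm H (m + 1) (lastOp m T u) v = tensorForm H (m + 1) u (lastOp m T v) := by
  refine tensorForm_adjoint_of_tprod (fun x y => ?_) u v
  rw [tprod_eq_rightTensor x, tprod_eq_rightTensor y]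
  simp only [lastOp_rightTensor, tensorForm_rightTensor, contract_rightTensor, innerₛₗ_apply_apply,
    inner_J hT]

/-- With `P = (P^{(m)} ⊗ 1) R`, both sides equal `⟨R u, (P^{(m)} ⊗ 1) T R v⟩_{0,0}` with `T` on the
last factor, since `T` is symmetric and commutes with `P^{(m)} ⊗ 1`. -/
theorem tensorForm_lastOp_Rop {J T : H →L[ℂ] H} (hJ : IsSelfAdjoint J)
    (hJJ : ∀ z, J (J z) = z) (hT : IsSelfAdjoint T) (α q : ℝ) {m : ℕ} (u v : ⨂[ℂ]^(m + 1) H) :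
    tensorForm H (m + 1) (lastOp m T (Rop α q J m u)) (symmetrization α q J (m + 1) v) =
      tensorForm H (m + 1) u (symmetrization α q J (m + 1) (lastOp m T (Rop α q J m v))) := by
  rw [← tensorForm_symmetrization hJ hJJ α q (m + 1) u, symmetrization_succ hJJ,
    Module.End.mul_apply, Module.End.mul_apply, ← tensorForm_symmetrizationInit hJ hJJ,
    ← lastOp_symmetrizationInit hJJ, tensorForm_lastOp hT]

end Factorization

/-! ## The operators on the Fock space -/

section FockOps

variable {H : Type*} [NormedAddCommGroup H] [InnerProductSpace ℂ H]

/-- The inclusion of `H^{⊗ n}` into the Fock space. -/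
abbrev ofDegree (n : ℕ) : (⨂[ℂ]^n H) →ₗ[ℂ] Fock H :=
  DirectSum.lof ℂ ℕ (fun n => ⨂[ℂ]^n H) n

/-- The projection of the Fock space onto `H^{⊗ n}`. -/
abbrev degreePart (n : ℕ) : Fock H →ₗ[ℂ] ⨂[ℂ]^n H :=
  DirectSum.component ℂ ℕ (fun n => ⨂[ℂ]^n H) n

theorem degreePart_ofDegree_self (n : ℕ) (u : ⨂[ℂ]^n H) : degreePart n (ofDegree n u) = u :=
  DirectSum.component.lof_self ℂ (M := fun n => ⨂[ℂ]^n H) n u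

theorem degreePart_ofDegree_ne {m n : ℕ} (h : m ≠ n) (u : ⨂[ℂ]^m H) :
    degreePart n (ofDegree m u) = 0 := by
  rw [degreePart, ofDegree, DirectSum.component.of, dif_neg h]

theorem fock_induction {P : Fock H → Prop} (h0 : P 0)
    (h1 : ∀ n (u : ⨂[ℂ]^n H), P (ofDegree n u)) (h2 : ∀ u v, P u → P v → P (u + v))
    (u : Fock H) : P u :=
  DirectSum.induction_on u h0 h1 h2

theorem deformedInner_ofDegree (α q : ℝ) (J : H →L[ℂ] H) (n : ℕ) (u : ⨂[ℂ]^n H) (v : Fock H) :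
    deformedInner α q J (ofDegree n u) v =
      tensorForm H n u (symmetrization α q J n (degreePart n v)) := by
  unfold deformedInner
  erw [DirectSum.toAddMonoid_of]
  rfl

theorem deformedInner_add_left (α q : ℝ) (J : H →L[ℂ] H) (u u' v : Fock H) :
    deformedInner α q J (u + u') v = deformedInner α q J u v + deformedInner α q J u' v := by
  simp only [deformedInner, map_add, LinearMap.add_apply]

theorem deformedInner_sub_left (α q : ℝ) (J : H →L[ℂ] H) (u u' v : Fock H) :
    deformedInner α q J (u - u') v = deformedInner α q J u v - deformedInner α q J u' v := by
  simp only [deformedInner, map_sub, LinearMap.sub_apply]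

theorem deformedInner_zero_left (α q : ℝ) (J : H →L[ℂ] H) (v : Fock H) :
    deformedInner α q J 0 v = 0 := by
  simp only [deformedInner, map_zero, LinearMap.zero_apply]

theorem deformedInner_add_right (α q : ℝ) (J : H →L[ℂ] H) (u v v' : Fock H) :
    deformedInner α q J u (v + v') = deformedInner α q J u v + deformedInner α q J u v' := by
  simp only [deformedInner, map_add]

theorem deformedInner_smul_right (α q : ℝ) (J : H →L[ℂ] H) (c : ℂ) (u v : Fock H) :
    deformedInner α q J u (c • v) = c * deformedInner α q J u v := by
  simp only [deformedInner, map_smul, smul_eq_mul]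

theorem deformedInner_zero_right (α q : ℝ) (J : H →L[ℂ] H) (u : Fock H) :
    deformedInner α q J u 0 = 0 := by
  simp only [deformedInner, map_zero]

/-- The right creation operator `u ↦ u ⊗ x`. -/
def rightCreation (x : H) : Module.End ℂ (Fock H) :=
  DirectSum.toModule ℂ ℕ (Fock H) fun n => ofDegree (n + 1) ∘ₗ rightTensor n x

theorem rightCreation_ofDegree (x : H) (n : ℕ) (u : ⨂[ℂ]^n H) :
    rightCreation x (ofDegree n u) = ofDegree (n + 1) (rightTensor n x u) := by
  rw [rightCreation, DirectSum.toModule_lof]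
  rfl

theorem annihilation_ofDegree_zero (α q : ℝ) (J : H →L[ℂ] H) (x : H) (u : ⨂[ℂ]^0 H) :
    annihilation α q J x (ofDegree 0 u) = 0 := by
  rw [annihilation, LinearMap.add_apply, LinearMap.smul_apply, rightAnnihilation,
    leftAnnihilation, DirectSum.toModule_lof, DirectSum.toModule_lof]
  simp

/-- The coefficients of `b` are the weights of the terms of `R`: the terms of `r_q` are the
selections with sign `1`, those of `ℓ^N_q` the selections with sign `-1`. -/
theorem annihilation_ofDegree_succ {J : H →L[ℂ] H} (hJJ : ∀ z, J (J z) = z) (α q : ℝ) (x : H)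
    (m : ℕ) (u : ⨂[ℂ]^(m + 1) H) :
    annihilation α q J x (ofDegree (m + 1) u) =
      ofDegree m (contract (Fin.last m) (innerₛₗ ℂ x) (Rop α q J m u)) := by
  rw [annihilation, LinearMap.add_apply, LinearMap.smul_apply, rightAnnihilation,
    leftAnnihilation, DirectSum.toModule_lof, DirectSum.toModule_lof]
  simp only [LinearMap.comp_apply]
  rw [← map_smul, ← map_add]
  congr 1
  have : (∑ k : Fin (m + 1), (q : ℂ) ^ (m - k.val) • contract k (innerₛₗ ℂ x)) +
      (α : ℂ) • ((q : ℂ) ^ m • ∑ k : Fin (m + 1),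
        (q : ℂ) ^ k.val • contract k (innerₛₗ ℂ x ∘ₗ J.toLinearMap)) =
      contract (Fin.last m) (innerₛₗ ℂ x) ∘ₗ Rop α q J m := by
    refine PiTensorProduct.ext (MultilinearMap.ext fun y => ?_)
    have h : (-1 : ℤˣ) ≠ 1 := by decide
    simp only [LinearMap.compMultilinearMap_apply, LinearMap.comp_apply, LinearMap.add_apply,
      LinearMap.smul_apply, LinearMap.sum_apply, Rop_tprod hJJ, map_add, map_sum, map_smul,
      contract_rightTensor, contract_tprod, Fintype.sum_prod_type, sum_units, signOp_one,
      signOp_neg_one, cosetWeight, if_true, h, if_false, Finset.sum_add_distrib,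
      Finset.smul_sum, smul_smul, pow_add, mul_assoc]
    rfl
  exact LinearMap.congr_fun this u

theorem gauge_ofDegree_zero (α q : ℝ) (J T : H →L[ℂ] H) (u : ⨂[ℂ]^0 H) :
    gauge α q J T (ofDegree 0 u) = 0 := by
  rw [gauge, DirectSum.toModule_lof]
  rfl

theorem gauge_ofDegree_succ (α q : ℝ) (J T : H →L[ℂ] H) (m : ℕ) (u : ⨂[ℂ]^(m + 1) H) :
    gauge α q J T (ofDegree (m + 1) u) = ofDegree (m + 1) (lastOp m T (Rop α q J m u)) := by
  rw [gauge, DirectSum.toModule_lof]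
  rfl

theorem degreePart_annihilation {J : H →L[ℂ] H} (hJJ : ∀ z, J (J z) = z) (α q : ℝ) (x : H)
    (m : ℕ) (v : Fock H) :
    degreePart m (annihilation α q J x v) =
      contract (Fin.last m) (innerₛₗ ℂ x) (Rop α q J m (degreePart (m + 1) v)) := by
  induction v using fock_induction with
  | h0 => simp only [map_zero]
  | h1 n u =>
    cases n with
    | zero =>
      rw [annihilation_ofDegree_zero, degreePart_ofDegree_ne (Nat.succ_ne_zero m).symm]
      simp only [map_zero]
    | succ n =>
      rw [annihilation_ofDegree_succ hJJ]
      by_cases h : n = m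
      · subst h
        rw [degreePart_ofDegree_self, degreePart_ofDegree_self]
      · rw [degreePart_ofDegree_ne h, degreePart_ofDegree_ne (by omega)]
        simp only [map_zero]
  | h2 u v hu hv => simp only [map_add, hu, hv]

theorem degreePart_gauge_zero (α q : ℝ) (J T : H →L[ℂ] H) (v : Fock H) :
    degreePart 0 (gauge α q J T v) = 0 := by
  induction v using fock_induction with
  | h0 => simp only [map_zero]
  | h1 n u =>
    cases n with
    | zero => rw [gauge_ofDegree_zero, map_zero]
    | succ n => rw [gauge_ofDegree_succ, degreePart_ofDegree_ne (Nat.succ_ne_zero n)]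
  | h2 u v hu hv => simp only [map_add, hu, hv, add_zero]

theorem degreePart_gauge_succ (α q : ℝ) (J T : H →L[ℂ] H) (m : ℕ) (v : Fock H) :
    degreePart (m + 1) (gauge α q J T v) =
      lastOp m T (Rop α q J m (degreePart (m + 1) v)) := by
  induction v using fock_induction with
  | h0 => simp only [map_zero]
  | h1 n u =>
    cases n with
    | zero =>
      rw [gauge_ofDegree_zero, degreePart_ofDegree_ne (Nat.succ_ne_zero m).symm]
      simp only [map_zero]
    | succ n =>
      rw [gauge_ofDegree_succ]
      by_cases h : n = m
      · subst h
        rw [degreePart_ofDegree_self, degreePart_ofDegree_self]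
      · rw [degreePart_ofDegree_ne (by omega), degreePart_ofDegree_ne (by omega)]
        simp only [map_zero]
  | h2 u v hu hv => simp only [map_add, hu, hv]

theorem symmetrization_zero (α q : ℝ) (J : H →L[ℂ] H) : symmetrization α q J 0 = 1 := by
  have h : ∀ σ : hyperoctahedral 0,
      ((α : ℂ) ^ l₁ σ * (q : ℂ) ^ l₂ σ) • signedPermOp J σ = 1 := by
    intro σ
    have hw : redWord σ = [] := List.eq_nil_iff_forall_not_mem.2 fun i hi =>
      Nat.not_lt_zero i (redWord_lt σ i hi)
    rw [signedPermOp_eq, hw, l₁_eq, l₂_eq]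
    simp [negCount, pairCount, wordOp]
  rw [symmetrization, Finset.sum_congr rfl fun σ _ => h σ, Finset.sum_const, Finset.card_univ,
    Fintype.card_eq_one_iff.2 ⟨1, fun σ => Subsingleton.elim σ 1⟩, one_smul]

theorem deformedInner_vacuum_left (α q : ℝ) (J : H →L[ℂ] H) (v : Fock H) :
    deformedInner α q J (vacuum H) v = tensorForm H 0 (tprod ℂ Fin.elim0) (degreePart 0 v) := by
  rw [vacuum, deformedInner_ofDegree, symmetrization_zero, Module.End.one_apply]

/-- Moving `x` across the form contracts the last factor of `(P^{(n)} ⊗ 1) R v`. The contraction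
passes through `P^{(n)} ⊗ 1` and leaves `P^{(n)}` applied to the contraction of `R v`, which is
`b(x) v`. -/
theorem deformedInner_rightCreation {J : H →L[ℂ] H} (hJJ : ∀ z, J (J z) = z) (α q : ℝ) (x : H)
    (u v : Fock H) :
    deformedInner α q J (rightCreation x u) v =
      deformedInner α q J u (annihilation α q J x v) := by
  induction u using fock_induction with
  | h0 => simp only [map_zero, deformedInner_zero_left]
  | h1 n u =>
    rw [rightCreation_ofDegree, deformedInner_ofDegree, deformedInner_ofDegree,
      tensorForm_rightTensor, symmetrization_succ hJJ, Module.End.mul_apply,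
      contract_symmetrizationInit hJJ, degreePart_annihilation hJJ]
  | h2 u u' hu hu' => simp only [map_add, deformedInner_add_left, hu, hu']

/-- Right creation shows that an adjoint exists, so the chosen one is an adjoint. Nothing else about
the choice enters the proof. -/
theorem deformedInner_creation {J : H →L[ℂ] H} (hJJ : ∀ z, J (J z) = z) (α q : ℝ) (x : H)
    (u v : Fock H) :
    deformedInner α q J (creation α q J x u) v =
      deformedInner α q J u (annihilation α q J x v) :=
  Classical.epsilon_spec (p := fun A : Module.End ℂ (Fock H) => ∀ u v : Fock H,
    deformedInner α q J (A u) v = deformedInner α q J u (annihilation α q J x v))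
    ⟨rightCreation x, deformedInner_rightCreation hJJ α q x⟩ u v

variable [CompleteSpace H]

theorem deformedInner_conj {J : H →L[ℂ] H} (hJ : IsSelfAdjoint J) (hJJ : ∀ z, J (J z) = z)
    (α q : ℝ) (u v : Fock H) :
    conj (deformedInner α q J u v) = deformedInner α q J v u := by
  induction u using fock_induction with
  | h0 => simp only [deformedInner_zero_left, deformedInner_zero_right, map_zero]
  | h1 m u =>
    induction v using fock_induction with
    | h0 => simp only [deformedInner_zero_left, deformedInner_zero_right, map_zero]
    | h1 n v =>
      rw [deformedInner_ofDegree, deformedInner_ofDegree]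
      by_cases h : m = n
      · subst h
        rw [degreePart_ofDegree_self, degreePart_ofDegree_self, tensorForm_conj,
          tensorForm_symmetrization hJ hJJ]
      · rw [degreePart_ofDegree_ne h, degreePart_ofDegree_ne (Ne.symm h)]
        simp only [map_zero]
    | h2 v v' hv hv' =>
      simp only [deformedInner_add_left, deformedInner_add_right, map_add, hv, hv']
  | h2 u u' hu hu' =>
    simp only [deformedInner_add_left, deformedInner_add_right, map_add, hu, hu']

theorem deformedInner_gauge {J T : H →L[ℂ] H} (hJ : IsSelfAdjoint J) (hJJ : ∀ z, J (J z) = z)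
    (hT : IsSelfAdjoint T) (α q : ℝ) (u v : Fock H) :
    deformedInner α q J (gauge α q J T u) v = deformedInner α q J u (gauge α q J T v) := by
  induction u using fock_induction with
  | h0 => simp only [map_zero, deformedInner_zero_left]
  | h1 n u =>
    cases n with
    | zero =>
      rw [gauge_ofDegree_zero, deformedInner_zero_left, deformedInner_ofDegree,
        degreePart_gauge_zero]
      simp only [map_zero]
    | succ n =>
      rw [gauge_ofDegree_succ, deformedInner_ofDegree, deformedInner_ofDegree,
        degreePart_gauge_succ, tensorForm_lastOp_Rop hJ hJJ hT]
  | h2 u u' hu hu' => simp only [map_add, deformedInner_add_left, hu, hu']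

/-! ## Replacing the creation operator by the right creation operator -/

/-- The radical of the deformed inner product. -/
def InRadical (α q : ℝ) (J : H →L[ℂ] H) (u : Fock H) : Prop :=
  ∀ v, deformedInner α q J u v = 0

/-- The operator of type B, with the right creation operator. -/
def typeBRightOp (α q : ℝ) (J : H →L[ℂ] H) (x : H) (T : H →L[ℂ] H) (lam : ℝ) :
    Module.End ℂ (Fock H) :=
  annihilation α q J x + rightCreation x + gauge α q J T + (lam : ℂ) • 1

/-- Every summand of the operator has an adjoint, so it maps the radical to itself; and two adjoints
of `b(x)` applied to the same vector differ by an element of the radical. -/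
theorem InRadical.typeBOp_sub {J T : H →L[ℂ] H} (hJ : IsSelfAdjoint J)
    (hJJ : ∀ z, J (J z) = z) (hT : IsSelfAdjoint T) {α q : ℝ} (x : H) (lam : ℝ) {u u' : Fock H}
    (h : InRadical α q J (u - u')) :
    InRadical α q J (typeBOp α q J x T lam u - typeBRightOp α q J x T lam u') := by
  have hr : ∀ v, deformedInner α q J v (u - u') = 0 := fun v => by
    rw [← deformedInner_conj hJ hJJ, h, map_zero]
  have e : typeBOp α q J x T lam u - typeBRightOp α q J x T lam u' =
      annihilation α q J x (u - u') + creation α q J x (u - u') + gauge α q J T (u - u') +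
        (lam : ℂ) • (u - u') + (creation α q J x u' - rightCreation x u') := by
    simp only [typeBOp, typeBRightOp, LinearMap.add_apply, LinearMap.smul_apply,
      Module.End.one_apply, map_sub, smul_sub]
    abel
  intro v
  -- Here the creation operator serves as the adjoint of annihilation, after a conjugation.
  have h1 : deformedInner α q J (annihilation α q J x (u - u')) v = 0 := by
    rw [← deformedInner_conj hJ hJJ, ← deformedInner_creation hJJ, hr, map_zero]
  have h2 : deformedInner α q J ((lam : ℂ) • (u - u')) v = 0 := by
    rw [← deformedInner_conj hJ hJJ, deformedInner_smul_right, hr, mul_zero, map_zero]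
  rw [e]
  simp only [deformedInner_add_left]
  rw [deformedInner_sub_left, h1, h2, deformedInner_creation hJJ, deformedInner_creation hJJ,
    deformedInner_rightCreation hJJ, deformedInner_gauge hJ hJJ hT, h, h]
  ring

theorem vacuumState_typeBOp {J : H →L[ℂ] H} (hJ : IsSelfAdjoint J)
    (hJJ : ∀ z, J (J z) = z) (α q : ℝ) {n : ℕ} (x : Fin n → H) (T : Fin n → H →L[ℂ] H)
    (hT : ∀ i, IsSelfAdjoint (T i)) (lam : Fin n → ℝ) :
    vacuumState α q J
        (List.ofFn fun i => typeBOp α q J (x i) (T i) (lam i)).reverse.prod =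
      deformedInner α q J (vacuum H)
        ((List.ofFn fun i => typeBRightOp α q J (x i) (T i) (lam i)).reverse.prod
          (vacuum H)) := by
  have key : InRadical α q J
      ((List.ofFn fun i => typeBOp α q J (x i) (T i) (lam i)).reverse.prod (vacuum H) -
        (List.ofFn fun i => typeBRightOp α q J (x i) (T i) (lam i)).reverse.prod
          (vacuum H)) := by
    induction n with
    | zero =>
      intro v
      simp [deformedInner_zero_left]
    | succ n ih =>
      have h := ih (fun i => x i.castSucc) (fun i => T i.castSucc) (fun i => hT _)
        (fun i => lam i.castSucc)
      simp only [List.ofFn_succ_last, List.reverse_append, List.reverse_singleton,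
        List.prod_append, List.prod_singleton, Module.End.mul_apply]
      exact h.typeBOp_sub hJ hJJ (hT _) _ _
  have h2 := key (vacuum H)
  rw [deformedInner_sub_left, sub_eq_zero] at h2
  -- The radical is defined through the left variable while the state puts the vector on the right,
  -- hence the two conjugations.
  rw [vacuumState, ← deformedInner_conj hJ hJJ, h2, deformedInner_conj hJ hJJ]

end FockOps

/-! ## Tensors indexed by sets of open elements -/

section State

variable {H : Type*} [NormedAddCommGroup H] [InnerProductSpace ℂ H] {n : ℕ}

/-- The tensor of the vectors `y i`, `i ∈ O`, in increasing order. -/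
def setTensor (O : Finset (Fin n)) (y : Fin n → H) : Fock H :=
  ofDegree O.card (tprod ℂ fun k => y (O.orderEmbOfFin rfl k))

/-- A finite set of labels has only one increasing enumeration, so any strictly monotone one may be
used in place of `orderEmbOfFin`. -/
theorem ofDegree_tprod_eq_setTensor {m : ℕ} (f : Fin m → Fin n) (hf : StrictMono f)
    (y : Fin n → H) :
    ofDegree m (tprod ℂ fun k => y (f k)) = setTensor (Finset.univ.image f) y := by
  have hc : (Finset.univ.image f).card = m := by
    rw [Finset.card_image_of_injective _ hf.injective, Finset.card_univ, Fintype.card_fin]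
  have hu := Finset.orderEmbOfFin_unique hc (f := f) (fun k => Finset.mem_image_of_mem f
    (Finset.mem_univ k)) hf
  -- With `O` general, the equation `O.card = m` can be substituted, which avoids transport between
  -- tensor powers.
  have key : ∀ (O : Finset (Fin n)) (h : O.card = m),
      ofDegree m (tprod ℂ fun k => y (O.orderEmbOfFin h k)) = setTensor O y := by
    rintro O rfl
    rfl
  rw [← key _ hc, ← hu]

theorem setTensor_congr {O : Finset (Fin n)} {y y' : Fin n → H} (h : ∀ i ∈ O, y i = y' i) :
    setTensor O y = setTensor O y' := by
  unfold setTensor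
  congr 2
  funext k
  exact h _ (Finset.orderEmbOfFin_mem O rfl k)

theorem setTensor_empty (y : Fin n → H) : setTensor ∅ y = vacuum H := by
  have h := ofDegree_tprod_eq_setTensor (Fin.elim0 : Fin 0 → Fin n) (fun k => k.elim0) y
  rw [Finset.univ_eq_empty, Finset.image_empty] at h
  rw [← h, vacuum]
  congr 2
  exact Subsingleton.elim _ _

theorem deformedInner_vacuum_setTensor (α q : ℝ) (J : H →L[ℂ] H) (O : Finset (Fin n))
    (y : Fin n → H) :
    deformedInner α q J (vacuum H) (setTensor O y) = if O = ∅ then 1 else 0 := by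
  rw [deformedInner_vacuum_left]
  split_ifs with h
  · rw [h, setTensor_empty, vacuum, degreePart_ofDegree_self, tensorForm_tprod]
    rfl
  · rw [setTensor, degreePart_ofDegree_ne (mt Finset.card_eq_zero.1 h), map_zero]

/-- The weight of an arc of colour `e`, when there are `a` open elements above and `b` open
elements below its left end. -/
def signWeight (α q : ℝ) (e : ℤˣ) (a b : ℕ) : ℂ :=
  if e = 1 then (q : ℂ) ^ a else (α : ℂ) * (q : ℂ) ^ (a + 2 * b)

/-- The number of elements of `O` above `i`. -/
def above (O : Finset (Fin n)) (i : Fin n) : ℕ := (O.filter fun j => i < j).card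

/-- The number of elements of `O` below `i`. -/
def below (O : Finset (Fin n)) (i : Fin n) : ℕ := (O.filter fun j => j < i).card

/-- The place `k` has `m - k` labels above it and `k` below it, and `m + k = (m - k) + 2k`. -/
theorem cosetWeight_eq (α q : ℝ) {m : ℕ} {f : Fin (m + 1) → Fin n} (hf : StrictMono f)
    (k : Fin (m + 1)) (e : ℤˣ) :
    cosetWeight α q (k, e) = signWeight α q e (above (Finset.univ.image f) (f k))
      (below (Finset.univ.image f) (f k)) := by
  have ha : above (Finset.univ.image f) (f k) = m - k.val := by
    rw [above, Finset.filter_image, Finset.card_image_of_injective _ hf.injective]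
    simp only [hf.lt_iff_lt]
    rw [Finset.filter_lt_eq_Ioi, Fin.card_Ioi]
    omega
  have hb : below (Finset.univ.image f) (f k) = k.val := by
    rw [below, Finset.filter_image, Finset.card_image_of_injective _ hf.injective]
    simp only [hf.lt_iff_lt]
    rw [Finset.filter_gt_eq_Iio, Fin.card_Iio]
  rw [ha, hb, cosetWeight, signWeight]
  have : m - k.val + 2 * k.val = m + k.val := by omega
  rw [this]

theorem image_erase_eq {m : ℕ} {f : Fin (m + 1) → Fin n} (hf : StrictMono f) (k : Fin (m + 1)) :
    (Finset.univ.image f).erase (f k) = Finset.univ.image fun j => f (k.succAbove j) := by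
  ext i
  simp only [Finset.mem_erase, Finset.mem_image, Finset.mem_univ, true_and]
  constructor
  · rintro ⟨h, j, rfl⟩
    obtain ⟨l, hl⟩ := Fin.exists_succAbove_eq (x := j) (y := k) fun h' => h (by rw [h'])
    exact ⟨l, congrArg f hl⟩
  · rintro ⟨j, rfl⟩
    exact ⟨fun h => Fin.succAbove_ne k j (hf.injective h), _, rfl⟩

theorem exists_strictMono_image (O : Finset (Fin n)) (hO : O.Nonempty) :
    ∃ (m : ℕ) (f : Fin (m + 1) → Fin n), StrictMono f ∧ Finset.univ.image f = O := by
  obtain ⟨m, hm⟩ := Nat.exists_eq_succ_of_ne_zero (Finset.card_ne_zero.2 hO)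
  exact ⟨m, O.orderEmbOfFin hm, (O.orderEmbOfFin hm).strictMono, by simp⟩

/-- Each term closes the open block whose last element so far is `i`, by an arc of colour `e`. -/
theorem annihilation_setTensor {J : H →L[ℂ] H} (hJJ : ∀ z, J (J z) = z) (α q : ℝ) (x : H)
    (O : Finset (Fin n)) (y : Fin n → H) :
    annihilation α q J x (setTensor O y) = ∑ i ∈ O, ∑ e : ℤˣ,
      (signWeight α q e (above O i) (below O i) * ⟪x, signOp J e (y i)⟫_ℂ) •
        setTensor (O.erase i) y := by
  rcases O.eq_empty_or_nonempty with rfl | hO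
  · rw [setTensor_empty, vacuum, annihilation_ofDegree_zero, Finset.sum_empty]
  · obtain ⟨m, f, hf, rfl⟩ := exists_strictMono_image O hO
    rw [← ofDegree_tprod_eq_setTensor f hf, annihilation_ofDegree_succ hJJ, Rop_tprod hJJ,
      Finset.sum_image hf.injective.injOn, map_sum, map_sum, Fintype.sum_prod_type]
    refine Finset.sum_congr rfl fun k _ => Finset.sum_congr rfl fun e _ => ?_
    rw [map_smul, contract_rightTensor, smul_smul, map_smul, image_erase_eq hf,
      ← cosetWeight_eq α q hf, ← ofDegree_tprod_eq_setTensor (fun j => f (k.succAbove j))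
        (hf.comp (Fin.strictMono_succAbove k))]
    rfl

theorem rightTensor_setTensor {m : ℕ} (g : Fin m → Fin n) (hg : StrictMono g) (k : Fin n)
    (hk : ∀ j, g j < k) (y : Fin n → H) :
    ofDegree (m + 1) (rightTensor m (y k) (tprod ℂ fun j => y (g j))) =
      setTensor (insert k (Finset.univ.image g)) y := by
  have hs : StrictMono (Fin.snoc (α := fun _ : Fin (m + 1) => Fin n) g k) := by
    intro a b hab
    induction b using Fin.lastCases with
    | last =>
      induction a using Fin.lastCases with
      | last => exact absurd hab (lt_irrefl _)
      | cast a => simpa using hk a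
    | cast b =>
      induction a using Fin.lastCases with
      | last => exact absurd hab (not_lt_of_gt (Fin.castSucc_lt_last b))
      | cast a => simpa using hg (Fin.castSucc_lt_castSucc_iff.1 hab)
  have hi : Finset.univ.image (Fin.snoc (α := fun _ : Fin (m + 1) => Fin n) g k) =
      insert k (Finset.univ.image g) := by
    ext i
    simp [Fin.exists_fin_succ', or_comm, eq_comm]
  rw [← hi, ← ofDegree_tprod_eq_setTensor _ hs, rightTensor_tprod]
  congr 2
  funext j
  induction j using Fin.lastCases with
  | last => simp
  | cast j => simp

/-- As `k` lies above all labels, appending a factor on the right agrees with inserting `k` in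
increasing order. -/
theorem rightCreation_setTensor (O : Finset (Fin n)) (k : Fin n) (hk : ∀ i ∈ O, i < k)
    (y : Fin n → H) : rightCreation (y k) (setTensor O y) = setTensor (insert k O) y := by
  rw [setTensor, rightCreation_ofDegree, rightTensor_setTensor _ (O.orderEmbOfFin rfl).strictMono k
    (fun j => hk _ (Finset.orderEmbOfFin_mem O rfl j))]
  congr 2
  simp

/-- Each term continues the block that ended at `i`: the label `i` is replaced by `k`, and the
vector accumulated by the block is stored under `k`. The new label is the largest, in agreement with
the selected factor having moved to the end. -/
theorem gauge_setTensor {J : H →L[ℂ] H} (hJJ : ∀ z, J (J z) = z) (α q : ℝ) (T : H →L[ℂ] H)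
    (O : Finset (Fin n)) (k : Fin n) (hk : ∀ i ∈ O, i < k) (y : Fin n → H) :
    gauge α q J T (setTensor O y) = ∑ i ∈ O, ∑ e : ℤˣ,
      signWeight α q e (above O i) (below O i) •
        setTensor (insert k (O.erase i)) (Function.update y k (T (signOp J e (y i)))) := by
  rcases O.eq_empty_or_nonempty with rfl | hO
  · rw [setTensor_empty, vacuum, gauge_ofDegree_zero, Finset.sum_empty]
  · obtain ⟨m, f, hf, rfl⟩ := exists_strictMono_image O hO
    have hk' : ∀ j, f j < k := fun j => hk _ (Finset.mem_image_of_mem f (Finset.mem_univ j))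
    rw [← ofDegree_tprod_eq_setTensor f hf, gauge_ofDegree_succ, Rop_tprod hJJ,
      Finset.sum_image hf.injective.injOn, map_sum, map_sum, Fintype.sum_prod_type]
    refine Finset.sum_congr rfl fun l _ => Finset.sum_congr rfl fun e _ => ?_
    rw [map_smul, lastOp_rightTensor, map_smul, image_erase_eq hf, ← cosetWeight_eq α q hf,
      ← rightTensor_setTensor (fun j => f (l.succAbove j)) (hf.comp (Fin.strictMono_succAbove l)) k
        fun j => hk' _,
      Function.update_self]
    congr 4
    funext j
    exact (Function.update_of_ne (hk' _).ne _ _).symm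

end State

/-! ## Arc diagrams -/

/-- A candidate for a coloured partition of a chain: `p j = some (i, e)` stands for an arc `(i, j)`
of colour `e`. -/
abbrev ArcMap (n : ℕ) : Type := Fin n → Option (Fin n × ℤˣ)

namespace ArcMap

variable {n : ℕ}

/-- The arcs go upwards, and no two arcs have the same left end. -/
structure Valid (p : ArcMap n) : Prop where
  lt : ∀ {j i e}, p j = some (i, e) → i < j
  inj : ∀ {j j' i e e'}, p j = some (i, e) → p j' = some (i, e') → j = j'

/-- The element `i` is the left end of an arc. -/
def Used (p : ArcMap n) (i : Fin n) : Prop := ∃ j e, p j = some (i, e)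

open Classical in
/-- The elements below `k` that are the left end of an arc that ends at or above `k`. -/
def opensAt (p : ArcMap n) (k : ℕ) : Finset (Fin n) :=
  Finset.univ.filter fun i => i.val < k ∧ ∃ j e, k ≤ j.val ∧ p j = some (i, e)

/-- The map `p` describes the arcs that end at or above `k`, when `O` is the set of open
elements. -/
structure StateAt (k : ℕ) (O : Finset (Fin n)) (p : ArcMap n) : Prop where
  valid : p.Valid
  eq_none : ∀ j : Fin n, j.val < k → p j = none
  mem_iff : ∀ i : Fin n, i ∈ O ↔ i.val < k ∧ p.Used i

theorem StateAt.opensAt_eq {k : ℕ} {O : Finset (Fin n)} {p : ArcMap n} (h : StateAt k O p) :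
    p.opensAt k = O := by
  ext i
  simp only [opensAt, Finset.mem_filter, Finset.mem_univ, true_and, h.mem_iff, Used]
  refine and_congr_right fun _ => ⟨fun ⟨j, e, _, hj⟩ => ⟨j, e, hj⟩, fun ⟨j, e, hj⟩ =>
    ⟨j, e, ?_, hj⟩⟩
  by_contra hk
  rw [h.eq_none j (not_le.1 hk)] at hj
  cases hj

theorem used_update {p : ArcMap n} {k : Fin n} (hk : p k = none) (i i' : Fin n) (e : ℤˣ) :
    Used (Function.update p k (some (i, e))) i' ↔ i' = i ∨ p.Used i' := by
  constructor
  · rintro ⟨j, e', hj⟩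
    by_cases h : j = k
    · subst h
      rw [Function.update_self] at hj
      left
      exact (congrArg Prod.fst (Option.some_inj.1 hj)).symm
    · rw [Function.update_of_ne h] at hj
      exact Or.inr ⟨j, e', hj⟩
  · rintro (rfl | ⟨j, e', hj⟩)
    · exact ⟨k, e, Function.update_self ..⟩
    · refine ⟨j, e', ?_⟩
      rw [Function.update_of_ne, hj]
      rintro rfl
      rw [hk] at hj
      cases hj

/-- When no arc ends at `k`, the two alternatives are whether `k` is the left end of an arc. -/
theorem stateAt_none_iff {k : Fin n} {O : Finset (Fin n)} (hO : ∀ i ∈ O, i < k) (p : ArcMap n) :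
    (StateAt k O p ∧ p k = none) ↔ StateAt (k.val + 1) O p ∨ StateAt (k.val + 1) (insert k O) p := by
  constructor
  · rintro ⟨h, hk⟩
    have hn : ∀ j : Fin n, j.val < k.val + 1 → p j = none := by
      intro j hj
      rcases Nat.lt_succ_iff_lt_or_eq.1 hj with hj | hj
      · exact h.eq_none j hj
      · rw [Fin.ext hj, hk]
    by_cases hu : p.Used k
    · refine Or.inr ⟨h.valid, hn, fun i => ?_⟩
      rw [Finset.mem_insert, h.mem_iff, Nat.lt_succ_iff_lt_or_eq]
      constructor
      · rintro (rfl | ⟨h1, h2⟩)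
        · exact ⟨Or.inr rfl, hu⟩
        · exact ⟨Or.inl h1, h2⟩
      · rintro ⟨h1 | h1, h2⟩
        · exact Or.inr ⟨h1, h2⟩
        · exact Or.inl (Fin.ext h1)
    · refine Or.inl ⟨h.valid, hn, fun i => ?_⟩
      rw [h.mem_iff, Nat.lt_succ_iff_lt_or_eq]
      constructor
      · rintro ⟨h1, h2⟩
        exact ⟨Or.inl h1, h2⟩
      · rintro ⟨h1 | h1, h2⟩
        · exact ⟨h1, h2⟩
        · rw [Fin.ext h1] at h2
          exact absurd h2 hu
  · rintro (h | h)
    · refine ⟨⟨h.valid, fun j hj => h.eq_none j (Nat.lt_succ_of_lt hj), fun i => ?_⟩,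
        h.eq_none k (Nat.lt_succ_self _)⟩
      refine ⟨fun hi => ⟨hO i hi, ((h.mem_iff i).1 hi).2⟩, fun hi =>
        (h.mem_iff i).2 ⟨Nat.lt_succ_of_lt hi.1, hi.2⟩⟩
    · refine ⟨⟨h.valid, fun j hj => h.eq_none j (Nat.lt_succ_of_lt hj), fun i => ?_⟩,
        h.eq_none k (Nat.lt_succ_self _)⟩
      refine ⟨fun hi => ⟨hO i hi, ((h.mem_iff i).1 (Finset.mem_insert_of_mem hi)).2⟩, fun hi => ?_⟩
      have := (h.mem_iff i).2 ⟨Nat.lt_succ_of_lt hi.1, hi.2⟩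
      exact (Finset.mem_insert.1 this).resolve_left (ne_of_lt (Fin.lt_def.2 hi.1))

/-- Here `p` is the diagram with the arc `(i, k)` removed. Since left ends are distinct, `i` must
have been open and is no longer a left end afterwards. -/
theorem stateAt_update_iff {k : Fin n} {O : Finset (Fin n)} (hO : ∀ i ∈ O, i < k) (p : ArcMap n)
    (i : Fin n) (e : ℤˣ) :
    (StateAt k O (Function.update p k (some (i, e))) ∧ p k = none) ↔
      i ∈ O ∧ (StateAt (k.val + 1) (O.erase i) p ∨
        StateAt (k.val + 1) (insert k (O.erase i)) p) := by
  rw [← stateAt_none_iff fun j hj => hO j (Finset.mem_of_mem_erase hj)]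
  constructor
  · rintro ⟨h, hk⟩
    have hself : Function.update p k (some (i, e)) k = some (i, e) := Function.update_self ..
    have hik : i < k := h.valid.lt hself
    have hup : ∀ {j a}, p j = some a → Function.update p k (some (i, e)) j = some a := by
      intro j a hj
      rw [Function.update_of_ne, hj]
      rintro rfl
      rw [hk] at hj
      cases hj
    refine ⟨(h.mem_iff i).2 ⟨hik, (used_update hk ..).2 (Or.inl rfl)⟩,
      ⟨⟨fun hj => h.valid.lt (hup hj), fun hj hj' => h.valid.inj (hup hj) (hup hj')⟩,
        fun j hj => ?_, fun i' => ?_⟩, hk⟩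
    · rw [← h.eq_none j hj, Function.update_of_ne (ne_of_lt (Fin.lt_def.2 hj))]
    · rw [Finset.mem_erase, h.mem_iff, used_update hk]
      constructor
      · rintro ⟨h1, h2, h3⟩
        exact ⟨h2, h3.resolve_left h1⟩
      · rintro ⟨h2, h3⟩
        refine ⟨?_, h2, Or.inr h3⟩
        rintro rfl
        obtain ⟨j, e', hj⟩ := h3
        have := h.valid.inj hself (hup hj)
        rw [← this, hk] at hj
        cases hj
  · rintro ⟨hi, h, hk⟩
    have hik := hO i hi
    have hnu : ¬ p.Used i := fun hu => (Finset.mem_erase.1 ((h.mem_iff i).2 ⟨hik, hu⟩)).1 rfl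
    refine ⟨⟨⟨?_, ?_⟩, fun j hj => ?_, fun i' => ?_⟩, hk⟩
    · intro j i' e' hj
      by_cases hjk : j = k
      · subst hjk
        rw [Function.update_self] at hj
        cases hj
        exact hik
      · rw [Function.update_of_ne hjk] at hj
        exact h.valid.lt hj
    · intro j j' i' e1 e2 hj hj'
      by_cases hjk : j = k <;> by_cases hjk' : j' = k
      · rw [hjk, hjk']
      · subst hjk
        rw [Function.update_self] at hj
        rw [Function.update_of_ne hjk'] at hj'
        cases hj
        exact absurd ⟨_, _, hj'⟩ hnu
      · subst hjk'
        rw [Function.update_self] at hj'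
        rw [Function.update_of_ne hjk] at hj
        cases hj'
        exact absurd ⟨_, _, hj⟩ hnu
      · rw [Function.update_of_ne hjk] at hj
        rw [Function.update_of_ne hjk'] at hj'
        exact h.valid.inj hj hj'
    · rw [Function.update_of_ne (ne_of_lt (Fin.lt_def.2 hj)), h.eq_none j hj]
    · rw [used_update hk]
      have := h.mem_iff i'
      rw [Finset.mem_erase] at this
      by_cases hii : i' = i
      · subst hii
        simp [hi, Fin.lt_def.1 hik]
      · simpa [hii] using this

theorem sum_update {M : Type*} [AddCommMonoid M] (k : Fin n) (F : ArcMap n → M) :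
    ∑ p, F p = ∑ p : ArcMap n with p k = none, ∑ a, F (Function.update p k a) := by
  rw [Finset.sum_sigma']
  refine Finset.sum_bij' (fun p _ => ⟨Function.update p k none, p k⟩)
    (fun x _ => Function.update x.1 k x.2) ?_ ?_ ?_ ?_ ?_
  · intro p _
    simp
  · simp
  · intro p _
    simp
  · rintro ⟨p, a⟩ hp
    simp only [Finset.mem_sigma, Finset.mem_filter, Finset.mem_univ, true_and, and_true] at hp
    simp [← hp]
  · intro p _
    simp

open Classical in
-- The cases at `k` are: singleton, first element of a larger block, last element, and inner
-- element. They match the summands `λ`, creation, annihilation and gauge of the operator.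
theorem sum_stateAt {M : Type*} [AddCommMonoid M] (k : Fin n) {O : Finset (Fin n)}
    (hO : ∀ i ∈ O, i < k) (G : ArcMap n → M) :
    ∑ p with StateAt k O p, G p =
      ((∑ p with StateAt (k.val + 1) O p, G p) +
        ∑ p with StateAt (k.val + 1) (insert k O) p, G p) +
      ∑ i ∈ O, ∑ e : ℤˣ,
        ((∑ p with StateAt (k.val + 1) (O.erase i) p, G (Function.update p k (some (i, e)))) +
          ∑ p with StateAt (k.val + 1) (insert k (O.erase i)) p,
            G (Function.update p k (some (i, e)))) := by
  have hor : ∀ (O' : Finset (Fin n)) (_ : k ∉ O') (F : ArcMap n → M),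
      (∑ p with StateAt (k.val + 1) O' p, F p) +
        ∑ p with StateAt (k.val + 1) (insert k O') p, F p =
      ∑ p with (StateAt (k.val + 1) O' p ∨ StateAt (k.val + 1) (insert k O') p), F p := by
    intro O' hk F
    rw [Finset.filter_or, Finset.sum_union]
    rw [Finset.disjoint_filter]
    intro p _ h1 h2
    exact hk ((h1.mem_iff k).2 ((h2.mem_iff k).1 (Finset.mem_insert_self k O')))
  have hkO : k ∉ O := fun h => lt_irrefl _ (hO k h)
  rw [Finset.sum_filter, sum_update k]
  simp only [Fintype.sum_option]
  rw [Finset.sum_add_distrib, hor O hkO]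
  congr 1
  · rw [Finset.sum_filter, Finset.sum_filter]
    refine Finset.sum_congr rfl fun p _ => ?_
    by_cases hk : p k = none
    · have hu : Function.update p k none = p := by rw [← hk, Function.update_eq_self]
      rw [if_pos hk, hu]
      exact if_congr (by rw [← stateAt_none_iff hO, and_iff_left hk]) rfl rfl
    · rw [if_neg hk, if_neg]
      rw [← stateAt_none_iff hO]
      exact fun h => hk h.2
  · have hi : ∀ f : Fin n → M, ∑ i ∈ O, f i = ∑ i, if i ∈ O then f i else 0 := by
      intro f
      rw [Finset.sum_ite_mem, Finset.univ_inter]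
    rw [Finset.sum_comm, Fintype.sum_prod_type, hi]
    refine Finset.sum_congr rfl fun i _ => ?_
    have hki : k ∉ O.erase i := fun h => hkO (Finset.mem_of_mem_erase h)
    split_ifs with hiO
    · refine Finset.sum_congr rfl fun e _ => ?_
      rw [hor _ hki, ← Finset.sum_filter, Finset.filter_filter]
      refine Finset.sum_congr (Finset.filter_congr fun p _ => ?_) fun _ _ => rfl
      rw [and_comm, stateAt_update_iff hO, and_iff_right hiO]
    · refine Finset.sum_eq_zero fun e _ => Finset.sum_eq_zero fun p hp => if_neg fun h => hiO ?_
      exact ((stateAt_update_iff hO p i e).1 ⟨h, (Finset.mem_filter.1 hp).2⟩).1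

/-! ## The weight of an arc diagram -/

section Weight

variable {H : Type*} [NormedAddCommGroup H] [InnerProductSpace ℂ H]

/-- The vector of the open block that ends at `j`, where `y` provides the vectors of the
minimal elements. -/
def chainVec (J : H →L[ℂ] H) (T : Fin n → H →L[ℂ] H) (p : ArcMap n) (y : Fin n → H)
    (j : Fin n) : H :=
  match p j with
  | none => y j
  | some (i, e) => if _h : i < j then T j (signOp J e (chainVec J T p y i)) else y j
termination_by j.val

theorem chainVec_none (J : H →L[ℂ] H) (T : Fin n → H →L[ℂ] H) {p : ArcMap n} (y : Fin n → H)
    {j : Fin n} (h : p j = none) : chainVec J T p y j = y j := by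
  rw [chainVec, h]

theorem chainVec_some (J : H →L[ℂ] H) (T : Fin n → H →L[ℂ] H) {p : ArcMap n} (y : Fin n → H)
    {i j : Fin n} {e : ℤˣ} (h : p j = some (i, e)) (hij : i < j) :
    chainVec J T p y j = T j (signOp J e (chainVec J T p y i)) := by
  rw [chainVec, h]
  exact dif_pos hij

/-- An arc into `k` from an element `i` with no arc ending at it can be absorbed into the initial
data: the block may be regarded as starting at `k` with the vector accumulated so far. -/
theorem chainVec_update (J : H →L[ℂ] H) (T : Fin n → H →L[ℂ] H) {p : ArcMap n} (hp : p.Valid)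
    (y : Fin n → H) {k i : Fin n} (e : ℤˣ) (hk : p k = none) (hik : i < k) (hi : p i = none)
    (j : Fin n) :
    chainVec J T (Function.update p k (some (i, e))) y j =
      chainVec J T p (Function.update y k (T k (signOp J e (y i)))) j := by
  induction hj : j.val using Nat.strong_induction_on generalizing j with
  | _ m ih =>
    subst hj
    by_cases hjk : j = k
    · subst hjk
      rw [chainVec_some J T y (Function.update_self ..) hik, chainVec_none J T _ hk,
        Function.update_self, chainVec_none J T y]
      rw [Function.update_of_ne hik.ne, hi]
    · have hpj : Function.update p k (some (i, e)) j = p j := Function.update_of_ne hjk _ _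
      cases hq : p j with
      | none =>
        rw [chainVec_none J T y (hpj.trans hq), chainVec_none J T _ hq, Function.update_of_ne hjk]
      | some a =>
        rcases a with ⟨i', e'⟩
        have hlt := hp.lt hq
        rw [chainVec_some J T y (hpj.trans hq) hlt, chainVec_some J T _ hq hlt,
          ih i'.val hlt i' rfl]

open Classical in
/-- The factor of the element `j` in the weight of an arc diagram. -/
def factor (α q : ℝ) (J : H →L[ℂ] H) (x : Fin n → H) (T : Fin n → H →L[ℂ] H) (lam : Fin n → ℝ)
    (p : ArcMap n) (y : Fin n → H) (j : Fin n) : ℂ :=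
  match p j with
  | none => if p.Used j then 1 else (lam j : ℂ)
  | some (i, e) => signWeight α q e (above (p.opensAt j) i) (below (p.opensAt j) i) *
      if p.Used j then 1 else ⟪x j, signOp J e (chainVec J T p y i)⟫_ℂ

end Weight

end ArcMap

/-! ### Expansion of the vacuum expectation over arc diagrams. -/

section Wick

variable {H : Type*} [NormedAddCommGroup H] [InnerProductSpace ℂ H] {n : ℕ}

theorem deformedInner_sum_right {κ : Type*} (α q : ℝ) (J : H →L[ℂ] H) (s : Finset κ) (u : Fock H)
    (f : κ → Fock H) :
    deformedInner α q J u (∑ i ∈ s, f i) = ∑ i ∈ s, deformedInner α q J u (f i) := by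
  simp only [deformedInner, map_sum]

namespace ArcMap

theorem opensAt_update {p : ArcMap n} {k : Fin n} (hk : p k = none) (a : Fin n × ℤˣ) {m : ℕ}
    (hm : k.val < m) : opensAt (Function.update p k (some a)) m = p.opensAt m := by
  ext i
  simp only [opensAt, Finset.mem_filter, Finset.mem_univ, true_and]
  refine and_congr_right fun _ => exists_congr fun j => exists_congr fun e =>
    and_congr_right fun hj => ?_
  rw [Function.update_of_ne]
  rintro rfl
  omega

open Classical in
theorem factor_update (α q : ℝ) (J : H →L[ℂ] H) (x : Fin n → H) (T : Fin n → H →L[ℂ] H)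
    (lam : Fin n → ℝ) {p : ArcMap n} (hp : p.Valid) (y : Fin n → H) {k i : Fin n} (e : ℤˣ)
    (hk : p k = none) (hik : i < k) (hi : p i = none) {j : Fin n} (hj : k < j) :
    factor α q J x T lam (Function.update p k (some (i, e))) y j =
      factor α q J x T lam p (Function.update y k (T k (signOp J e (y i)))) j := by
  have hu : Used (Function.update p k (some (i, e))) j ↔ p.Used j := by
    rw [used_update hk, or_iff_right (hik.trans hj).ne']
  have hpj : Function.update p k (some (i, e)) j = p j := Function.update_of_ne hj.ne' _ _
  simp only [factor, hpj, opensAt_update hk _ hj, chainVec_update J T hp y e hk hik hi]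
  cases p j with
  | none => exact if_congr hu rfl rfl
  | some a => exact congrArg (HMul.hMul _) (if_congr hu rfl rfl)

theorem prod_le_eq (k : Fin n) (f : Fin n → ℂ) :
    ∏ j with k.val ≤ j.val, f j = f k * ∏ j with k.val + 1 ≤ j.val, f j := by
  rw [← Finset.prod_insert (by simp)]
  refine Finset.prod_congr ?_ fun _ _ => rfl
  ext j
  simp only [Finset.mem_filter, Finset.mem_univ, true_and, Finset.mem_insert, Fin.ext_iff]
  omega

open Classical in
-- The induction is on the number `m` of operators still to be applied. On `O` the function `y`
-- holds the accumulated vectors of the open blocks, and from `k` on it still agrees with `x`. At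
-- the end only `O = ∅` survives, because the vacuum is orthogonal to tensors of positive degree.
theorem wick_from {J : H →L[ℂ] H} (hJJ : ∀ z, J (J z) = z) (α q : ℝ) (x : Fin n → H)
    (T : Fin n → H →L[ℂ] H) (lam : Fin n → ℝ) (m k : ℕ) (hkm : k + m = n) (O : Finset (Fin n))
    (hO : ∀ i ∈ O, i.val < k) (y : Fin n → H) (hy : ∀ j : Fin n, k ≤ j.val → y j = x j) :
    deformedInner α q J (vacuum H)
        (((List.ofFn fun i => typeBRightOp α q J (x i) (T i) (lam i)).drop k).reverse.prod
          (setTensor O y)) =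
      ∑ p : ArcMap n with StateAt k O p, ∏ j with k ≤ j.val, factor α q J x T lam p y j := by
  induction m generalizing k O y with
  | zero =>
    rw [add_zero] at hkm
    rw [List.drop_of_length_le (by simp [hkm]), List.reverse_nil, List.prod_nil,
      Module.End.one_apply, deformedInner_vacuum_setTensor]
    have h1 : ∀ p : ArcMap n, StateAt k O p ↔ O = ∅ ∧ p = fun _ => none := by
      intro p
      constructor
      · intro h
        have hp : p = fun _ => none := funext fun j => h.eq_none j (by omega)
        refine ⟨Finset.eq_empty_of_forall_notMem fun i hi => ?_, hp⟩
        obtain ⟨j, e, hj⟩ := ((h.mem_iff i).1 hi).2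
        rw [hp] at hj
        cases hj
      · rintro ⟨rfl, rfl⟩
        exact ⟨⟨fun h => (by cases h), fun h => (by cases h)⟩, fun _ _ => rfl, fun i => by simp [Used]⟩
    have h2 : (Finset.univ.filter fun j : Fin n => k ≤ j.val) = ∅ := by
      rw [Finset.filter_eq_empty_iff]
      intro j _
      omega
    simp only [h1, h2, Finset.prod_empty]
    split_ifs with h <;> simp [h, Finset.filter_eq']
  | succ m ih =>
    obtain ⟨κ, rfl⟩ : ∃ κ : Fin n, κ.val = k := ⟨⟨k, by omega⟩, rfl⟩
    have hO' : ∀ i ∈ O, i < κ := hO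
    have hκO : κ ∉ O := fun h => lt_irrefl _ (hO κ h)
    have hyκ : y κ = x κ := hy κ le_rfl
    have hdrop : (List.ofFn fun i => typeBRightOp α q J (x i) (T i) (lam i)).drop κ.val =
        typeBRightOp α q J (x κ) (T κ) (lam κ) ::
          (List.ofFn fun i => typeBRightOp α q J (x i) (T i) (lam i)).drop (κ.val + 1) := by
      rw [List.drop_eq_getElem_cons (by simp), List.getElem_ofFn]
    have ihy : ∀ O' : Finset (Fin n), (∀ i ∈ O', i.val < κ.val + 1) → _ := fun O' h =>
      ih (κ.val + 1) (by omega) O' h y fun j hj => hy j (by omega)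
    have ihy' : ∀ z, ∀ O' : Finset (Fin n), (∀ i ∈ O', i.val < κ.val + 1) → _ := fun z O' h =>
      ih (κ.val + 1) (by omega) O' h (Function.update y κ z) fun j hj => by
        rw [Function.update_of_ne, hy j (by omega)]
        rintro rfl
        omega
    have b1 : ∀ i ∈ O, i.val < κ.val + 1 := fun i hi => Nat.lt_succ_of_lt (hO i hi)
    have b2 : ∀ i ∈ insert κ O, i.val < κ.val + 1 := by
      intro i hi
      rcases Finset.mem_insert.1 hi with rfl | hi
      · exact Nat.lt_succ_self _
      · exact b1 i hi
    have b3 : ∀ l, ∀ i ∈ O.erase l, i.val < κ.val + 1 := fun l i hi =>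
      b1 i (Finset.mem_of_mem_erase hi)
    have b4 : ∀ l, ∀ i ∈ insert κ (O.erase l), i.val < κ.val + 1 := fun l i hi =>
      b2 i (Finset.insert_subset_insert _ (Finset.erase_subset _ _) hi)
    rw [hdrop, List.reverse_cons, List.prod_append, List.prod_singleton, Module.End.mul_apply,
      typeBRightOp]
    simp only [LinearMap.add_apply, LinearMap.smul_apply, Module.End.one_apply]
    rw [annihilation_setTensor hJJ, gauge_setTensor hJJ α q (T κ) O κ hO', ← hyκ,
      rightCreation_setTensor O κ hO']
    simp only [map_add, map_sum, map_smul, deformedInner_add_right, deformedInner_sum_right,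
      deformedInner_smul_right]
    rw [ihy O b1, ihy _ b2, sum_stateAt κ hO']
    have hnone : ∀ {O' : Finset (Fin n)} {p : ArcMap n}, StateAt (κ.val + 1) O' p → p κ = none :=
      fun h => h.eq_none κ (Nat.lt_succ_self _)
    have g1 : (∑ p : ArcMap n with StateAt (κ.val + 1) O p,
        ∏ j with κ.val ≤ j.val, factor α q J x T lam p y j) =
        lam κ * ∑ p : ArcMap n with StateAt (κ.val + 1) O p,
          ∏ j with κ.val + 1 ≤ j.val, factor α q J x T lam p y j := by
      rw [Finset.mul_sum]
      refine Finset.sum_congr rfl fun p hp => ?_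
      have h := (Finset.mem_filter.1 hp).2
      have hu : ¬ p.Used κ := fun hu => hκO ((h.mem_iff κ).2 ⟨Nat.lt_succ_self _, hu⟩)
      rw [prod_le_eq]
      congr 1
      rw [factor, hnone h]
      exact if_neg hu
    have g2 : (∑ p : ArcMap n with StateAt (κ.val + 1) (insert κ O) p,
        ∏ j with κ.val ≤ j.val, factor α q J x T lam p y j) =
        ∑ p : ArcMap n with StateAt (κ.val + 1) (insert κ O) p,
          ∏ j with κ.val + 1 ≤ j.val, factor α q J x T lam p y j := by
      refine Finset.sum_congr rfl fun p hp => ?_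
      have h := (Finset.mem_filter.1 hp).2
      have hu : p.Used κ := ((h.mem_iff κ).1 (Finset.mem_insert_self κ O)).2
      rw [prod_le_eq]
      have : factor α q J x T lam p y κ = 1 := by
        rw [factor, hnone h]
        exact if_pos hu
      rw [this, one_mul]
    -- The arc `(i, κ)` contributes its own weight, and the later factors notice it only through the
    -- vector stored at `κ`.
    have hfac : ∀ {O' : Finset (Fin n)} {p : ArcMap n} {i : Fin n} (e : ℤˣ), i ∈ O →
        (O' = O.erase i ∨ O' = insert κ (O.erase i)) → StateAt (κ.val + 1) O' p →
        ∏ j with κ.val ≤ j.val, factor α q J x T lam (Function.update p κ (some (i, e))) y j =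
          (signWeight α q e (above O i) (below O i) *
            if p.Used κ then 1 else ⟪x κ, signOp J e (y i)⟫_ℂ) *
          ∏ j with κ.val + 1 ≤ j.val, factor α q J x T lam p
            (Function.update y κ (T κ (signOp J e (y i)))) j := by
      intro O' p i e hi hO1 h
      have hiκ := hO' i hi
      have hpi : p i = none := h.eq_none i (Nat.lt_succ_of_lt hiκ)
      have hst : StateAt κ O (Function.update p κ (some (i, e))) :=
        ((stateAt_update_iff hO' p i e).2 ⟨hi, by rcases hO1 with rfl | rfl <;> simp [h]⟩).1
      rw [prod_le_eq]
      congr 1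
      · have hu : Used (Function.update p κ (some (i, e))) κ ↔ p.Used κ := by
          rw [used_update (hnone h), or_iff_right hiκ.ne']
        have hc : chainVec J T (Function.update p κ (some (i, e))) y i = y i :=
          chainVec_none J T y (by rw [Function.update_of_ne hiκ.ne, hpi])
        rw [factor, Function.update_self]
        simp only [hst.opensAt_eq, hu, hc]
      · refine Finset.prod_congr rfl fun j hj => ?_
        exact factor_update α q J x T lam h.valid y e (hnone h) hiκ hpi
          (Fin.lt_def.2 (Nat.lt_of_succ_le (Finset.mem_filter.1 hj).2))
    rw [g1, g2]
    have g3 : ∀ i ∈ O, ∀ e : ℤˣ,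
        (∑ p : ArcMap n with StateAt (κ.val + 1) (O.erase i) p,
          ∏ j with κ.val ≤ j.val, factor α q J x T lam (Function.update p κ (some (i, e))) y j) =
        (signWeight α q e (above O i) (below O i) * ⟪x κ, signOp J e (y i)⟫_ℂ) *
          ∑ p : ArcMap n with StateAt (κ.val + 1) (O.erase i) p,
          ∏ j with κ.val + 1 ≤ j.val, factor α q J x T lam p
            (Function.update y κ (T κ (signOp J e (y i)))) j := by
      intro i hi e
      rw [Finset.mul_sum]
      refine Finset.sum_congr rfl fun p hp => ?_
      have h := (Finset.mem_filter.1 hp).2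
      have hu : ¬ p.Used κ := fun hu => hκO (Finset.mem_of_mem_erase
        ((h.mem_iff κ).2 ⟨Nat.lt_succ_self _, hu⟩))
      rw [hfac e hi (Or.inl rfl) h, if_neg hu]
    have g4 : ∀ i ∈ O, ∀ e : ℤˣ,
        (∑ p : ArcMap n with StateAt (κ.val + 1) (insert κ (O.erase i)) p,
          ∏ j with κ.val ≤ j.val, factor α q J x T lam (Function.update p κ (some (i, e))) y j) =
        signWeight α q e (above O i) (below O i) *
          ∑ p : ArcMap n with StateAt (κ.val + 1) (insert κ (O.erase i)) p,
          ∏ j with κ.val + 1 ≤ j.val, factor α q J x T lam p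
            (Function.update y κ (T κ (signOp J e (y i)))) j := by
      intro i hi e
      rw [Finset.mul_sum]
      refine Finset.sum_congr rfl fun p hp => ?_
      have h := (Finset.mem_filter.1 hp).2
      have hu : p.Used κ := ((h.mem_iff κ).1 (Finset.mem_insert_self κ _)).2
      rw [hfac e hi (Or.inr rfl) h, if_pos hu, mul_one]
    -- Once the block is closed, `κ` is not an open label and its stored vector is irrelevant.
    -- Changing it gives the annihilation term the same `y` as `factor_update` produces.
    have e3 : ∀ i e, setTensor (O.erase i) y =
        setTensor (O.erase i) (Function.update y κ (T κ (signOp J e (y i)))) := by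
      intro i e
      refine setTensor_congr fun l hl => (Function.update_of_ne ?_ _ _).symm
      rintro rfl
      exact hκO (Finset.mem_of_mem_erase hl)
    have f3 : (∑ i ∈ O, ∑ e : ℤˣ,
        (signWeight α q e (above O i) (below O i) * ⟪y κ, signOp J e (y i)⟫_ℂ) *
          deformedInner α q J (vacuum H)
            (((List.ofFn fun i => typeBRightOp α q J (x i) (T i) (lam i)).drop
              (κ.val + 1)).reverse.prod (setTensor (O.erase i) y))) =
        ∑ i ∈ O, ∑ e : ℤˣ, ∑ p : ArcMap n with StateAt (κ.val + 1) (O.erase i) p,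
          ∏ j with κ.val ≤ j.val,
            factor α q J x T lam (Function.update p κ (some (i, e))) y j := by
      refine Finset.sum_congr rfl fun i hi => Finset.sum_congr rfl fun e _ => ?_
      rw [g3 i hi e, e3 i e, ihy' _ _ (b3 i), hyκ]
    have f4 : (∑ i ∈ O, ∑ e : ℤˣ, signWeight α q e (above O i) (below O i) *
          deformedInner α q J (vacuum H)
            (((List.ofFn fun i => typeBRightOp α q J (x i) (T i) (lam i)).drop
              (κ.val + 1)).reverse.prod (setTensor (insert κ (O.erase i))
                (Function.update y κ (T κ (signOp J e (y i))))))) =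
        ∑ i ∈ O, ∑ e : ℤˣ, ∑ p : ArcMap n with StateAt (κ.val + 1) (insert κ (O.erase i)) p,
          ∏ j with κ.val ≤ j.val,
            factor α q J x T lam (Function.update p κ (some (i, e))) y j := by
      refine Finset.sum_congr rfl fun i hi => Finset.sum_congr rfl fun e _ => ?_
      rw [g4 i hi e, ihy' _ _ (b4 i)]
    rw [f3, f4]
    simp only [Finset.sum_add_distrib]
    ring

open Classical in
theorem wick_arcMap {J : H →L[ℂ] H} (hJJ : ∀ z, J (J z) = z) (α q : ℝ) (x : Fin n → H)
    (T : Fin n → H →L[ℂ] H) (lam : Fin n → ℝ) :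
    deformedInner α q J (vacuum H)
        ((List.ofFn fun i => typeBRightOp α q J (x i) (T i) (lam i)).reverse.prod (vacuum H)) =
      ∑ p : ArcMap n with p.Valid, ∏ j, factor α q J x T lam p x j := by
  have h := wick_from hJJ α q x T lam n 0 (zero_add n) ∅ (by simp) x fun _ _ => rfl
  rw [setTensor_empty, List.drop_zero] at h
  rw [h]
  refine Finset.sum_congr (Finset.filter_congr fun p _ => ?_) fun p _ => ?_
  · exact ⟨fun h => h.valid, fun h => ⟨h, fun _ hj => absurd hj (Nat.not_lt_zero _), by simp⟩⟩
  · simp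

end ArcMap

end Wick

/-! ## Partitions of type B as arc diagrams -/

section Partition

variable {n : ℕ}

theorem mem_blockArcs {B : Finset (Fin n)} {a : Fin n × Fin n} :
    a ∈ blockArcs B ↔ a.1 ∈ B ∧ a.2 ∈ B ∧ a.1 < a.2 ∧ ∀ k ∈ B, a.1 < k → a.2 ≤ k := by
  simp [blockArcs]

theorem mem_arcs {π : Finpartition (Finset.univ : Finset (Fin n))} {a : Fin n × Fin n} :
    a ∈ arcs π ↔ ∃ B ∈ π.parts, a ∈ blockArcs B := by
  simp [arcs]

theorem mem_blockArcs_of_mem_arcs {π : Finpartition (Finset.univ : Finset (Fin n))}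
    {a : Fin n × Fin n} (ha : a ∈ arcs π) {B : Finset (Fin n)} (hB : B ∈ π.parts)
    (h : a.1 ∈ B ∨ a.2 ∈ B) : a ∈ blockArcs B := by
  obtain ⟨B', hB', h'⟩ := mem_arcs.1 ha
  obtain ⟨h1, h2, -⟩ := mem_blockArcs.1 h'
  have : B = B' := by
    rcases h with h | h
    · exact π.eq_of_mem_parts hB hB' h h1
    · exact π.eq_of_mem_parts hB hB' h h2
  rwa [this]

theorem arcs_lt {π : Finpartition (Finset.univ : Finset (Fin n))} {a : Fin n × Fin n}
    (ha : a ∈ arcs π) : a.1 < a.2 := by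
  obtain ⟨B, -, h⟩ := mem_arcs.1 ha
  exact (mem_blockArcs.1 h).2.2.1

theorem arcs_left_inj {π : Finpartition (Finset.univ : Finset (Fin n))} {a b : Fin n × Fin n}
    (ha : a ∈ arcs π) (hb : b ∈ arcs π) (h : a.1 = b.1) : a = b := by
  obtain ⟨B, hB, ha'⟩ := mem_arcs.1 ha
  have hb' := mem_blockArcs_of_mem_arcs hb hB (Or.inl (h ▸ (mem_blockArcs.1 ha').1))
  obtain ⟨-, a2, a3, a4⟩ := mem_blockArcs.1 ha'
  obtain ⟨-, b2, b3, b4⟩ := mem_blockArcs.1 hb'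
  exact Prod.ext h (le_antisymm (a4 _ b2 (h ▸ b3)) (b4 _ a2 (h ▸ a3)))

theorem arcs_right_inj {π : Finpartition (Finset.univ : Finset (Fin n))} {a b : Fin n × Fin n}
    (ha : a ∈ arcs π) (hb : b ∈ arcs π) (h : a.2 = b.2) : a = b := by
  obtain ⟨B, hB, ha'⟩ := mem_arcs.1 ha
  have hb' := mem_blockArcs_of_mem_arcs hb hB (Or.inr (h ▸ (mem_blockArcs.1 ha').2.1))
  obtain ⟨a1, -, a3, a4⟩ := mem_blockArcs.1 ha'
  obtain ⟨b1, -, b3, b4⟩ := mem_blockArcs.1 hb'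
  refine Prod.ext (le_antisymm ?_ ?_) h <;> by_contra hlt
  · exact absurd (b4 _ a1 (not_le.1 hlt)) (not_le.2 (h ▸ a3))
  · exact absurd (a4 _ b1 (not_le.1 hlt)) (not_le.2 (h ▸ b3))

theorem exists_blockArc_right {B : Finset (Fin n)} {j k : Fin n} (hj : j ∈ B) (hk : k ∈ B)
    (h : k < j) : ∃ i, (i, j) ∈ blockArcs B := by
  obtain ⟨i, hi, hmax⟩ := (B.filter (· < j)).exists_max_image id
    ⟨k, Finset.mem_filter.2 ⟨hk, h⟩⟩
  obtain ⟨h1, h2⟩ := Finset.mem_filter.1 hi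
  refine ⟨i, mem_blockArcs.2 ⟨h1, hj, h2, fun l hl hlt => ?_⟩⟩
  by_contra hlj
  exact absurd (hmax l (Finset.mem_filter.2 ⟨hl, not_le.1 hlj⟩)) (not_le.2 hlt)

theorem exists_blockArc_left {B : Finset (Fin n)} {j k : Fin n} (hj : j ∈ B) (hk : k ∈ B)
    (h : j < k) : ∃ i, (j, i) ∈ blockArcs B := by
  obtain ⟨i, hi, hmin⟩ := (B.filter (j < ·)).exists_min_image id
    ⟨k, Finset.mem_filter.2 ⟨hk, h⟩⟩
  obtain ⟨h1, h2⟩ := Finset.mem_filter.1 hi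
  exact ⟨i, mem_blockArcs.2 ⟨hj, h1, h2, fun l hl hlt => hmin l (Finset.mem_filter.2 ⟨hl, hlt⟩)⟩⟩

namespace ArcMap

/-- The minimal element of the block of `j`. -/
def root (p : ArcMap n) (j : Fin n) : Fin n :=
  match p j with
  | none => j
  | some (i, _) => if _h : i < j then root p i else j
termination_by j.val

theorem root_none {p : ArcMap n} {j : Fin n} (h : p j = none) : p.root j = j := by
  rw [root, h]

theorem root_some {p : ArcMap n} (hp : p.Valid) {i j : Fin n} {e : ℤˣ} (h : p j = some (i, e)) :
    p.root j = p.root i := by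
  rw [root, h]
  exact dif_pos (hp.lt h)

theorem root_le {p : ArcMap n} (hp : p.Valid) (j : Fin n) : p.root j ≤ j := by
  induction hj : j.val using Nat.strong_induction_on generalizing j with
  | _ m ih =>
    subst hj
    cases h : p j with
    | none => rw [root_none h]
    | some a =>
      rw [root_some hp h]
      exact (ih _ (hp.lt h) _ rfl).trans (hp.lt h).le

/-- Descend from `j` to its predecessor `i'`. If `i < i'`, recurse to `i'`; if `i = i'`, the arc is
found. If `i' < i`, the same claim for `i' < i` gives an arc from `i'` ending at or below `i`,
although the only arc from `i'` ends at `j`. -/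
theorem exists_of_root_eq {p : ArcMap n} (hp : p.Valid) {i j : Fin n} (hij : i < j)
    (h : p.root i = p.root j) : ∃ k ≤ j, ∃ e, p k = some (i, e) := by
  induction hj : j.val using Nat.strong_induction_on generalizing i j with
  | _ m ih =>
    subst hj
    cases hpj : p j with
    | none =>
      rw [root_none hpj] at h
      exact absurd (root_le hp i) (not_le.2 (h ▸ hij))
    | some a =>
      rcases a with ⟨i', e⟩
      have hr := root_some hp hpj
      rcases lt_trichotomy i i' with hlt | rfl | hlt
      · obtain ⟨k, hk, hk'⟩ := ih i'.val (hp.lt hpj) hlt (h.trans hr) rfl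
        exact ⟨k, hk.trans (hp.lt hpj).le, hk'⟩
      · exact ⟨j, le_rfl, e, hpj⟩
      · obtain ⟨k, hk, e', hk'⟩ := ih i.val hij hlt (hr.symm.trans h.symm) rfl
        rw [hp.inj hk' hpj] at hk
        exact absurd hk (not_le.2 hij)

/-- The partition of an arc diagram. -/
def toFinpartition (p : ArcMap n) : Finpartition (Finset.univ : Finset (Fin n)) :=
  letI : DecidableRel (Setoid.ker p.root).r := fun i j => decEq (p.root i) (p.root j)
  Finpartition.ofSetoid (Setoid.ker p.root)

theorem mem_toFinpartition {p : ArcMap n} {B : Finset (Fin n)} :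
    B ∈ p.toFinpartition.parts ↔ ∃ i, B = Finset.univ.filter fun j => p.root i = p.root j := by
  simp only [toFinpartition, Finpartition.ofSetoid, Finpartition.ofSetSetoid_parts,
    Finset.mem_image, Finset.mem_univ, true_and]
  exact exists_congr fun i => eq_comm

theorem mem_arcs_toFinpartition {p : ArcMap n} (hp : p.Valid) {i j : Fin n} :
    (i, j) ∈ arcs p.toFinpartition ↔ ∃ e, p j = some (i, e) := by
  rw [mem_arcs]
  constructor
  · rintro ⟨B, hB, h⟩
    obtain ⟨l, rfl⟩ := mem_toFinpartition.1 hB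
    simp only [mem_blockArcs, Finset.mem_filter, Finset.mem_univ, true_and] at h
    obtain ⟨h1, h2, h3, h4⟩ := h
    obtain ⟨k, hk, e, hke⟩ := exists_of_root_eq hp h3 (h1.symm.trans h2)
    have hjk := h4 k (h1.trans (root_some hp hke).symm) (hp.lt hke)
    rw [le_antisymm hjk hk]
    exact ⟨e, hke⟩
  · rintro ⟨e, h⟩
    refine ⟨_, mem_toFinpartition.2 ⟨i, rfl⟩, ?_⟩
    simp only [mem_blockArcs, Finset.mem_filter, Finset.mem_univ, true_and]
    refine ⟨(root_some hp h).symm, hp.lt h, fun k hk hik => ?_⟩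
    obtain ⟨k', hk', e', h'⟩ := exists_of_root_eq hp hik hk
    rw [hp.inj h h']
    exact hk'

end ArcMap

namespace PartitionB

open Classical in
/-- The arc diagram of a partition of type B. -/
def toArcMap (πf : PartitionB n) : ArcMap n := fun j =>
  if h : ∃ i, (i, j) ∈ arcs πf.1 then some (h.choose, πf.color (h.choose, j)) else none

theorem toArcMap_eq_some {πf : PartitionB n} {i j : Fin n} {e : ℤˣ} :
    πf.toArcMap j = some (i, e) ↔ (i, j) ∈ arcs πf.1 ∧ πf.color (i, j) = e := by
  unfold toArcMap
  constructor
  · intro h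
    split_ifs at h with hex
    cases h
    exact ⟨hex.choose_spec, rfl⟩
  · rintro ⟨h, rfl⟩
    have hex : ∃ i, (i, j) ∈ arcs πf.1 := ⟨i, h⟩
    rw [dif_pos hex, show hex.choose = i from
      congrArg Prod.fst (arcs_right_inj hex.choose_spec h rfl)]

theorem toArcMap_eq_none {πf : PartitionB n} {j : Fin n} :
    πf.toArcMap j = none ↔ ∀ i, (i, j) ∉ arcs πf.1 := by
  rw [toArcMap, dite_eq_right_iff]
  simp

theorem used_toArcMap {πf : PartitionB n} {i : Fin n} :
    πf.toArcMap.Used i ↔ ∃ j, (i, j) ∈ arcs πf.1 := by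
  simp [ArcMap.Used, toArcMap_eq_some]

theorem valid_toArcMap (πf : PartitionB n) : πf.toArcMap.Valid where
  lt h := arcs_lt (toArcMap_eq_some.1 h).1
  inj h h' := congrArg Prod.snd
    (arcs_left_inj (toArcMap_eq_some.1 h).1 (toArcMap_eq_some.1 h').1 rfl)

theorem root_toArcMap_mem (πf : PartitionB n) {B : Finset (Fin n)} (hB : B ∈ πf.1.parts)
    {j : Fin n} (hj : j ∈ B) :
    πf.toArcMap.root j ∈ B ∧ ∀ k ∈ B, πf.toArcMap.root j ≤ k := by
  induction h : j.val using Nat.strong_induction_on generalizing j with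
  | _ m ih =>
    subst h
    cases hp : πf.toArcMap j with
    | none =>
      rw [ArcMap.root_none hp]
      refine ⟨hj, fun k hk => ?_⟩
      by_contra hlt
      obtain ⟨i, hi⟩ := exists_blockArc_right hj hk (not_le.1 hlt)
      exact toArcMap_eq_none.1 hp i (mem_arcs.2 ⟨B, hB, hi⟩)
    | some a =>
      rw [ArcMap.root_some πf.valid_toArcMap hp]
      have ha := (toArcMap_eq_some.1 hp).1
      exact ih _ (arcs_lt ha)
        (mem_blockArcs.1 (mem_blockArcs_of_mem_arcs ha hB (Or.inr hj))).1 rfl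

theorem mem_iff_root_eq (πf : PartitionB n) {B : Finset (Fin n)} (hB : B ∈ πf.1.parts)
    {i j : Fin n} (hi : i ∈ B) : j ∈ B ↔ πf.toArcMap.root i = πf.toArcMap.root j := by
  obtain ⟨h1, h2⟩ := root_toArcMap_mem πf hB hi
  constructor
  · intro hj
    obtain ⟨h3, h4⟩ := root_toArcMap_mem πf hB hj
    exact le_antisymm (h2 _ h3) (h4 _ h1)
  · intro h
    obtain ⟨B', hB', hj'⟩ := πf.1.exists_mem (Finset.mem_univ j)
    have h3 := (root_toArcMap_mem πf hB' hj').1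
    rw [← h] at h3
    rwa [πf.1.eq_of_mem_parts hB hB' h1 h3]

theorem parts_subset_of_toArcMap_eq {πf πf' : PartitionB n} (h : πf.toArcMap = πf'.toArcMap) :
    πf.1.parts ⊆ πf'.1.parts := by
  intro B hB
  obtain ⟨i, hi⟩ := πf.1.nonempty_of_mem_parts hB
  obtain ⟨B', hB', hi'⟩ := πf'.1.exists_mem (Finset.mem_univ i)
  have : B = B' := by
    ext j
    rw [mem_iff_root_eq πf hB hi, mem_iff_root_eq πf' hB' hi', h]
  rwa [this]

/-- The blocks are the classes of elements with the same root, so the arc diagram determines the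
partition, and then the colour of each arc. -/
theorem toArcMap_injective : Function.Injective (toArcMap (n := n)) := by
  rintro ⟨π, f⟩ ⟨π', f'⟩ h
  have hπ : π = π' := Finpartition.ext (Finset.Subset.antisymm
    (parts_subset_of_toArcMap_eq h) (parts_subset_of_toArcMap_eq h.symm))
  subst hπ
  congr 1
  funext ⟨⟨i, j⟩, ha⟩
  have h1 : toArcMap ⟨π, f⟩ j = some (i, f ⟨(i, j), ha⟩) :=
    toArcMap_eq_some.2 ⟨ha, dif_pos ha⟩
  rw [h] at h1
  exact ((dif_pos ha).symm.trans (toArcMap_eq_some.1 h1).2).symm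

theorem exists_toArcMap_eq {p : ArcMap n} (hp : p.Valid) : ∃ πf : PartitionB n, πf.toArcMap = p := by
  -- The default colour `1` is never reached, since every arc of this partition comes from a value
  -- `some` of `p`.
  refine ⟨⟨p.toFinpartition, fun a => ((p a.1.2).map Prod.snd).getD 1⟩, ?_⟩
  funext j
  cases h : p j with
  | none =>
    rw [toArcMap_eq_none]
    intro i hi
    obtain ⟨e, he⟩ := (ArcMap.mem_arcs_toFinpartition hp).1 hi
    rw [h] at he
    cases he
  | some a =>
    rcases a with ⟨i, e⟩
    have ha := (ArcMap.mem_arcs_toFinpartition hp).2 ⟨e, h⟩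
    refine toArcMap_eq_some.2 ⟨ha, (dif_pos ha).trans ?_⟩
    simp [h]

open Classical in
theorem sum_valid_eq {M : Type*} [AddCommMonoid M] (F : ArcMap n → M) :
    ∑ p with ArcMap.Valid p, F p = ∑ πf : PartitionB n, F πf.toArcMap := by
  symm
  refine Finset.sum_bij (fun πf _ => πf.toArcMap) (fun πf _ => ?_) (fun _ _ _ _ h =>
    toArcMap_injective h) (fun p hp => ?_) fun _ _ => rfl
  · exact Finset.mem_filter.2 ⟨Finset.mem_univ _, πf.valid_toArcMap⟩
  · obtain ⟨πf, h⟩ := exists_toArcMap_eq (Finset.mem_filter.1 hp).2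
    exact ⟨πf, Finset.mem_univ _, h⟩

end PartitionB

end Partition

namespace PartitionB

/-! ## The weights of the two descriptions agree -/

section Blocks

variable {H : Type*} [NormedAddCommGroup H] [InnerProductSpace ℂ H] {n : ℕ}

theorem color_of_mem (πf : PartitionB n) {i j : Fin n} (h : (i, j) ∈ arcs πf.1) :
    πf.toArcMap j = some (i, πf.color (i, j)) :=
  toArcMap_eq_some.2 ⟨h, rfl⟩

/-- The list must contain all elements of `B` up to `i`. Then consecutive entries are arcs, and the
last entry is the minimum of `B`, where both recursions stop. -/
theorem chain_eq_chainVec (πf : PartitionB n) (J : H →L[ℂ] H) (x : Fin n → H)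
    (T : Fin n → H →L[ℂ] H) {B : Finset (Fin n)} (hB : B ∈ πf.1.parts) (i : Fin n)
    (l : List (Fin n)) (hs : (i :: l).Pairwise (· > ·)) (hl : ∀ k ∈ i :: l, k ∈ B)
    (hd : ∀ k ∈ B, k ≤ i → k ∈ i :: l) :
    πf.chain J x T (i :: l) = ArcMap.chainVec J T πf.toArcMap x i := by
  have hi : i ∈ B := hl i List.mem_cons_self
  induction l generalizing i with
  | nil =>
    rw [chain, ArcMap.chainVec_none]
    refine toArcMap_eq_none.2 fun k hk => ?_
    have hkB := (mem_blockArcs.1 (mem_blockArcs_of_mem_arcs hk hB (Or.inr hi))).1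
    have := hd k hkB (arcs_lt hk).le
    rw [List.mem_singleton] at this
    exact absurd (arcs_lt hk) (this ▸ lt_irrefl _)
  | cons b l ih =>
    obtain ⟨hs1, hs2⟩ := List.pairwise_cons.1 hs
    have hbi : b < i := hs1 b List.mem_cons_self
    have hb : b ∈ B := hl b (by simp)
    have htail : ∀ k ∈ B, k < i → k ∈ b :: l := fun k hk hki =>
      (List.mem_cons.1 (hd k hk hki.le)).resolve_left hki.ne
    have harc : (b, i) ∈ arcs πf.1 := by
      refine mem_arcs.2 ⟨B, hB, mem_blockArcs.2 ⟨hb, hi, hbi, fun k hk hbk => ?_⟩⟩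
      by_contra hki
      rcases List.mem_cons.1 (htail k hk (not_le.1 hki)) with rfl | hkl
      · exact lt_irrefl _ hbk
      · exact lt_asymm hbk ((List.pairwise_cons.1 hs2).1 k hkl)
    rw [ArcMap.chainVec_some J T x (color_of_mem πf harc) hbi, chain,
      ih b hs2 (fun k hk => hl k (List.mem_cons_of_mem i hk))
        (fun k hk hkb => htail k hk (hkb.trans_lt hbi)) hb]
    rfl

open Classical in
/-- The part of the factor of `j` that does not depend on `α` and `q`. -/
def blockFactor (πf : PartitionB n) (J : H →L[ℂ] H) (x : Fin n → H) (T : Fin n → H →L[ℂ] H)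
    (lam : Fin n → ℝ) (j : Fin n) : ℂ :=
  if πf.toArcMap.Used j then 1 else
    match πf.toArcMap j with
    | none => (lam j : ℂ)
    | some (i, e) => ⟪x j, signOp J e (ArcMap.chainVec J T πf.toArcMap x i)⟫_ℂ

/-- Every element of a block except its maximum is a left end and contributes `1`, so the maximum
carries the whole cumulant. -/
theorem cumulant_eq (πf : PartitionB n) (J : H →L[ℂ] H) (x : Fin n → H)
    (T : Fin n → H →L[ℂ] H) (lam : Fin n → ℝ) {B : Finset (Fin n)} (hB : B ∈ πf.1.parts) :
    πf.cumulant J x T lam B = ∏ j ∈ B, πf.blockFactor J x T lam j := by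
  have hs : (B.sort (· ≥ ·)).Pairwise (· > ·) := B.sortedGT_sort.pairwise
  have hm : ∀ k, k ∈ B.sort (· ≥ ·) ↔ k ∈ B := fun k => Finset.mem_sort _
  unfold cumulant
  generalize B.sort (· ≥ ·) = L at hs hm
  cases L with
  | nil =>
    obtain ⟨i, hi⟩ := πf.1.nonempty_of_mem_parts hB
    simpa using (hm i).2 hi
  | cons j l =>
    have hj : j ∈ B := (hm j).1 List.mem_cons_self
    have hjmax : ∀ k ∈ B, k ≠ j → k < j := fun k hk hkj =>
      (List.pairwise_cons.1 hs).1 k ((List.mem_cons.1 ((hm k).2 hk)).resolve_left hkj)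
    have hu : ¬ πf.toArcMap.Used j := by
      intro h
      obtain ⟨k, hk⟩ := used_toArcMap.1 h
      have hkB := (mem_blockArcs.1 (mem_blockArcs_of_mem_arcs hk hB (Or.inl hj))).2.1
      exact lt_asymm (arcs_lt hk) (hjmax k hkB (arcs_lt hk).ne')
    rw [Finset.prod_eq_single_of_mem j hj, blockFactor, if_neg hu]
    · cases l with
      | nil =>
        have hn : πf.toArcMap j = none := by
          refine toArcMap_eq_none.2 fun k hk => ?_
          have hkB := (mem_blockArcs.1 (mem_blockArcs_of_mem_arcs hk hB (Or.inr hj))).1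
          have := (hm k).2 hkB
          rw [List.mem_singleton] at this
          exact absurd (arcs_lt hk) (this ▸ lt_irrefl _)
        rw [hn]
      | cons i l =>
        obtain ⟨hs1, hs2⟩ := List.pairwise_cons.1 hs
        have hij : i < j := hs1 i List.mem_cons_self
        have hi : i ∈ B := (hm i).1 (by simp)
        have htail : ∀ k ∈ B, k < j → k ∈ i :: l := fun k hk hkj =>
          (List.mem_cons.1 ((hm k).2 hk)).resolve_left hkj.ne
        have harc : (i, j) ∈ arcs πf.1 := by
          refine mem_arcs.2 ⟨B, hB, mem_blockArcs.2 ⟨hi, hj, hij, fun k hk hik => ?_⟩⟩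
          by_contra hkj
          rcases List.mem_cons.1 (htail k hk (not_le.1 hkj)) with rfl | hkl
          · exact lt_irrefl _ hik
          · exact lt_asymm hik ((List.pairwise_cons.1 hs2).1 k hkl)
        rw [color_of_mem πf harc]
        dsimp only
        rw [chain_eq_chainVec πf J x T hB i l hs2
          (fun k hk => (hm k).1 (List.mem_cons_of_mem j hk))
          (fun k hk hki => htail k hk (hki.trans_lt hij))]
        rfl
    · intro k hk hkj
      rw [blockFactor, if_pos]
      obtain ⟨i, hi⟩ := exists_blockArc_left hk hj (hjmax k hk hkj)
      exact used_toArcMap.2 ⟨i, mem_arcs.2 ⟨B, hB, hi⟩⟩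

theorem prod_cumulant (πf : PartitionB n) (J : H →L[ℂ] H) (x : Fin n → H)
    (T : Fin n → H →L[ℂ] H) (lam : Fin n → ℝ) :
    ∏ B ∈ πf.1.parts, πf.cumulant J x T lam B = ∏ j, πf.blockFactor J x T lam j := by
  rw [Finset.prod_congr rfl fun B hB => cumulant_eq πf J x T lam hB,
    ← Finset.prod_biUnion (t := fun B => B) πf.1.disjoint]
  exact Finset.prod_congr πf.1.biUnion_parts fun _ _ => rfl

end Blocks

/-! ### Crossings and nestings as counts of open elements. -/

section Statistics

variable {n : ℕ}

open Classical in
-- Distinct blocks have distinct maxima, so `blockPairs` lists each unordered pair of blocks once.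
-- By asymmetry of `R`, the symmetrized count for such a pair is the sum of the counts for its two
-- orders, and a block paired with itself contributes nothing.
theorem sum_blockPairs (πf : PartitionB n) (R : Fin n × Fin n → Fin n × Fin n → Prop)
    (hR : ∀ a b, R a b → ¬ R b a)
    (hB : ∀ B, ∀ a ∈ blockArcs B, ∀ b ∈ blockArcs (n := n) B, ¬ R a b) :
    ∑ p ∈ πf.blockPairs, ((blockArcs p.1 ×ˢ blockArcs p.2).filter fun a =>
        R a.1 a.2 ∨ R a.2 a.1).card =
      ∑ a ∈ arcs πf.1, ((arcs πf.1).filter fun b => R a b).card := by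
  have hdisj : Set.PairwiseDisjoint (πf.1.parts : Set (Finset (Fin n))) blockArcs := by
    intro B hBp B' hBp' hne
    refine Finset.disjoint_left.2 fun a ha ha' => hne ?_
    exact πf.1.eq_of_mem_parts hBp hBp' (mem_blockArcs.1 ha).1 (mem_blockArcs.1 ha').1
  let c : Finset (Fin n) → Finset (Fin n) → ℕ := fun B B' =>
    ∑ a ∈ blockArcs B, ∑ b ∈ blockArcs B', if R a b then 1 else 0
  have hc0 : ∀ B, c B B = 0 := fun B => Finset.sum_eq_zero fun a ha =>
    Finset.sum_eq_zero fun b hb => if_neg (hB B a ha b hb)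
  have hrhs : ∑ a ∈ arcs πf.1, ((arcs πf.1).filter fun b => R a b).card =
      ∑ B ∈ πf.1.parts, ∑ B' ∈ πf.1.parts, c B B' := by
    have harcs : arcs πf.1 = πf.1.parts.biUnion blockArcs := rfl
    simp only [Finset.card_filter, harcs]
    rw [Finset.sum_biUnion hdisj]
    refine Finset.sum_congr rfl fun B _ => ?_
    exact (Finset.sum_congr rfl fun a _ => Finset.sum_biUnion hdisj).trans Finset.sum_comm
  have hlhs : ∀ p : Finset (Fin n) × Finset (Fin n),
      ((blockArcs p.1 ×ˢ blockArcs p.2).filter fun a => R a.1 a.2 ∨ R a.2 a.1).card =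
        c p.1 p.2 + c p.2 p.1 := by
    intro p
    rw [Finset.card_filter, Finset.sum_product]
    simp only [c]
    rw [Finset.sum_comm (s := blockArcs p.2), ← Finset.sum_add_distrib]
    refine Finset.sum_congr rfl fun a _ => ?_
    rw [← Finset.sum_add_distrib]
    refine Finset.sum_congr rfl fun b _ => ?_
    have := hR a b
    by_cases h1 : R a b <;> by_cases h2 : R b a <;> simp_all
  have hmax : ∀ B ∈ πf.1.parts, ∀ B' ∈ πf.1.parts, B.max = B'.max → B = B' := by
    intro B hBp B' hBp' h
    obtain ⟨m, hm⟩ := Finset.max_of_nonempty (πf.1.nonempty_of_mem_parts hBp)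
    exact πf.1.eq_of_mem_parts hBp hBp' (Finset.mem_of_max hm) (Finset.mem_of_max (h ▸ hm))
  rw [hrhs, Finset.sum_congr rfl fun p _ => hlhs p, blockPairs, Finset.sum_filter,
    Finset.sum_product]
  have hsplit : ∀ B ∈ πf.1.parts, ∀ B' ∈ πf.1.parts,
      c B B' = (if B.max < B'.max then c B B' else 0) + if B'.max < B.max then c B B' else 0 := by
    intro B hBp B' hBp'
    rcases lt_trichotomy B.max B'.max with h | h | h
    · rw [if_pos h, if_neg (lt_asymm h), add_zero]
    · rw [hmax B hBp B' hBp' h, hc0]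
      simp
    · rw [if_neg (lt_asymm h), if_pos h, zero_add]
  rw [Finset.sum_congr rfl fun B hBp => Finset.sum_congr rfl fun B' hBp' => hsplit B hBp B' hBp']
  have hite : ∀ (P : Prop) [Decidable P] (u v : ℕ),
      (if P then u + v else 0) = (if P then u else 0) + if P then v else 0 := by
    intro P _ u v
    split_ifs <;> rfl
  simp only [hite, Finset.sum_add_distrib]
  exact congrArg _ Finset.sum_comm

/-- No element of a block lies strictly between the ends of one of its arcs; this is why the
restriction to distinct blocks loses no crossing or nesting. -/
theorem not_lt_of_same_block {B : Finset (Fin n)} {a b : Fin n × Fin n} (ha : a ∈ blockArcs B)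
    (hb : b ∈ blockArcs B) : ¬ (a.1 < b.1 ∧ b.1 < a.2) := fun h =>
  absurd ((mem_blockArcs.1 ha).2.2.2 b.1 (mem_blockArcs.1 hb).1 h.1) (not_le.2 h.2)

/-- Each crossing is charged to the arc that closes first, which is the arc whose weight records it.
-/
theorem rc_eq (πf : PartitionB n) :
    πf.rc = ∑ a ∈ arcs πf.1,
      ((arcs πf.1).filter fun b => a.1 < b.1 ∧ b.1 < a.2 ∧ a.2 < b.2).card := by
  classical
  have h := sum_blockPairs πf (fun a b => a.1 < b.1 ∧ b.1 < a.2 ∧ a.2 < b.2)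
    (fun a b h h' => lt_asymm h.1 h'.1)
    (fun B a ha b hb h => not_lt_of_same_block ha hb ⟨h.1, h.2.1⟩)
  rw [rc]
  refine (Finset.sum_congr rfl fun p _ => congrArg Finset.card ?_).trans
    (h.trans (Finset.sum_congr rfl fun a _ => congrArg Finset.card ?_))
  · ext a
    simp only [Finset.mem_filter]
    exact Iff.rfl
  · ext a
    simp only [Finset.mem_filter]

/-- Each negative nesting is charged to its inner arc, whose colour is the one that matters. -/
theorem rnarc_eq (πf : PartitionB n) :
    πf.rnarc = ∑ a ∈ arcs πf.1, if πf.color a = -1 then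
      ((arcs πf.1).filter fun b => b.1 < a.1 ∧ a.2 < b.2).card else 0 := by
  classical
  have h := sum_blockPairs πf (fun a b => Nests b a ∧ πf.color a = -1)
    (fun a b h h' => lt_asymm h.1.1.1 h'.1.1.1)
    (fun B a ha b hb h => not_lt_of_same_block hb ha h.1.1)
  rw [rnarc]
  refine (Finset.sum_congr rfl fun p _ => congrArg Finset.card ?_).trans
    (h.trans (Finset.sum_congr rfl fun a ha => ?_))
  · ext a
    simp only [Finset.mem_filter]
    exact and_congr_right fun _ => or_comm
  · split_ifs with hc
    · refine congrArg Finset.card ?_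
      ext b
      have := arcs_lt ha
      simp only [Finset.mem_filter, Nests, hc, and_true]
      refine and_congr_right fun _ => ⟨?_, ?_⟩
      · rintro ⟨⟨h1, -⟩, -, h2⟩
        exact ⟨h1, h2⟩
      · rintro ⟨h1, h2⟩
        exact ⟨⟨h1, this.trans h2⟩, h1.trans this, h2⟩
    · simp [hc]

theorem mem_opensAt_toArcMap (πf : PartitionB n) (k : ℕ) (i : Fin n) :
    i ∈ πf.toArcMap.opensAt k ↔ i.val < k ∧ ∃ j : Fin n, k ≤ j.val ∧ (i, j) ∈ arcs πf.1 := by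
  simp [ArcMap.opensAt, toArcMap_eq_some]

/-- An open label above `a.1` at time `a.2` is the left end of exactly one arc. That arc ends
strictly after `a.2`, because right ends are distinct. -/
theorem above_eq (πf : PartitionB n) {a : Fin n × Fin n} (ha : a ∈ arcs πf.1) :
    above (πf.toArcMap.opensAt a.2) a.1 =
      ((arcs πf.1).filter fun b => a.1 < b.1 ∧ b.1 < a.2 ∧ a.2 < b.2).card := by
  classical
  rw [above, ← Finset.card_image_of_injOn (f := Prod.fst) (s := (arcs πf.1).filter _)]
  · congr 1
    ext i
    simp only [Finset.mem_filter, mem_opensAt_toArcMap, Finset.mem_image, Prod.exists,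
      exists_and_right, exists_eq_right]
    constructor
    · rintro ⟨⟨h1, j, h2, h3⟩, h4⟩
      refine ⟨j, h3, h4, h1, lt_of_le_of_ne h2 fun h => h4.ne ?_⟩
      exact congrArg Prod.fst (arcs_right_inj ha h3 h)
    · rintro ⟨j, h3, h4, h1, h2⟩
      exact ⟨⟨h1, j, h2.le, h3⟩, h4⟩
  · intro b hb b' hb' h
    exact arcs_left_inj (Finset.mem_filter.1 hb).1 (Finset.mem_filter.1 hb').1 h

theorem below_eq (πf : PartitionB n) {a : Fin n × Fin n} (ha : a ∈ arcs πf.1) :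
    below (πf.toArcMap.opensAt a.2) a.1 =
      ((arcs πf.1).filter fun b => b.1 < a.1 ∧ a.2 < b.2).card := by
  classical
  rw [below, ← Finset.card_image_of_injOn (f := Prod.fst) (s := (arcs πf.1).filter _)]
  · congr 1
    ext i
    simp only [Finset.mem_filter, mem_opensAt_toArcMap, Finset.mem_image, Prod.exists,
      exists_and_right, exists_eq_right]
    constructor
    · rintro ⟨⟨h1, j, h2, h3⟩, h4⟩
      refine ⟨j, h3, h4, lt_of_le_of_ne h2 fun h => h4.ne' ?_⟩
      exact congrArg Prod.fst (arcs_right_inj ha h3 h)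
    · rintro ⟨j, h3, h4, h2⟩
      exact ⟨⟨h4.trans (arcs_lt ha), j, h2.le, h3⟩, h4⟩
  · intro b hb b' hb' h
    exact arcs_left_inj (Finset.mem_filter.1 hb).1 (Finset.mem_filter.1 hb').1 h

/-- The part of the factor of `j` that depends on `α` and `q`. -/
def arcFactor (α q : ℝ) (πf : PartitionB n) (j : Fin n) : ℂ :=
  match πf.toArcMap j with
  | none => 1
  | some (i, e) => signWeight α q e (above (πf.toArcMap.opensAt j) i)
      (below (πf.toArcMap.opensAt j) i)

theorem prod_arcFactor_eq (α q : ℝ) (πf : PartitionB n) :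
    ∏ j, πf.arcFactor α q j = ∏ a ∈ arcs πf.1, signWeight α q (πf.color a)
      (above (πf.toArcMap.opensAt a.2) a.1) (below (πf.toArcMap.opensAt a.2) a.1) := by
  symm
  refine Finset.prod_of_injOn Prod.snd (fun a ha b hb h => arcs_right_inj ha hb h)
    (fun _ _ => Finset.mem_coe.2 (Finset.mem_univ _)) (fun j _ hj => ?_) (fun a ha => ?_)
  · have : πf.toArcMap j = none :=
      toArcMap_eq_none.2 fun i hi => hj ⟨(i, j), Finset.mem_coe.2 hi, rfl⟩
    rw [arcFactor, this]
  · rw [arcFactor, color_of_mem πf (show (a.1, a.2) ∈ arcs πf.1 from ha)]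

theorem signWeight_eq (α q : ℝ) (e : ℤˣ) (a b : ℕ) :
    signWeight α q e a b =
      (α : ℂ) ^ (if e = -1 then 1 else 0) * (q : ℂ) ^ (a + 2 * if e = -1 then b else 0) := by
  rcases Int.units_eq_one_or e with rfl | rfl <;> simp [signWeight]

theorem prod_arcFactor (α q : ℝ) (πf : PartitionB n) :
    ∏ j, πf.arcFactor α q j = (α : ℂ) ^ πf.narc * (q : ℂ) ^ (πf.rc + 2 * πf.rnarc) := by
  rw [prod_arcFactor_eq, narc, rc_eq, rnarc_eq, Finset.card_filter, Finset.mul_sum,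
    ← Finset.sum_add_distrib, ← Finset.prod_pow_eq_pow_sum, ← Finset.prod_pow_eq_pow_sum,
    ← Finset.prod_mul_distrib]
  refine Finset.prod_congr rfl fun a ha => ?_
  rw [signWeight_eq, above_eq πf ha, below_eq πf ha]

end Statistics

theorem factor_toArcMap {H : Type*} [NormedAddCommGroup H] [InnerProductSpace ℂ H] {n : ℕ}
    (α q : ℝ) (πf : PartitionB n) (J : H →L[ℂ] H) (x : Fin n → H) (T : Fin n → H →L[ℂ] H)
    (lam : Fin n → ℝ) (j : Fin n) :
    ArcMap.factor α q J x T lam πf.toArcMap x j =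
      πf.arcFactor α q j * πf.blockFactor J x T lam j := by
  unfold ArcMap.factor arcFactor blockFactor
  cases πf.toArcMap j with
  | none => exact (one_mul _).symm
  | some a => rfl

end PartitionB

end TypeBFock

end

/-! ### The Wick formula. -/

theorem mainTheorem1
    {E H : Type*} [NormedAddCommGroup E] [InnerProductSpace ℝ E] [CompleteSpace E]
    [TopologicalSpace.SeparableSpace E]
    [NormedAddCommGroup H] [InnerProductSpace ℂ H] [CompleteSpace H]
    (ι : E →ₗ[ℝ] H) (hι : TypeBFock.IsComplexification ι)
    (J : H →L[ℂ] H) (hJ : IsSelfAdjoint J) (hJJ : ∀ z, J (J z) = z)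
    (α q : ℝ) (hα : α ∈ Set.Ioo (-1 : ℝ) 1) (hq : q ∈ Set.Ioo (-1 : ℝ) 1)
    (T : E → H →L[ℂ] H) (hT : ∀ x, IsSelfAdjoint (T x))
    (n : ℕ) (x : Fin n → E) (lam : Fin n → ℝ) :
    TypeBFock.vacuumState α q J
        (List.ofFn fun i => TypeBFock.typeBOp α q J (ι (x i)) (T (x i)) (lam i)).reverse.prod =
      ∑ πf : TypeBFock.PartitionB n,
        (α : ℂ) ^ πf.narc * (q : ℂ) ^ (πf.rc + 2 * πf.rnarc) *
          ∏ B ∈ πf.1.parts,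
            πf.cumulant J (fun i => ι (x i)) (fun i => T (x i)) lam B := by
  rw [TypeBFock.vacuumState_typeBOp hJ hJJ α q (fun i => ι (x i)) (fun i => T (x i))
    (fun i => hT (x i)) lam, TypeBFock.ArcMap.wick_arcMap hJJ,
    TypeBFock.PartitionB.sum_valid_eq]
  refine Finset.sum_congr rfl fun πf _ => ?_
  rw [TypeBFock.PartitionB.prod_cumulant, ← TypeBFock.PartitionB.prod_arcFactor,
    ← Finset.prod_mul_distrib]
  exact Finset.prod_congr rfl fun j _ => TypeBFock.PartitionB.factor_toArcMap α q πf J _ _ lam j
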